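/- **Setting.** Let $d>2$, $p\ge 1$, $\Theta=\{\theta\in\mathbb R^{p-1}:\|\theta\|^2<1\}$, $\beta(\theta)=(\sqrt{1-\|\theta\|^2},\theta^T)^T\in\mathbb R^p$, and let $J(\theta)=\partial\beta/\partial\theta$ be the $p\times(p-1)$ matrix with first row $-\theta^T/\sqrt{1-\|\theta\|^2}$ above $I_{p-1}$. Let $(X,Y)\sim F_0$ with $X\in\mathcal X$ a.s., $\mathcal X\subset\mathbb R^p$ compact, and $Y\in\mathbb S^{d-1}\subset\mathbb R^d$. Put $U_\theta=X^T\beta(\theta)$. For $\theta\in\Theta$ let $U_\theta$ have density $f_\theta$, let $\mathcal U_\theta=\{f_\theta>0\}$, and let $Y$ have, given $U_\theta=u$, a conditional density $f_\theta(y|u)$ with respect to the unnormalized uniform measure $\sigma$ on $\mathbb S^{d-1}$. All conditional expectations of functions of $Y$ given $U_\theta=u$, $u\in\mathcal U_\theta$, are computed with $f_\theta(\cdot|u)$. For a loss $\psi:\mathbb R^d\to\mathbb R$ with gradient $\psi'$ and Hessian $\psi''$ let $$\mu_\theta(u)=\arg\min_{\mu\in\mathbb R^d}E[\psi(Y-\mu)\mid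 U_\theta=u],\qquad \theta_0=\arg\min_{\theta\in\Theta}E_{F_0}[\psi(Y-\mu_\theta(U_\theta))]\in\Theta .$$ For some $\kappa>0$, the conditional density of $Y$ given $X$ with respect to $\sigma$ is $c\,f(\kappa\,Y^T\tilde\mu(U_{\theta_0}))$, with $c>0$, a measurable $f\ge0$, and $\tilde\mu=\mu_{\theta_0}/\|\mu_{\theta_0}\|$, where $\mu_{\theta_0}\ne0$ on $\mathcal U_{\theta_0}$. Assume: * (A1) For each $\theta\in\Theta$, $\mathcal U_\theta$ is open and $f_\theta$ is $C^2$ on it. * (A2) For each compact $K\subset\Theta$ there is $L>0$ with $\|\mu_{\theta_1}(x^T\beta(\theta_1))-\mu_{\theta_2}(x^T\beta(\theta_2))\|\le L\|\theta_1-\theta_2\|$ for all $\theta_1,\theta_2\in K$ and all $x\in\mathcal X$ with $x^T\beta(\theta_i)\in\mathcal U_{\theta_i}$, $i=1,2$. For each $\theta\in\Theta$, $\theta\neq\theta_0$: $P(\mu_\theta(U_\theta)\ne\mu_{\theta_0}(U_{\theta_0}))>0$. * (A3) $\psi$ is differentiable with locally Lipschitz gradient, and $\psi''$ exists at $Y-\mu_\theta(u)$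 almost surely given $U_\theta=u$. The matrices $G(u;\theta)=E[\psi'(Y-\mu_\theta(u))\psi'(Y-\mu_\theta(u))^T|U_\theta=u]$ and $F(u;\theta)=E[\psi''(Y-\mu_\theta(u))|U_\theta=u]$ are continuous in $(u,\theta)$ and positive definite for $\theta\in\Theta$, $u\in\mathcal U_\theta$. * (A4) For $\theta\in\Theta$, $u\in\mathcal U_\theta$, the function $\zeta_\theta(t|u)=E[\psi(Y-\mu_\theta(u)+t)|U_\theta=u]$ is $C^2$ in $t$ and has $t=0$ as its unique minimizer; for all small $t$, $\zeta_\theta(t|\tilde u)$ and its first and second derivatives in $t$ are continuous and bounded in $\tilde u\in\mathcal U_\theta$ near $u$. * (A5) For $\theta\in\Theta$, $f_\theta(y|u)$ is continuous in $u\in\mathcal U_\theta$, and for each $u\in\mathcal U_\theta$ there are $\epsilon,\delta>0$ and a positive measurable function $g$ on $\mathbb S^{d-1}$ with $f_\theta(y|\tilde u)\le g(y)$ whenever $\tilde u\in\mathcal U_\theta$, $|\tilde u-u|\le\epsilon$, with $\int\|\psi'(y-\mu_\theta(u))\|^{2+\delta}g(y)\,\sigma(dy)<\infty$, and with $\int(\psi(y-t)-\psi(y)+t^T\psi'(y))^2g(y)\,\sigma(dy)=o(\|t\|^2)$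 as $t\to0$ (these integrals being finite for small $t$). * (Regularity) Each $\mu_\theta$ is measurable; $(\theta,u)\mapsto\mu_\theta(u)$ is $C^1$ near $(\theta_0,u)$ for every $u\in\mathcal U_{\theta_0}$; $\mu_{\theta_0}$ is bounded on $\mathcal U_{\theta_0}$; and $E[X|U_{\theta_0}=u]$ has a version continuous on $\mathcal U_{\theta_0}$, which is the one used below. With $\mu'=\mu'_{\theta_0}(U_{\theta_0})$ and $\Sigma_{X|U}$ the conditional covariance matrix of $X$ given $U_{\theta_0}$, let $$W_0=E[\mu'^TF(U_{\theta_0};\theta_0)\mu'\,J(\theta_0)^T\Sigma_{X|U}J(\theta_0)],\quad M_0=E[\mu'^TG(U_{\theta_0};\theta_0)\mu'\,J(\theta_0)^T\Sigma_{X|U}J(\theta_0)],$$ and assume that $W_0$ is invertible. **Influence function.** The functional behind the M-estimator $\hat\theta$ is $T(F)=\arg\min_\theta E_F[\psi(Y-\mu_\theta(U_\theta))]$, where $\mu_\theta$ is the population link family defined above from $F_0$. For $z=(x,y)$ let $F_t=(1-t)F_0+t\delta_z$. The statement $\mathrm{IF}(z;\hat\theta,F_0)=v$ means: there is a closed ball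 $B\subset\Theta$ of positive radius centred at $\theta_0$ such that $\theta_0$ minimizes the criterion at $F_0$ over $B$, the criterion at $F_t$ has a minimizer over $B$ for all small $t>0$, and every choice $T(F_t)$ of such minimizers satisfies $(T(F_t)-\theta_0)/t\to v$ as $t\downarrow0$. Let $\Sigma_{\hat\theta;F_0}=E[\mathrm{IF}(Z)\mathrm{IF}(Z)^T]$, $Z\sim F_0$, and $\mathrm{SIF}(z;\hat\theta,F_0,\Sigma)=\{\mathrm{IF}(z)^T\Sigma^{-1}\mathrm{IF}(z)\}^{1/2}$. **Theorem.** For all $z=(x,y)$ with $x\in\mathcal X$, $u=x^T\beta(\theta_0)\in\mathcal U_{\theta_0}$ and $y\in\mathbb S^{d-1}$: (i) the influence function exists and $$\mathrm{IF}(z;\hat\theta,F_0)=\psi'(y-\mu_{\theta_0}(u))^T\mu'_{\theta_0}(u)\;W_0^{-1}J(\theta_0)^T\bigl(x-E[X|U_{\theta_0}=u]\bigr);$$ (ii) $\Sigma_{\hat\theta;F_0}=W_0^{-1}M_0W_0^{-1}$ and, if this matrix is invertible, $$\mathrm{SIF}(z;\hat\theta,F_0,\Sigma_{\hat\theta;F_0})=\bigl|\psi'(y-\mu_{\theta_0}(u))^T\mu'_{\theta_0}(u)\bigr|\Bigl\{(x-E[X|U_{\theta_0}=u])^TJ(\theta_0)M_0^{-1}J(\theta_0)^T(x-E[X|U_{\theta_0}=u])\Bigr\}^{1/2}.$$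 -/

import Mathlib

open MeasureTheory Filter Topology Set Asymptotics

noncomputable section

/-- Euclidean space `ℝⁿ`. -/
abbrev Euc (n : ℕ) : Type := EuclideanSpace ℝ (Fin n)

/-- The unit sphere `S^{d-1}` of `ℝ^d`. -/
abbrev Sph (d : ℕ) : Type := Metric.sphere (0 : Euc d) 1

/-- The unnormalized uniform (surface) measure on `S^{d-1}`. -/
def surf (d : ℕ) : Measure (Sph d) := (volume : Measure (Euc d)).toSphere

/-- The parameter space: the open unit ball of `ℝ^k`, where `k = p - 1`. -/
def paramSpace (k : ℕ) : Set (Euc k) := {θ | ‖θ‖ ^ 2 < 1}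

/-- `β(θ) = (√(1 - ‖θ‖²), θ)`, a vector of `ℝ^p` with `p = k + 1`. -/
def betaOf {k : ℕ} (θ : Euc k) : Euc (k + 1) :=
  WithLp.toLp 2 (Fin.cons (Real.sqrt (1 - ‖θ‖ ^ 2)) (fun j => θ j))

/-- The `p × (p-1)` Jacobian matrix of `β`: the first row is `-θᵀ / √(1 - ‖θ‖²)`, and below it
stands the identity matrix. -/
def jac {k : ℕ} (θ : Euc k) : Matrix (Fin (k + 1)) (Fin k) ℝ :=
  Matrix.of (Fin.cons (fun j => -θ j / Real.sqrt (1 - ‖θ‖ ^ 2))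
    (fun i j => (1 : Matrix (Fin k) (Fin k) ℝ) i j))

/-- The projection index `u_θ = xᵀ β(θ)`. -/
def idx {k : ℕ} (θ : Euc k) (x : Euc (k + 1)) : ℝ := inner ℝ x (betaOf θ)

/-- The contaminated distribution `(1 - t) F + t δ_z`. -/
def contaminate {Z : Type*} [MeasurableSpace Z] (F : Measure Z) (z : Z) (t : ℝ) : Measure Z :=
  ENNReal.ofReal (1 - t) • F + ENNReal.ofReal t • Measure.dirac z

/-- The data of an extrinsic single-index model with responses in `S^{d-1}` and predictors in
`ℝ^{k+1}`. What the densities, the link functions and `θ₀` have to satisfy is stated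
separately below. -/
structure ESIM (d k : ℕ) where
  /-- the joint distribution `F₀` of `(X, Y)` -/
  law : Measure (Euc (k + 1) × Sph d)
  /-- `F₀` is a probability distribution -/
  prob : IsProbabilityMeasure law
  /-- the set that contains the values of `X` -/
  dom : Set (Euc (k + 1))
  /-- the loss function `ψ` -/
  loss : Euc d → ℝ
  /-- the link functions: `link θ u` is `μ_θ(u)` -/
  link : Euc k → ℝ → Euc d
  /-- the marginal density of `U_θ = Xᵀ β(θ)` -/
  idxDens : Euc k → ℝ → ℝ
  /-- the conditional density `f_θ(y | u)` of `Y` given `U_θ = u`, with respect to the surface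
  measure; the arguments are `θ`, `u`, `y` -/
  condDens : Euc k → ℝ → Sph d → ℝ
  /-- the true parameter -/
  θ₀ : Euc k

namespace ESIM

variable {d k : ℕ} (M : ESIM d k)

/-- The support `𝒰_θ` of the index `U_θ`: the set on which its density is positive. -/
def supp (θ : Euc k) : Set ℝ := {u | 0 < M.idxDens θ u}

/-- `E[h(Y) | U_θ = u]`, computed with the conditional density. -/
def condE (θ : Euc k) (u : ℝ) (h : Euc d → ℝ) : ℝ :=
  ∫ y, h (y : Euc d) * M.condDens θ u y ∂(surf d)

/-- `idxDens θ` is a density of `U_θ`, and `condDens θ` is a conditional density of `Y` given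
`U_θ`, for every `θ ∈ Θ`. -/
structure HasDensities : Prop where
  meas_idx : ∀ θ ∈ paramSpace k, Measurable (M.idxDens θ)
  meas_cond : ∀ θ ∈ paramSpace k, Measurable (fun w : ℝ × Sph d => M.condDens θ w.1 w.2)
  idx_law : ∀ θ ∈ paramSpace k, M.law.map (fun z => idx θ z.1) =
    volume.withDensity (fun u => ENNReal.ofReal (M.idxDens θ u))
  nonneg : ∀ θ ∈ paramSpace k, ∀ u, 0 ≤ M.idxDens θ u
  cond_nonneg : ∀ θ ∈ paramSpace k, ∀ u ∈ M.supp θ, ∀ y, 0 ≤ M.condDens θ u y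
  cond_one : ∀ θ ∈ paramSpace k, ∀ u ∈ M.supp θ, ∫ y, M.condDens θ u y ∂(surf d) = 1
  joint_law : ∀ θ ∈ paramSpace k, M.law.map (fun z => (idx θ z.1, z.2)) =
    ((volume : Measure ℝ).prod (surf d)).withDensity
      (fun w => ENNReal.ofReal (M.idxDens θ w.1 * M.condDens θ w.1 w.2))

/-- `μ_θ(u)` minimizes `μ ↦ E[ψ(Y - μ) | U_θ = u]` over `ℝ^d`, for `θ ∈ Θ` and `u ∈ 𝒰_θ`. -/
def IsLink : Prop :=
  ∀ θ ∈ paramSpace k, ∀ u ∈ M.supp θ, ∀ m : Euc d,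
    M.condE θ u (fun y => M.loss (y - M.link θ u)) ≤ M.condE θ u (fun y => M.loss (y - m))

/-- The criterion `θ ↦ E_F[ψ(Y - μ_θ(U_θ))]` of the M-estimator at a distribution `F` of `(X, Y)`. -/
def crit (F : Measure (Euc (k + 1) × Sph d)) (θ : Euc k) : ℝ :=
  ∫ z, M.loss ((z.2 : Euc d) - M.link θ (idx θ z.1)) ∂F

/-- `θ₀` minimizes the criterion at `F₀` over the parameter space. -/
def IsTrueParam : Prop :=
  M.θ₀ ∈ paramSpace k ∧ IsMinOn (M.crit M.law) (paramSpace k) M.θ₀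

/-- The population mean curve `μ_{θ₀}(u) / ‖μ_{θ₀}(u)‖`. -/
def meanCurve (u : ℝ) : Euc d := ‖M.link M.θ₀ u‖⁻¹ • M.link M.θ₀ u

/-- `F₀` belongs to the class of joint distributions with concentration `κ`: the conditional
density of `Y` given `X` is `c f(κ yᵀ μ̃(U_{θ₀}))` for an angular function `f`. -/
def InClass (κ : ℝ) : Prop :=
  (∀ u ∈ M.supp M.θ₀, M.link M.θ₀ u ≠ 0) ∧
  ∃ (f : ℝ → ℝ) (c : ℝ), Measurable f ∧ (∀ s, 0 ≤ f s) ∧ 0 < c ∧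
    M.law = ((M.law.map Prod.fst).prod (surf d)).withDensity (fun z =>
      ENNReal.ofReal (c * f (κ * inner ℝ (z.2 : Euc d) (M.meanCurve (idx M.θ₀ z.1)))))

/-- `G(u; θ) = E[ψ'(Y - μ_θ(u)) ψ'(Y - μ_θ(u))ᵀ | U_θ = u]`. -/
def Gmat (θ : Euc k) (u : ℝ) : Matrix (Fin d) (Fin d) ℝ :=
  Matrix.of fun i j => M.condE θ u fun y =>
    gradient M.loss (y - M.link θ u) i * gradient M.loss (y - M.link θ u) j

/-- `F(u; θ) = E[ψ''(Y - μ_θ(u)) | U_θ = u]`, with `ψ''` the Hessian matrix. -/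
def Fmat (θ : Euc k) (u : ℝ) : Matrix (Fin d) (Fin d) ℝ :=
  Matrix.of fun i j => M.condE θ u fun y =>
    (fderiv ℝ (gradient M.loss) (y - M.link θ u) (EuclideanSpace.single j 1)) i

/-- `ζ_θ(t | u) = E[ψ(Y - μ_θ(u) + t) | U_θ = u]`. -/
def zeta (θ : Euc k) (u : ℝ) (t : Euc d) : ℝ :=
  M.condE θ u fun y => M.loss (y - M.link θ u + t)

/-- Assumption (A1). -/
structure A1 : Prop where
  compact : IsCompact M.dom
  mem_dom : ∀ᵐ z ∂M.law, z.1 ∈ M.dom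
  supp_open : ∀ θ ∈ paramSpace k, IsOpen (M.supp θ)
  smooth : ∀ θ ∈ paramSpace k, ContDiffOn ℝ 2 (M.idxDens θ) (M.supp θ)

/-- Assumption (A2). The Lipschitz condition is required locally uniformly in the open ball `Θ`. -/
structure A2 : Prop where
  lipschitz : ∀ K ⊆ paramSpace k, IsCompact K → ∃ L : ℝ, 0 < L ∧
    ∀ θ₁ ∈ K, ∀ θ₂ ∈ K, ∀ x ∈ M.dom, idx θ₁ x ∈ M.supp θ₁ → idx θ₂ x ∈ M.supp θ₂ →
      ‖M.link θ₁ (idx θ₁ x) - M.link θ₂ (idx θ₂ x)‖ ≤ L * ‖θ₁ - θ₂‖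
  identifiable : ∀ θ ∈ paramSpace k, θ ≠ M.θ₀ →
    0 < M.law {z | M.link θ (idx θ z.1) ≠ M.link M.θ₀ (idx M.θ₀ z.1)}

/-- Assumption (A3). The loss has a gradient, which is locally Lipschitz, and a Hessian at almost
every residual (so that the Huber and the biweight loss are included). -/
structure A3 : Prop where
  diff : Differentiable ℝ M.loss
  grad_lipschitz : LocallyLipschitz (gradient M.loss)
  hess : ∀ θ ∈ paramSpace k, ∀ u ∈ M.supp θ, ∀ᵐ y ∂(surf d), M.condDens θ u y ≠ 0 →
    DifferentiableAt ℝ (gradient M.loss) ((y : Euc d) - M.link θ u)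
  G_cont : ContinuousOn (fun w : Euc k × ℝ => M.Gmat w.1 w.2)
    {w | w.1 ∈ paramSpace k ∧ w.2 ∈ M.supp w.1}
  F_cont : ContinuousOn (fun w : Euc k × ℝ => M.Fmat w.1 w.2)
    {w | w.1 ∈ paramSpace k ∧ w.2 ∈ M.supp w.1}
  G_pos : ∀ θ ∈ paramSpace k, ∀ u ∈ M.supp θ, (M.Gmat θ u).PosDef
  F_pos : ∀ θ ∈ paramSpace k, ∀ u ∈ M.supp θ, (M.Fmat θ u).PosDef

/-- Assumption (A4). -/
structure A4 : Prop where
  unique_min : ∀ θ ∈ paramSpace k, ∀ u ∈ M.supp θ, ∀ t : Euc d, t ≠ 0 →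
    M.zeta θ u 0 < M.zeta θ u t
  smooth : ∀ θ ∈ paramSpace k, ∀ u ∈ M.supp θ, ContDiff ℝ 2 (M.zeta θ u)
  locally_cont : ∀ θ ∈ paramSpace k, ∀ u ∈ M.supp θ, ∃ ε > 0, ∃ C : ℝ, ∀ t : Euc d, ‖t‖ < ε →
    ContinuousOn (fun v => M.zeta θ v t) (M.supp θ ∩ Metric.ball u ε) ∧
    ContinuousOn (fun v => gradient (M.zeta θ v) t) (M.supp θ ∩ Metric.ball u ε) ∧
    ContinuousOn (fun v => fderiv ℝ (gradient (M.zeta θ v)) t) (M.supp θ ∩ Metric.ball u ε) ∧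
    ∀ v ∈ M.supp θ ∩ Metric.ball u ε, |M.zeta θ v t| ≤ C ∧ ‖gradient (M.zeta θ v) t‖ ≤ C ∧
      ‖fderiv ℝ (gradient (M.zeta θ v)) t‖ ≤ C

/-- Assumption (A5). -/
structure A5 : Prop where
  cont : ∀ θ ∈ paramSpace k, ∀ y, ContinuousOn (fun u => M.condDens θ u y) (M.supp θ)
  dominated : ∀ θ ∈ paramSpace k, ∀ u ∈ M.supp θ, ∃ ε > 0, ∃ δ > 0, ∃ g : Sph d → ℝ,
    Measurable g ∧ (∀ y, 0 < g y) ∧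
    (∀ v ∈ M.supp θ, |v - u| ≤ ε → ∀ y, M.condDens θ v y ≤ g y) ∧
    Integrable (fun y : Sph d =>
      ‖gradient M.loss ((y : Euc d) - M.link θ u)‖ ^ (2 + δ : ℝ) * g y) (surf d) ∧
    (∀ᶠ t in 𝓝 (0 : Euc d), Integrable (fun y : Sph d =>
      (M.loss ((y : Euc d) - t) - M.loss y + inner ℝ t (gradient M.loss (y : Euc d))) ^ 2 * g y)
      (surf d)) ∧
    (fun t : Euc d => ∫ y : Sph d,
      (M.loss ((y : Euc d) - t) - M.loss y + inner ℝ t (gradient M.loss (y : Euc d))) ^ 2 * g y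
      ∂(surf d)) =o[𝓝 0] fun t => ‖t‖ ^ 2

/-- Regularity of the link functions: measurability, `(θ, u) ↦ μ_θ(u)` is continuously
differentiable near `(θ₀, u)` for every `u ∈ 𝒰_{θ₀}`, and `μ_{θ₀}` is bounded on `𝒰_{θ₀}`. -/
structure LinkRegular : Prop where
  meas : ∀ θ ∈ paramSpace k, Measurable (M.link θ)
  smooth : ∀ u ∈ M.supp M.θ₀, ContDiffAt ℝ 1 (fun w : Euc k × ℝ => M.link w.1 w.2) (M.θ₀, u)
  bounded : ∃ C : ℝ, ∀ u ∈ M.supp M.θ₀, ‖M.link M.θ₀ u‖ ≤ C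

/-- The σ-algebra generated by `U_{θ₀}`. -/
abbrev sigmaU : MeasurableSpace (Euc (k + 1) × Sph d) :=
  MeasurableSpace.comap (fun z => idx M.θ₀ z.1) inferInstance

/-- `E[X | U_{θ₀}]`, as a random vector. -/
def condMeanX : Euc (k + 1) × Sph d → Euc (k + 1) :=
  condExp M.sigmaU M.law (fun z => z.1)

/-- `e u` is the conditional mean `E[X | U_{θ₀} = u]` for `u ∈ 𝒰_{θ₀}`, in its continuous version. -/
structure IsCondMean (e : ℝ → Euc (k + 1)) : Prop where
  ae_eq : ∀ᵐ z ∂M.law, e (idx M.θ₀ z.1) = M.condMeanX z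
  cont : ContinuousOn e (M.supp M.θ₀)

/-- The conditional covariance matrix `Σ_{X | U_{θ₀}}`, as a random matrix. -/
def condCovX (z : Euc (k + 1) × Sph d) : Matrix (Fin (k + 1)) (Fin (k + 1)) ℝ :=
  Matrix.of fun i j => condExp M.sigmaU M.law
    (fun w => (w.1 - M.condMeanX w) i * (w.1 - M.condMeanX w) j) z

/-- `E[μ'(U)ᵀ A(U) μ'(U) Jᵀ Σ_{X|U} J]` with `μ = μ_{θ₀}`, `U = U_{θ₀}`, `J = J(θ₀)`. -/
def weighted (A : ℝ → Matrix (Fin d) (Fin d) ℝ) : Matrix (Fin k) (Fin k) ℝ :=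
  Matrix.of fun i j => ∫ z,
    (let m : Fin d → ℝ := (deriv (M.link M.θ₀) (idx M.θ₀ z.1)).ofLp
     m ⬝ᵥ (A (idx M.θ₀ z.1)).mulVec m) *
    ((jac M.θ₀).transpose * M.condCovX z * jac M.θ₀) i j ∂M.law

/-- The matrix `W₀`. -/
def W₀ : Matrix (Fin k) (Fin k) ℝ := M.weighted (M.Fmat M.θ₀)

/-- The matrix `M₀`. -/
def M₀ : Matrix (Fin k) (Fin k) ℝ := M.weighted (M.Gmat M.θ₀)

/-- `v` is the influence function at `z`, at `F₀`, of the argmin functional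
`T(F) = argmin_θ E_F[ψ(Y - μ_θ(U_θ))]` near `θ₀ = T(F₀)`: on some closed ball around `θ₀` inside
`Θ`, the criterion at `F₀` is minimal at `θ₀`, the criterion at `F_t = (1 - t) F₀ + t δ_z` has a
minimizer for every small `t > 0`, and every choice `T t` of such minimizers satisfies
`(T t - θ₀) / t → v` as `t ↓ 0`. -/
def HasInfluence (z : Euc (k + 1) × Sph d) (v : Euc k) : Prop :=
  ∃ r > 0, Metric.closedBall M.θ₀ r ⊆ paramSpace k ∧
    IsMinOn (M.crit M.law) (Metric.closedBall M.θ₀ r) M.θ₀ ∧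
    (∀ᶠ t in 𝓝[>] (0 : ℝ), ∃ θ ∈ Metric.closedBall M.θ₀ r,
      IsMinOn (M.crit (contaminate M.law z t)) (Metric.closedBall M.θ₀ r) θ) ∧
    ∀ T : ℝ → Euc k,
      (∀ᶠ t in 𝓝[>] (0 : ℝ), T t ∈ Metric.closedBall M.θ₀ r ∧
        IsMinOn (M.crit (contaminate M.law z t)) (Metric.closedBall M.θ₀ r) (T t)) →
      Tendsto (fun t => t⁻¹ • (T t - M.θ₀)) (𝓝[>] 0) (𝓝 v)

open Classical in
/-- The influence function `IF(z; θ̂, F₀)` (zero where it does not exist). -/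
def influence (z : Euc (k + 1) × Sph d) : Euc k :=
  if h : ∃ v, M.HasInfluence z v then h.choose else 0

/-- The dispersion matrix `E[IF(Z) IF(Z)ᵀ]`. -/
def dispersion : Matrix (Fin k) (Fin k) ℝ :=
  Matrix.of fun i j => ∫ z, M.influence z i * M.influence z j ∂M.law

/-- The standardized influence function `(IF(z)ᵀ S⁻¹ IF(z))^{1/2}` with respect to `S`. -/
def stdInfluence (S : Matrix (Fin k) (Fin k) ℝ) (z : Euc (k + 1) × Sph d) : ℝ :=
  Real.sqrt ((M.influence z).ofLp ⬝ᵥ S⁻¹.mulVec (M.influence z).ofLp)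

/-- The scalar `ψ'(y - μ_{θ₀}(u))ᵀ μ'_{θ₀}(u)` with `u = xᵀ β(θ₀)`. -/
def score (z : Euc (k + 1) × Sph d) : ℝ :=
  inner ℝ (gradient M.loss ((z.2 : Euc d) - M.link M.θ₀ (idx M.θ₀ z.1)))
    (deriv (M.link M.θ₀) (idx M.θ₀ z.1))

/-- The vector `J(θ₀)ᵀ (x - e(u))` with `u = xᵀ β(θ₀)`. -/
def dir (e : ℝ → Euc (k + 1)) (x : Euc (k + 1)) : Fin k → ℝ :=
  (jac M.θ₀).transpose.mulVec (x - e (idx M.θ₀ x)).ofLp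

end ESIM

end

/-! At `F_t` the criterion is `(1 - t) R(θ) + t h(θ)`, where `R` is the criterion at `F₀` and `h(θ)
= ψ(y - μ_θ(xᵀβ(θ)))`. If `θ₀` is the only minimizer of `R` on a ball, `R` has the quadratic
expansion `½ (θ - θ₀)ᵀ W₀ (θ - θ₀)` with `W₀` positive definite, and `h` has gradient `-W₀ v` at
`θ₀`, then the minimizers are `θ₀ + t v + o(t)`. This is `tendsto_argmin_of_perturb` followed by
`tendsto_scaled_argmin_of_perturb`.

The heart of the matter is the derivative of the fitted value `μ_θ(xᵀβ(θ))` at `θ₀`, which is `μ'(u)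
(x - E[X | U = u])ᵀ J` (`fitDeriv_eq`). The chain rule through the index gives `μ'(u) xᵀ J`. The
remaining part, `∂_θ μ_θ(u)`, is found by differentiating `E[φ(U_θ) ψ'(Y - μ_θ(U_θ))] = 0` in `θ`
(`integral_test_mul_inner_hess_eq_zero`). The term in which `φ` is differentiated drops out: in the
model class `Y` depends on `X` only through `U_{θ₀}`, so `ψ'` at the true residual is centred even
given `X`. The rest says that `F(u) (∂_θ μ_θ(u) + μ'(u) E[X | U = u]ᵀ J)`, weighted by the density
of `U`, integrates to zero against every test function. Continuity and positive definiteness of `F`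
force the bracket to vanish (`linkDeriv_fst_eq`).

The same centring removes the linear term of `R`, so that once differentiable links suffice for the
quadratic expansion (`isLittleO_crit`). Conditioning on `X` replaces `ψ''` by `F`, and conditioning
on `U` produces `Σ_{X|U}` (`weighted_apply`), so the quadratic form is that of `W₀`. Uniqueness of
the minimizer comes from (A4) and identifiability (`crit_lt_crit`). The second moment of the score
gives `G` in place of `F`, hence the sandwich form of the dispersion, in which `W₀` cancels after
standardization. -/

noncomputable section

/-! ### Minimizers of a perturbed criterion -/

section Argmin

/-- Minimizers of a small perturbation of a function with a unique minimizer converge to it. -/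
theorem tendsto_argmin_of_perturb {E : Type*} [NormedAddCommGroup E] [ProperSpace E]
    {R h : E → ℝ} {x₀ : E} {r : ℝ} (hr : 0 < r)
    (hR : ContinuousOn R (Metric.closedBall x₀ r)) (hh : ContinuousOn h (Metric.closedBall x₀ r))
    (hmin : ∀ x ∈ Metric.closedBall x₀ r, x ≠ x₀ → R x₀ < R x) {T : ℝ → E}
    (hT : ∀ᶠ t in 𝓝[>] (0 : ℝ), T t ∈ Metric.closedBall x₀ r ∧
      IsMinOn (fun x => (1 - t) * R x + t * h x) (Metric.closedBall x₀ r) (T t)) :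
    Tendsto T (𝓝[>] 0) (𝓝 x₀) := by
  have hx₀ : x₀ ∈ Metric.closedBall x₀ r := Metric.mem_closedBall_self hr.le
  obtain ⟨H, hH⟩ := (isCompact_closedBall x₀ r).exists_bound_of_continuousOn hh
  rw [Metric.tendsto_nhds]
  intro ε hε
  set K := Metric.closedBall x₀ r \ Metric.ball x₀ ε with hK
  have hKc : IsCompact K := (isCompact_closedBall x₀ r).diff Metric.isOpen_ball
  -- Away from `x₀` the values of `R` exceed the minimum by a fixed `η`; a minimizer there would
  -- force `(1 - t) η ≤ 2 t H`, which fails for small `t`.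
  have hη : ∃ η > 0, ∀ x ∈ K, R x₀ + η ≤ R x := by
    rcases K.eq_empty_or_nonempty with h0 | h0
    · exact ⟨1, one_pos, by simp [h0]⟩
    · obtain ⟨m, hm, hmm⟩ := hKc.exists_isMinOn h0 (hR.mono sdiff_subset)
      have hne : m ≠ x₀ := by
        rintro rfl
        exact hm.2 (Metric.mem_ball_self hε)
      refine ⟨R m - R x₀, sub_pos.2 (hmin m hm.1 hne), fun x hx => ?_⟩
      have := hmm hx
      simp only [mem_ofPred_eq] at this
      linarith
  obtain ⟨η, hη0, hη⟩ := hη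
  have hsmall : ∀ᶠ t in 𝓝[>] (0 : ℝ), (1 - t) * η - 2 * t * H > 0 := by
    have : Tendsto (fun t : ℝ => (1 - t) * η - 2 * t * H) (𝓝[>] 0)
        (𝓝 ((1 - 0) * η - 2 * 0 * H)) := by
      apply Tendsto.mono_left _ nhdsWithin_le_nhds
      exact Continuous.tendsto (by fun_prop) 0
    exact this.eventually_const_lt (by simpa using hη0)
  have h1 : ∀ᶠ t in 𝓝[>] (0 : ℝ), t < 1 :=
    mem_nhdsWithin_of_mem_nhds (Iio_mem_nhds one_pos)
  filter_upwards [hT, hsmall, h1, self_mem_nhdsWithin] with t ht hs ht1 ht0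
  by_contra hcon
  have hTK : T t ∈ K := ⟨ht.1, hcon⟩
  have e1 := hη _ hTK
  have e2 := ht.2 hx₀
  simp only [mem_ofPred_eq] at e2
  have e3 := abs_le.1 (hH _ ht.1)
  have e4 := abs_le.1 (hH _ hx₀)
  have ht0' : (0 : ℝ) < t := ht0
  nlinarith [mul_le_mul_of_nonneg_left e1 (by linarith : (0 : ℝ) ≤ 1 - t),
    mul_le_mul_of_nonneg_left e3.1 ht0'.le, mul_le_mul_of_nonneg_left e4.2 ht0'.le]

variable {E : Type*} [NormedAddCommGroup E] [InnerProductSpace ℝ E]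

/-- First-order expansion of the minimizers of `(1 - t) R + t h` as `t ↓ 0`, when `R` has a
positive definite quadratic expansion and `h` is differentiable at the minimizer of `R`. -/
theorem tendsto_scaled_argmin_of_perturb {R h : E → ℝ} {x₀ : E} {r : ℝ}
    (hr : 0 < r) {W : E →L[ℝ] E} (hsymm : ∀ v w, inner ℝ (W v) w = inner ℝ v (W w))
    {c : ℝ} (hc : 0 < c) (hpos : ∀ v, c * ‖v‖ ^ 2 ≤ inner ℝ v (W v))
    (hR : (fun x => R x - R x₀ - 2⁻¹ * inner ℝ (x - x₀) (W (x - x₀))) =o[𝓝 x₀]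
      fun x => ‖x - x₀‖ ^ 2)
    {v : E} (hh : (fun x => h x - h x₀ + inner ℝ (x - x₀) (W v)) =o[𝓝 x₀] fun x => ‖x - x₀‖)
    {T : ℝ → E} (hTlim : Tendsto T (𝓝[>] 0) (𝓝 x₀))
    (hT : ∀ᶠ t in 𝓝[>] (0 : ℝ),
      IsMinOn (fun x => (1 - t) * R x + t * h x) (Metric.closedBall x₀ r) (T t)) :
    Tendsto (fun t => t⁻¹ • (T t - x₀)) (𝓝[>] 0) (𝓝 v) := by
  have hx₀ : x₀ ∈ Metric.closedBall x₀ r := Metric.mem_closedBall_self hr.le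
  have hpos0 : ∀ᶠ t in 𝓝[>] (0 : ℝ), (0 : ℝ) < t := self_mem_nhdsWithin
  have hid : Tendsto (fun t : ℝ => t) (𝓝[>] 0) (𝓝 0) := nhdsWithin_le_nhds
  -- the minimizers approach at rate `t`
  have hO : ∃ A, 0 < A ∧ ∀ᶠ t in 𝓝[>] (0 : ℝ), ‖T t - x₀‖ ≤ A * t := by
    have e1 := hTlim.eventually (hR.bound (by positivity : 0 < c / 4))
    have e2 := hTlim.eventually (hh.bound one_pos)
    have e3 : ∀ᶠ t in 𝓝[>] (0 : ℝ), t < 1 / 2 :=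
      mem_nhdsWithin_of_mem_nhds (Iio_mem_nhds (by norm_num))
    -- Half of the quadratic bound `c / 2` is spent on the remainder of `R`, which leaves `c / 4`;
    -- the factor `1 - t ≥ 1 / 2` leaves `c / 8`, set against the slope `1 + ‖W v‖` of `h`.
    refine ⟨8 / c * (1 + ‖W v‖), by positivity, ?_⟩
    filter_upwards [e1, e2, e3, hT, hpos0] with t h1 h2 h3 h4 h5
    have h6 := h4 hx₀
    simp only [mem_ofPred_eq] at h6
    set δ := T t - x₀
    rw [Real.norm_eq_abs, norm_pow, norm_norm] at h1
    rw [Real.norm_eq_abs, norm_norm] at h2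
    have h1' := (abs_le.1 h1).1
    have h2' := (abs_le.1 h2).1
    have h7 := hpos δ
    have h8 := real_inner_le_norm δ (W v)
    have h9 : c / 4 * ‖δ‖ ^ 2 ≤ R (T t) - R x₀ := by linarith
    have h10 : -((1 + ‖W v‖) * ‖δ‖) ≤ h (T t) - h x₀ := by nlinarith
    have h11 : (1 - t) * (c / 4 * ‖δ‖ ^ 2) ≤ t * ((1 + ‖W v‖) * ‖δ‖) := by
      have := mul_le_mul_of_nonneg_left h9 (by linarith : (0 : ℝ) ≤ 1 - t)
      have := mul_le_mul_of_nonneg_left h10 h5.le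
      nlinarith
    have h12 : (1 / 2) * (c / 4 * ‖δ‖ ^ 2) ≤ t * ((1 + ‖W v‖) * ‖δ‖) := by
      have : (0 : ℝ) ≤ c / 4 * ‖δ‖ ^ 2 := by positivity
      nlinarith
    rcases (norm_nonneg δ).eq_or_lt with h0 | h0
    · rw [← h0]; positivity
    · have h13 : ‖δ‖ * c ≤ 8 * (1 + ‖W v‖) * t := by
        have : (‖δ‖ * c) * ‖δ‖ ≤ (8 * (1 + ‖W v‖) * t) * ‖δ‖ := by nlinarith
        exact le_of_mul_le_mul_right this h0
      calc ‖δ‖ = ‖δ‖ * c / c := by field_simp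
        _ ≤ 8 * (1 + ‖W v‖) * t / c := by gcongr
        _ = _ := by ring
  obtain ⟨A, hA, hO⟩ := hO
  -- the comparison point `x₀ + t v`
  set S : ℝ → E := fun t => x₀ + t • v with hS
  have hSlim : Tendsto S (𝓝[>] 0) (𝓝 x₀) := by
    have : Tendsto S (𝓝[>] 0) (𝓝 (x₀ + (0 : ℝ) • v)) :=
      tendsto_const_nhds.add (hid.smul_const v)
    simpa using this
  have hTO : (fun t => T t - x₀) =O[𝓝[>] 0] fun t => t := by
    refine IsBigO.of_bound A ?_
    filter_upwards [hO, hpos0] with t h1 h2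
    rwa [Real.norm_eq_abs, abs_of_pos h2]
  have hSO : (fun t => S t - x₀) =O[𝓝[>] 0] fun t => t := by
    simp only [hS, add_sub_cancel_left]
    exact IsBigO.of_bound ‖v‖ (Eventually.of_forall fun t => by
      rw [norm_smul, mul_comm])
  -- expansion of the criterion along any path with rate `t`
  have hexp : ∀ P : ℝ → E, Tendsto P (𝓝[>] 0) (𝓝 x₀) →
      ((fun t => P t - x₀) =O[𝓝[>] 0] fun t => t) →
      (fun t => ((1 - t) * R (P t) + t * h (P t)) - ((1 - t) * R x₀ + t * h x₀) -
        (2⁻¹ * inner ℝ (P t - x₀) (W (P t - x₀)) - t * inner ℝ (P t - x₀) (W v)))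
        =o[𝓝[>] 0] fun t => t ^ 2 := by
    intro P hP hPO
    have hPn : (fun t => ‖P t - x₀‖) =O[𝓝[>] 0] fun t => t := hPO.norm_left
    have a1 : (fun t => R (P t) - R x₀ - 2⁻¹ * inner ℝ (P t - x₀) (W (P t - x₀)))
        =o[𝓝[>] 0] fun t => t ^ 2 :=
      (hR.comp_tendsto hP).trans_isBigO (hPn.pow 2)
    have a2 : (fun t => h (P t) - h x₀ + inner ℝ (P t - x₀) (W v)) =o[𝓝[>] 0] fun t => t :=
      (hh.comp_tendsto hP).trans_isBigO hPn
    have a3 : (fun t => t * (h (P t) - h x₀ + inner ℝ (P t - x₀) (W v)))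
        =o[𝓝[>] 0] fun t => t ^ 2 := by
      simpa [sq] using (isBigO_refl (fun t : ℝ => t) (𝓝[>] 0)).mul_isLittleO a2
    have hto : (fun t : ℝ => t) =o[𝓝[>] 0] fun _ => (1 : ℝ) := (isLittleO_one_iff ℝ).2 hid
    have a4 : (fun t => (1 - t) * (R (P t) - R x₀ - 2⁻¹ * inner ℝ (P t - x₀) (W (P t - x₀))))
        =o[𝓝[>] 0] fun t => t ^ 2 := by
      have : (fun t : ℝ => 1 - t) =O[𝓝[>] 0] fun _ => (1 : ℝ) :=
        (isBigO_refl _ _).sub hto.isBigO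
      simpa using this.mul_isLittleO a1
    have a5 : (fun t => t * (2⁻¹ * inner ℝ (P t - x₀) (W (P t - x₀))))
        =o[𝓝[>] 0] fun t => t ^ 2 := by
      have b1 : (fun t => 2⁻¹ * inner ℝ (P t - x₀) (W (P t - x₀))) =O[𝓝[>] 0]
          fun t => t ^ 2 := by
        have : (fun t => 2⁻¹ * inner ℝ (P t - x₀) (W (P t - x₀))) =O[𝓝[>] 0]
            fun t => ‖P t - x₀‖ ^ 2 := by
          refine IsBigO.of_bound ‖W‖ (Eventually.of_forall fun t => ?_)
          have c1 := abs_real_inner_le_norm (P t - x₀) (W (P t - x₀))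
          have c2 := W.le_opNorm (P t - x₀)
          rw [Real.norm_eq_abs, Real.norm_eq_abs, abs_mul, abs_of_pos (by norm_num : (0:ℝ) < 2⁻¹),
            abs_of_nonneg (by positivity : 0 ≤ ‖P t - x₀‖ ^ 2)]
          have c3 : ‖P t - x₀‖ * ‖W (P t - x₀)‖ ≤ ‖P t - x₀‖ * (‖W‖ * ‖P t - x₀‖) := by gcongr
          have c4 := abs_nonneg (inner ℝ (P t - x₀) (W (P t - x₀)))
          nlinarith
        exact this.trans (hPn.pow 2)
      simpa using hto.mul_isBigO b1
    refine ((a4.add a3).sub a5).congr_left fun t => ?_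
    ring
  -- Completing the square, the leading part along `x₀ + δ` is `½⟨δ - t v, W (δ - t v)⟩` minus a
  -- constant, and `S` attains its minimum. As `T` does no worse than `S` in the true criterion,
  -- this square is `o(t²)`.
  have hcmp := (hexp S hSlim hSO).sub (hexp T hTlim hTO)
  rw [Metric.tendsto_nhds]
  intro ε hε
  have hSball : ∀ᶠ t in 𝓝[>] (0 : ℝ), S t ∈ Metric.closedBall x₀ r :=
    hSlim.eventually (Metric.closedBall_mem_nhds x₀ hr)
  filter_upwards [hcmp.bound (by positivity : 0 < c * ε ^ 2 / 4), hT, hSball, hpos0]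
    with t h1 h2 h3 h4
  have h5 := h2 h3
  simp only [mem_ofPred_eq] at h5
  set δ := T t - x₀ with hδ
  have hSt : S t - x₀ = t • v := by simp [hS]
  rw [hSt, Real.norm_eq_abs, Real.norm_eq_abs, abs_of_nonneg (by positivity : 0 ≤ t ^ 2)] at h1
  have h6 := (abs_le.1 h1).2
  have h7 : inner ℝ (δ - t • v) (W (δ - t • v)) =
      inner ℝ δ (W δ) - 2 * t * inner ℝ δ (W v) + t ^ 2 * inner ℝ v (W v) := by
    have := hsymm v δ
    rw [real_inner_comm] at this
    simp only [map_sub, map_smul, inner_sub_left, inner_sub_right, inner_smul_left,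
      inner_smul_right, RCLike.conj_to_real]
    rw [← this]
    ring
  have h8 : inner ℝ (t • v) (W (t • v)) = t ^ 2 * inner ℝ v (W v) := by
    simp only [map_smul, inner_smul_left, inner_smul_right, RCLike.conj_to_real]; ring
  have h9 : inner ℝ (t • v) (W v) = t * inner ℝ v (W v) := by
    simp only [inner_smul_left, RCLike.conj_to_real]
  rw [h8, h9] at h6
  have h10 := hpos (δ - t • v)
  have h11 : ‖δ - t • v‖ ^ 2 ≤ (ε * t) ^ 2 / 2 := by
    have : c * ‖δ - t • v‖ ^ 2 ≤ c * ((ε * t) ^ 2 / 2) := by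
      rw [h7] at h10
      nlinarith
    exact le_of_mul_le_mul_left this hc
  have h12 : ‖δ - t • v‖ < ε * t := by
    have : 0 < ε * t := by positivity
    nlinarith [norm_nonneg (δ - t • v)]
  rw [dist_eq_norm]
  have h13 : t⁻¹ • δ - v = t⁻¹ • (δ - t • v) := by
    rw [smul_sub t⁻¹ δ, smul_smul, inv_mul_cancel₀ h4.ne', one_smul]
  rw [h13, norm_smul, norm_inv, Real.norm_eq_abs, abs_of_pos h4]
  calc t⁻¹ * ‖δ - t • v‖ < t⁻¹ * (ε * t) := by gcongr
    _ = ε := by field_simp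

end Argmin

/-! ### Taylor expansions of the loss -/

section Taylor

theorem LocallyLipschitz.exists_lipschitzOnWith_closedBall {E : Type*} [NormedAddCommGroup E]
    [ProperSpace E] {F : Type*}
    [PseudoMetricSpace F] {g : E → F} (hg : LocallyLipschitz g) (R : ℝ) :
    ∃ K, LipschitzOnWith K g (Metric.closedBall 0 R) :=
  (hg.locallyLipschitzOn (s := Metric.closedBall 0 R)).exists_lipschitzOnWith_of_compact
    (isCompact_closedBall 0 R)

variable {E : Type*} [NormedAddCommGroup E] [InnerProductSpace ℝ E]
  [CompleteSpace E] {f : E → ℝ}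

theorem hasDerivAt_comp_segment (hf : Differentiable ℝ f) (a b : E) (s : ℝ) :
    HasDerivAt (fun s : ℝ => f (a + s • b)) (inner ℝ (gradient f (a + s • b)) b) s := by
  have h1 : HasDerivAt (fun s : ℝ => a + s • b) b s := by
    simpa using ((hasDerivAt_id s).smul_const b).const_add a
  have h2 := (hf (a + s • b)).hasGradientAt.hasFDerivAt.comp_hasDerivAt s h1
  rw [InnerProductSpace.toDual_apply_apply] at h2
  exact h2

/-- Second-order expansion at a point where the gradient is differentiable. -/
theorem isLittleO_taylor_two (hf : Differentiable ℝ f) {a : E} {H : E →L[ℝ] E}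
    (hH : HasFDerivAt (gradient f) H a) :
    (fun b => f (a + b) - f a - inner ℝ (gradient f a) b - 2⁻¹ * inner ℝ (H b) b) =o[𝓝 0]
      fun b => ‖b‖ ^ 2 := by
  rw [isLittleO_iff]
  intro ε hε
  have h1 := (hasFDerivAt_iff_isLittleO_nhds_zero.1 hH).bound hε
  obtain ⟨ρ, hρ, hball⟩ := Metric.eventually_nhds_iff_ball.1 h1
  filter_upwards [Metric.ball_mem_nhds (0 : E) hρ] with b hb
  -- The gradient is differentiable at `a` only, so the mean value inequality is applied to the
  -- remainder along the segment, whose derivative in `s` is at most `ε ‖b‖²`.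
  have hder : ∀ s ∈ Icc (0 : ℝ) 1, HasDerivWithinAt (fun s : ℝ => f (a + s • b) -
      s * inner ℝ (gradient f a) b - s ^ 2 * (2⁻¹ * inner ℝ (H b) b))
      (inner ℝ (gradient f (a + s • b)) b - inner ℝ (gradient f a) b -
        s * inner ℝ (H b) b) (Icc 0 1) s := by
    intro s _
    have e1 := hasDerivAt_comp_segment hf a b s
    have e2 : HasDerivAt (fun s : ℝ => s * inner ℝ (gradient f a) b)
        (inner ℝ (gradient f a) b) s := by
      simpa using (hasDerivAt_id s).mul_const (inner ℝ (gradient f a) b)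
    have e3 : HasDerivAt (fun s : ℝ => s ^ 2 * (2⁻¹ * inner ℝ (H b) b))
        (s * inner ℝ (H b) b) s := by
      have := (hasDerivAt_pow 2 s).mul_const (2⁻¹ * inner ℝ (H b) b)
      refine this.congr_deriv ?_
      push_cast; ring
    exact ((e1.sub e2).sub e3).hasDerivWithinAt
  have hbd : ∀ s ∈ Ico (0 : ℝ) 1, ‖inner ℝ (gradient f (a + s • b)) b -
      inner ℝ (gradient f a) b - s * inner ℝ (H b) b‖ ≤ ε * ‖b‖ ^ 2 := by
    intro s hs
    have e1 : ‖s • b‖ ≤ ‖b‖ := by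
      rw [norm_smul, Real.norm_eq_abs, abs_of_nonneg hs.1]
      exact mul_le_of_le_one_left (norm_nonneg b) hs.2.le
    have e2 := hball (s • b) (by
      rw [mem_ball_zero_iff] at hb ⊢
      exact e1.trans_lt hb)
    have e3 : inner ℝ (gradient f (a + s • b)) b - inner ℝ (gradient f a) b -
        s * inner ℝ (H b) b = inner ℝ (gradient f (a + s • b) - gradient f a - H (s • b)) b := by
      simp only [map_smul, inner_sub_left, inner_smul_left, RCLike.conj_to_real]
    rw [e3]
    calc _ ≤ ‖gradient f (a + s • b) - gradient f a - H (s • b)‖ * ‖b‖ := norm_inner_le_norm _ _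
      _ ≤ (ε * ‖b‖) * ‖b‖ := by gcongr; exact e2.trans (by gcongr)
      _ = _ := by ring
  have := norm_image_sub_le_of_norm_deriv_le_segment_01' hder hbd
  simp only [one_smul, one_mul, one_pow, zero_smul, add_zero, zero_mul, sub_zero, ne_eq,
    OfNat.ofNat_ne_zero, not_false_eq_true, zero_pow] at this
  rw [norm_pow, norm_norm]
  refine le_of_eq_of_le (congrArg _ ?_) this
  ring

/-- First-order expansion with a quadratic remainder bound on a ball where the gradient is
Lipschitz. -/
theorem abs_taylor_one_le (hf : Differentiable ℝ f) {R : ℝ} {K : NNReal}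
    (hK : LipschitzOnWith K (gradient f) (Metric.closedBall 0 R)) {a b : E}
    (ha : a ∈ Metric.closedBall (0 : E) R) (hab : a + b ∈ Metric.closedBall (0 : E) R) :
    |f (a + b) - f a - inner ℝ (gradient f a) b| ≤ K * ‖b‖ ^ 2 := by
  have hder : ∀ s ∈ Icc (0 : ℝ) 1, HasDerivWithinAt (fun s : ℝ => f (a + s • b) -
      s * inner ℝ (gradient f a) b)
      (inner ℝ (gradient f (a + s • b)) b - inner ℝ (gradient f a) b) (Icc 0 1) s := by
    intro s _
    have e1 := hasDerivAt_comp_segment hf a b s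
    have e2 : HasDerivAt (fun s : ℝ => s * inner ℝ (gradient f a) b)
        (inner ℝ (gradient f a) b) s := by
      simpa using (hasDerivAt_id s).mul_const (inner ℝ (gradient f a) b)
    exact (e1.sub e2).hasDerivWithinAt
  have hbd : ∀ s ∈ Ico (0 : ℝ) 1, ‖inner ℝ (gradient f (a + s • b)) b -
      inner ℝ (gradient f a) b‖ ≤ K * ‖b‖ ^ 2 := by
    intro s hs
    have e1 : ‖s • b‖ ≤ ‖b‖ := by
      rw [norm_smul, Real.norm_eq_abs, abs_of_nonneg hs.1]
      exact mul_le_of_le_one_left (norm_nonneg b) hs.2.le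
    have hmem : a + s • b ∈ Metric.closedBall (0 : E) R := by
      have := (convex_closedBall (0 : E) R).add_smul_mem ha hab ⟨hs.1, hs.2.le⟩
      exact this
    have e2 := hK.dist_le_mul _ hmem _ ha
    rw [dist_eq_norm, dist_eq_norm, add_sub_cancel_left] at e2
    rw [← inner_sub_left]
    calc _ ≤ ‖gradient f (a + s • b) - gradient f a‖ * ‖b‖ := norm_inner_le_norm _ _
      _ ≤ (K * ‖b‖) * ‖b‖ := by gcongr; exact e2.trans (by gcongr)
      _ = _ := by ring
  have := norm_image_sub_le_of_norm_deriv_le_segment_01' hder hbd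
  simp only [one_smul, one_mul, zero_smul, add_zero, zero_mul, sub_zero] at this
  rw [← Real.norm_eq_abs]
  refine le_of_eq_of_le (congrArg _ ?_) this
  ring

end Taylor

/-! ### Disintegration of the law of `(X, Y)` -/

/-- Pulling a density back through a measurable map. -/
theorem map_withDensity_comp {α β : Type*} [MeasurableSpace α] [MeasurableSpace β]
    (μ : Measure α) {Φ : α → β} (hΦ : Measurable Φ) {G : β → ENNReal} (hG : Measurable G) :
    (μ.withDensity (fun a => G (Φ a))).map Φ = (μ.map Φ).withDensity G := by
  ext s hs
  rw [Measure.map_apply hΦ hs, withDensity_apply _ (hΦ hs), withDensity_apply _ hs,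
    setLIntegral_map hs hG hΦ]

instance (d : ℕ) : IsFiniteMeasure (surf d) := by unfold surf; infer_instance

theorem continuous_idx {k : ℕ} (θ : Euc k) : Continuous (idx θ) := by
  unfold idx; fun_prop

theorem measurable_idx {k : ℕ} (θ : Euc k) : Measurable (idx θ) := (continuous_idx θ).measurable

namespace ESIM

variable {d k : ℕ} {M : ESIM d k}

instance : IsProbabilityMeasure M.law := M.prob

theorem measurable_idx_fst (θ : Euc k) :
    Measurable (fun z : Euc (k + 1) × Sph d => idx θ z.1) :=
  (measurable_idx θ).comp measurable_fst

theorem ae_idx_mem_supp (hdens : M.HasDensities) {θ : Euc k} (hθ : θ ∈ paramSpace k) :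
    ∀ᵐ z ∂M.law, idx θ z.1 ∈ M.supp θ := by
  refine ae_of_ae_map (measurable_idx_fst θ).aemeasurable (p := fun u => u ∈ M.supp θ) ?_
  rw [hdens.idx_law θ hθ, ae_withDensity_iff (hdens.meas_idx θ hθ).ennreal_ofReal]
  refine Eventually.of_forall fun u hu => ?_
  simpa [supp] using hu

theorem measurable_condDens_idx (hdens : M.HasDensities) {θ : Euc k} (hθ : θ ∈ paramSpace k) :
    Measurable (fun z : Euc (k + 1) × Sph d => M.condDens θ (idx θ z.1) z.2) :=
  (hdens.meas_cond θ hθ).comp ((measurable_idx_fst θ).prodMk measurable_snd)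

/-- In the model class, `Y` and `X` are conditionally independent given the true index. -/
theorem law_eq_withDensity {κ : ℝ} (hdens : M.HasDensities) (hθ : M.θ₀ ∈ paramSpace k)
    (hclass : M.InClass κ) (hreg : M.LinkRegular) :
    M.law = ((M.law.map Prod.fst).prod (surf d)).withDensity
      (fun z => ENNReal.ofReal (M.condDens M.θ₀ (idx M.θ₀ z.1) z.2)) := by
  obtain ⟨-, f, c, hf, hf0, hc, hlaw⟩ := hclass
  have hm : Measurable M.meanCurve := by
    have := hreg.meas _ hθ
    unfold meanCurve
    fun_prop
  set G : ℝ × Sph d → ENNReal := fun w =>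
    ENNReal.ofReal (c * f (κ * inner ℝ (w.2 : Euc d) (M.meanCurve w.1))) with hGdef
  have hG : Measurable G := by
    have h1 : Measurable (fun w : ℝ × Sph d => inner ℝ (w.2 : Euc d) (M.meanCurve w.1)) :=
      Measurable.inner (measurable_subtype_coe.comp measurable_snd) (hm.comp measurable_fst)
    exact ((hf.comp (h1.const_mul κ)).const_mul c).ennreal_ofReal
  set Φ : Euc (k + 1) × Sph d → ℝ × Sph d := fun z => (idx M.θ₀ z.1, z.2) with hΦdef
  have hΦ : Measurable Φ := (measurable_idx_fst M.θ₀).prodMk measurable_snd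
  set F : ℝ → ENNReal := fun u => ENNReal.ofReal (M.idxDens M.θ₀ u) with hFdef
  have hF : Measurable F := (hdens.meas_idx _ hθ).ennreal_ofReal
  have : IsProbabilityMeasure (M.law.map Prod.fst) :=
    Measure.isProbabilityMeasure_map measurable_fst.aemeasurable
  have hprod : ((M.law.map Prod.fst).prod (surf d)).map Φ =
      ((volume : Measure ℝ).prod (surf d)).withDensity (fun w => F w.1) := by
    have e1 : Φ = Prod.map (idx M.θ₀) id := rfl
    rw [e1, ← Measure.map_prod_map _ _ (measurable_idx M.θ₀) measurable_id,
      Measure.map_map (measurable_idx M.θ₀) measurable_fst, Measure.map_id,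
      ← prod_withDensity_left hF]
    congr 1
    exact hdens.idx_law _ hθ
  have hmap : M.law.map Φ = ((volume : Measure ℝ).prod (surf d)).withDensity
      (fun w => F w.1 * G w) := by
    conv_lhs => rw [hlaw]
    have := map_withDensity_comp ((M.law.map Prod.fst).prod (surf d)) hΦ hG
    rw [hprod, ← withDensity_mul _ (by fun_prop) hG] at this
    exact this
  have hc' : Measurable (fun w : ℝ × Sph d => M.condDens M.θ₀ w.1 w.2) := hdens.meas_cond _ hθ
  have hi' := hdens.meas_idx _ hθ
  -- Two densities of `(U, Y)` with respect to the same σ-finite measure agree almost everywhere;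
  -- the marginal density then cancels where it is nonzero. So the angular density given `X` is the
  -- conditional density given the index.
  rw [hdens.joint_law _ hθ, withDensity_eq_iff_of_sigmaFinite (by fun_prop)
    (Measurable.aemeasurable (by fun_prop))] at hmap
  have hae : ∀ᵐ w ∂(((M.law.map Prod.fst).prod (surf d)).map Φ),
      G w = ENNReal.ofReal (M.condDens M.θ₀ w.1 w.2) := by
    rw [hprod, ae_withDensity_iff (by fun_prop)]
    filter_upwards [hmap] with w hw hw0
    simp only [hFdef] at hw hw0
    rw [ENNReal.ofReal_mul (hdens.nonneg _ hθ _)] at hw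
    exact ((ENNReal.mul_right_inj hw0 ENNReal.ofReal_ne_top).1 hw).symm
  conv_lhs => rw [hlaw]
  exact withDensity_congr_ae (ae_of_ae_map hΦ.aemeasurable hae)

section Disintegration

variable {κ : ℝ} (hdens : M.HasDensities) (hθ : M.θ₀ ∈ paramSpace k) (hclass : M.InClass κ)
  (hreg : M.LinkRegular)
include hdens hθ hclass hreg

/-- Fubini for null sets. It transfers assumptions made for each fixed index value, such as the
existence of the Hessian in (A3), to statements about `F₀`. -/
theorem ae_law_of_forall_supp {P : Euc (k + 1) × Sph d → Prop} (hP : MeasurableSet {z | P z})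
    (h : ∀ x, idx M.θ₀ x ∈ M.supp M.θ₀ → ∀ᵐ y ∂(surf d),
      M.condDens M.θ₀ (idx M.θ₀ x) y ≠ 0 → P (x, y)) : ∀ᵐ z ∂M.law, P z := by
  have : IsProbabilityMeasure (M.law.map Prod.fst) :=
    Measure.isProbabilityMeasure_map measurable_fst.aemeasurable
  have hm := measurable_condDens_idx hdens hθ
  rw [law_eq_withDensity hdens hθ hclass hreg, ae_withDensity_iff hm.ennreal_ofReal]
  have hset : MeasurableSet {z : Euc (k + 1) × Sph d |
      ENNReal.ofReal (M.condDens M.θ₀ (idx M.θ₀ z.1) z.2) ≠ 0 → P z} := by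
    have : MeasurableSet {z : Euc (k + 1) × Sph d |
        ENNReal.ofReal (M.condDens M.θ₀ (idx M.θ₀ z.1) z.2) = 0} :=
      measurableSet_eq_fun hm.ennreal_ofReal measurable_const
    convert this.union hP using 1
    ext z
    simp only [mem_ofPred_eq, mem_union]
    tauto
  rw [Measure.ae_prod_iff_ae_ae hset]
  have hsupp : ∀ᵐ x ∂(M.law.map Prod.fst), idx M.θ₀ x ∈ M.supp M.θ₀ := by
    rw [ae_map_iff measurable_fst.aemeasurable]
    · exact ae_idx_mem_supp hdens hθ
    · exact measurable_idx M.θ₀ (measurableSet_lt measurable_const (hdens.meas_idx _ hθ))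
  filter_upwards [hsupp] with x hx
  filter_upwards [h x hx] with y hy hne
  exact hy fun h0 => hne (by simp [h0])

/-- Fubini for the density of `law_eq_withDensity`. The conditioning is on all of `X`, while the
kernel involves only the true index; this is the form in which conditional independence is used
throughout. -/
theorem integral_law_eq {E : Type*} [NormedAddCommGroup E] [NormedSpace ℝ E]
    {f : Euc (k + 1) × Sph d → E} (hf : Integrable f M.law) :
    ∫ z, f z ∂M.law = ∫ z, (∫ y, M.condDens M.θ₀ (idx M.θ₀ z.1) y • f (z.1, y) ∂(surf d))
      ∂M.law := by
  have : IsProbabilityMeasure (M.law.map Prod.fst) :=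
    Measure.isProbabilityMeasure_map measurable_fst.aemeasurable
  have hm := measurable_condDens_idx hdens hθ
  have hlaw := law_eq_withDensity hdens hθ hclass hreg
  have hint := hf
  rw [hlaw, integrable_withDensity_iff_integrable_smul' hm.ennreal_ofReal (by simp)] at hint
  have h1 := integral_withDensity_eq_integral_toReal_smul
    (μ := (M.law.map Prod.fst).prod (surf d)) hm.ennreal_ofReal (by simp) f
  rw [← hlaw, integral_prod _ hint, integral_map measurable_fst.aemeasurable] at h1
  · rw [h1]
    apply integral_congr_ae
    filter_upwards [ae_idx_mem_supp hdens hθ] with z hz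
    congr 1
    ext y
    rw [ENNReal.toReal_ofReal (hdens.cond_nonneg _ hθ _ hz y)]
  · exact hint.aestronglyMeasurable.integral_prod_right'

end Disintegration

/-- An integral of a function of `(U_θ, Y)` vanishes when its conditional integrals do. -/
theorem integral_idx_eq_zero (hdens : M.HasDensities) {θ : Euc k} (hθ : θ ∈ paramSpace k)
    {f : ℝ × Sph d → ℝ} (hf : Measurable f)
    (h : ∀ u ∈ M.supp θ, ∫ y, f (u, y) * M.condDens θ u y ∂(surf d) = 0) :
    ∫ z, f (idx θ z.1, z.2) ∂M.law = 0 := by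
  -- A Bochner integral that does not converge is zero by convention, so this case agrees with the
  -- claim.
  by_cases hint : Integrable (fun z : Euc (k + 1) × Sph d => f (idx θ z.1, z.2)) M.law
  swap
  · exact integral_undef hint
  have hΦ : Measurable (fun z : Euc (k + 1) × Sph d => (idx θ z.1, z.2)) :=
    (measurable_idx_fst θ).prodMk measurable_snd
  have hc := hdens.meas_cond _ hθ
  have hi := hdens.meas_idx _ hθ
  have hm : Measurable (fun w : ℝ × Sph d =>
      ENNReal.ofReal (M.idxDens θ w.1 * M.condDens θ w.1 w.2)) := by fun_prop
  have hint' : Integrable f (M.law.map (fun z => (idx θ z.1, z.2))) :=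
    (integrable_map_measure hf.aestronglyMeasurable hΦ.aemeasurable).2 hint
  rw [hdens.joint_law _ hθ, integrable_withDensity_iff_integrable_smul' hm (by simp)] at hint'
  rw [← integral_map (f := f) hΦ.aemeasurable hf.aestronglyMeasurable, hdens.joint_law _ hθ,
    integral_withDensity_eq_integral_toReal_smul hm (by simp), integral_prod _ hint']
  refine integral_eq_zero_of_ae (Eventually.of_forall fun u => ?_)
  simp only [Pi.zero_apply, smul_eq_mul]
  by_cases hu : u ∈ M.supp θ
  · have e : ∀ y, (ENNReal.ofReal (M.idxDens θ u * M.condDens θ u y)).toReal * f (u, y) =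
        M.idxDens θ u * (f (u, y) * M.condDens θ u y) := fun y => by
      rw [ENNReal.toReal_ofReal (mul_nonneg (hdens.nonneg _ hθ _)
        (hdens.cond_nonneg _ hθ _ hu y))]
      ring
    simp only [e]
    rw [integral_const_mul, h u hu, mul_zero]
  · have : M.idxDens θ u = 0 := le_antisymm (not_lt.1 hu) (hdens.nonneg _ hθ _)
    simp [this]

end ESIM

/-! ### Uniform bounds and the estimating equation -/

theorem isOpen_paramSpace (k : ℕ) : IsOpen (paramSpace k) :=
  isOpen_lt (by fun_prop) continuous_const

theorem norm_sphere_sub_le {d : ℕ} (y : Sph d) (m : Euc d) : ‖(y : Euc d) - m‖ ≤ 1 + ‖m‖ := by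
  have := norm_sub_le (y : Euc d) m
  rwa [norm_eq_of_mem_sphere y] at this

namespace ESIM

variable {d k : ℕ} {M : ESIM d k}

/-- The fitted value `μ_θ(xᵀ β(θ))`. -/
def fit (M : ESIM d k) (θ : Euc k) (x : Euc (k + 1)) : Euc d := M.link θ (idx θ x)

/-- The residual `y - μ_θ(xᵀ β(θ))`. -/
def resid (M : ESIM d k) (θ : Euc k) (z : Euc (k + 1) × Sph d) : Euc d := z.2 - M.fit θ z.1

/-- The Hessian of the loss, as a linear map. -/
abbrev hess (M : ESIM d k) (a : Euc d) : Euc d →L[ℝ] Euc d := fderiv ℝ (gradient M.loss) a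

theorem measurable_fit (hreg : M.LinkRegular) {θ : Euc k} (hθ : θ ∈ paramSpace k) :
    Measurable (M.fit θ) :=
  (hreg.meas θ hθ).comp (measurable_idx θ)

theorem measurable_resid (hreg : M.LinkRegular) {θ : Euc k} (hθ : θ ∈ paramSpace k) :
    Measurable (M.resid θ) :=
  (measurable_subtype_coe.comp measurable_snd).sub
    ((measurable_fit hreg hθ).comp measurable_fst)

/-- Uniform bounds on a closed ball of parameters: on residuals, fitted values, and the gradient
of the loss. -/
structure LocalBounds (M : ESIM d k) (r C L : ℝ) (K : NNReal) (G : ℝ) : Prop where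
  r_pos : 0 < r
  subset : Metric.closedBall M.θ₀ r ⊆ paramSpace k
  L_nonneg : 0 ≤ L
  G_nonneg : 0 ≤ G
  fit_sub : ∀ θ₁ ∈ Metric.closedBall M.θ₀ r, ∀ θ₂ ∈ Metric.closedBall M.θ₀ r,
    ∀ᵐ z ∂M.law, ‖M.fit θ₁ z.1 - M.fit θ₂ z.1‖ ≤ L * ‖θ₁ - θ₂‖
  fit_le : ∀ θ ∈ Metric.closedBall M.θ₀ r, ∀ᵐ z ∂M.law, ‖M.fit θ z.1‖ ≤ C
  link_le : ∀ u ∈ M.supp M.θ₀, ‖M.link M.θ₀ u‖ ≤ C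
  grad_lip : LipschitzOnWith K (gradient M.loss) (Metric.closedBall 0 (2 + C))
  grad_le : ∀ a ∈ Metric.closedBall (0 : Euc d) (2 + C), ‖gradient M.loss a‖ ≤ G

/-- On a closed ball inside `Θ` the Lipschitz bound of (A2) carries the boundedness of `μ_{θ₀}` over
to the nearby fits, at the cost of `L * r`. Residuals then stay in a fixed compact ball, where the
gradient is bounded and Lipschitz. -/
theorem exists_localBounds (hdens : M.HasDensities) (hθ : M.θ₀ ∈ paramSpace k) (h1 : M.A1)
    (h2 : M.A2) (h3 : M.A3) (hreg : M.LinkRegular) :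
    ∃ (r C L : ℝ) (K : NNReal) (G : ℝ), M.LocalBounds r C L K G := by
  obtain ⟨r, hr, hsub⟩ := Metric.nhds_basis_closedBall.mem_iff.1
    ((isOpen_paramSpace k).mem_nhds hθ)
  obtain ⟨L, hL, hlip⟩ := h2.lipschitz _ hsub (isCompact_closedBall M.θ₀ r)
  obtain ⟨C, hC⟩ := hreg.bounded
  have hθr : M.θ₀ ∈ Metric.closedBall M.θ₀ r := Metric.mem_closedBall_self hr.le
  have hfs : ∀ θ₁ ∈ Metric.closedBall M.θ₀ r, ∀ θ₂ ∈ Metric.closedBall M.θ₀ r,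
      ∀ᵐ z ∂M.law, ‖M.fit θ₁ z.1 - M.fit θ₂ z.1‖ ≤ L * ‖θ₁ - θ₂‖ := by
    intro θ₁ h₁ θ₂ h₂
    filter_upwards [h1.mem_dom, ae_idx_mem_supp hdens (hsub h₁),
      ae_idx_mem_supp hdens (hsub h₂)] with z a b c
    exact hlip _ h₁ _ h₂ _ a b c
  obtain ⟨K, hK⟩ := h3.grad_lipschitz.exists_lipschitzOnWith_closedBall (2 + (C + L * r))
  obtain ⟨G, hG⟩ := (isCompact_closedBall (0 : Euc d) (2 + (C + L * r))).exists_bound_of_continuousOn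
    h3.grad_lipschitz.continuous.continuousOn
  refine ⟨r, C + L * r, L, K, max G 0, hr, hsub, hL.le, le_max_right _ _, hfs, ?_, ?_, hK,
    fun a ha => (hG a ha).trans (le_max_left _ _)⟩
  · intro θ hθ'
    filter_upwards [hfs θ hθ' _ hθr, ae_idx_mem_supp hdens hθ] with z a b
    have e1 := hC _ b
    have e2 : ‖θ - M.θ₀‖ ≤ r := by simpa [dist_eq_norm] using hθ'
    calc ‖M.fit θ z.1‖ = ‖M.fit M.θ₀ z.1 + (M.fit θ z.1 - M.fit M.θ₀ z.1)‖ := by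
          rw [add_sub_cancel]
      _ ≤ ‖M.fit M.θ₀ z.1‖ + ‖M.fit θ z.1 - M.fit M.θ₀ z.1‖ := norm_add_le _ _
      _ ≤ C + L * r := add_le_add e1 (a.trans (by gcongr))
  · intro u hu
    exact (hC u hu).trans (by nlinarith)

theorem LocalBounds.mem_self {r C L : ℝ} {K : NNReal} {G : ℝ} (hb : M.LocalBounds r C L K G) :
    M.θ₀ ∈ Metric.closedBall M.θ₀ r := Metric.mem_closedBall_self hb.r_pos.le

theorem LocalBounds.ae_resid_le {r C L : ℝ} {K : NNReal} {G : ℝ} (hb : M.LocalBounds r C L K G)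
    {θ : Euc k} (hθ : θ ∈ Metric.closedBall M.θ₀ r) : ∀ᵐ z ∂M.law, ‖M.resid θ z‖ ≤ 1 + C := by
  filter_upwards [hb.fit_le θ hθ] with z hz
  exact (norm_sphere_sub_le _ _).trans (by linarith)

/-- A Lipschitz constant on a set bounds the derivative at interior points. This is why the bounds
are kept on radius `2 + C`, although residuals have norm at most `1 + C`. -/
theorem LocalBounds.norm_hess_le {r C L : ℝ} {K : NNReal} {G : ℝ} (hb : M.LocalBounds r C L K G)
    {a : Euc d} (ha : ‖a‖ ≤ 1 + C) : ‖M.hess a‖ ≤ K := by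
  refine norm_fderiv_le_of_lipschitzOn ℝ (s := Metric.closedBall 0 (2 + C)) ?_ hb.grad_lip
  refine mem_of_superset (Metric.isOpen_ball.mem_nhds (?_ : a ∈ Metric.ball 0 (2 + C)))
    Metric.ball_subset_closedBall
  rw [mem_ball_zero_iff]
  linarith

theorem LocalBounds.grad_le' {r C L : ℝ} {K : NNReal} {G : ℝ} (hb : M.LocalBounds r C L K G)
    {a : Euc d} (ha : ‖a‖ ≤ 1 + C) : ‖gradient M.loss a‖ ≤ G :=
  hb.grad_le a (by rw [mem_closedBall_zero_iff]; linarith)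

/-- The integral equals one, whereas a non-integrable function would have integral zero by
convention. -/
theorem integrable_condDens (hdens : M.HasDensities) {θ : Euc k} (hθ : θ ∈ paramSpace k) {u : ℝ}
    (hu : u ∈ M.supp θ) : Integrable (M.condDens θ u) (surf d) := by
  by_contra h
  have := hdens.cond_one θ hθ u hu
  rw [integral_undef h] at this
  exact zero_ne_one this

theorem measurable_condDens (hdens : M.HasDensities) {θ : Euc k} (hθ : θ ∈ paramSpace k) (u : ℝ) :
    Measurable (M.condDens θ u) :=
  (hdens.meas_cond θ hθ).comp (measurable_const.prodMk measurable_id)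

theorem integrable_mul_condDens (hdens : M.HasDensities) {θ : Euc k} (hθ : θ ∈ paramSpace k)
    {u : ℝ} (hu : u ∈ M.supp θ) {q : Sph d → ℝ} (hq : Measurable q) {B : ℝ}
    (hB : ∀ y, |q y| ≤ B) : Integrable (fun y => q y * M.condDens θ u y) (surf d) :=
  (integrable_condDens hdens hθ hu).bdd_mul hq.aestronglyMeasurable
    (Eventually.of_forall fun y => hB y)

/-- The estimating equation of the link functions: `E[ψ'(Y - μ_θ(u)) | U_θ = u] = 0`. -/
theorem integral_inner_gradient_eq_zero (hdens : M.HasDensities) (hlink : M.IsLink) (h3 : M.A3)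
    {θ : Euc k} (hθ : θ ∈ paramSpace k) {u : ℝ} (hu : u ∈ M.supp θ) (w : Euc d) :
    ∫ y : Sph d, inner ℝ (gradient M.loss ((y : Euc d) - M.link θ u)) w * M.condDens θ u y
      ∂(surf d) = 0 := by
  set m := M.link θ u with hm
  set ρ := 1 + ‖m‖ + ‖w‖
  have hgc := h3.grad_lipschitz.continuous
  have hlc := h3.diff.continuous
  obtain ⟨G, hG⟩ := (isCompact_closedBall (0 : Euc d) ρ).exists_bound_of_continuousOn
    hgc.continuousOn
  obtain ⟨B, hB⟩ := (isCompact_closedBall (0 : Euc d) ρ).exists_bound_of_continuousOn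
    hlc.continuousOn
  have hmem : ∀ (y : Sph d) (s : ℝ), s ∈ Metric.ball (0 : ℝ) 1 →
      ((y : Euc d) - m) + s • w ∈ Metric.closedBall (0 : Euc d) ρ := by
    intro y s hs
    rw [mem_closedBall_zero_iff]
    rw [mem_ball_zero_iff] at hs
    calc _ ≤ ‖(y : Euc d) - m‖ + ‖s • w‖ := norm_add_le _ _
      _ ≤ (1 + ‖m‖) + ‖w‖ := by
        refine add_le_add (norm_sphere_sub_le _ _) ?_
        rw [norm_smul]
        exact mul_le_of_le_one_left (norm_nonneg _) hs.le
      _ = ρ := rfl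
  have hcm := measurable_condDens hdens hθ u
  have hci := integrable_condDens hdens hθ hu
  have hmeas : ∀ s : ℝ, Measurable (fun y : Sph d => M.loss (((y : Euc d) - m) + s • w)) :=
    fun s => (hlc.comp (by fun_prop :
      Continuous fun y : Sph d => ((y : Euc d) - m) + s • w)).measurable
  have hmeas' : Measurable (fun y : Sph d =>
      inner ℝ (gradient M.loss (((y : Euc d) - m) + (0 : ℝ) • w)) w) := by
    have : Continuous (fun y : Sph d =>
        inner ℝ (gradient M.loss (((y : Euc d) - m) + (0 : ℝ) • w)) w) :=
      (hgc.comp (by fun_prop : Continuous fun y : Sph d =>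
        ((y : Euc d) - m) + (0 : ℝ) • w)).inner continuous_const
    exact this.measurable
  have key := hasDerivAt_integral_of_dominated_loc_of_deriv_le (μ := surf d) (𝕜 := ℝ)
    (F := fun s y => M.loss (((y : Euc d) - m) + s • w) * M.condDens θ u y)
    (F' := fun s y => inner ℝ (gradient M.loss (((y : Euc d) - m) + s • w)) w * M.condDens θ u y)
    (bound := fun y => G * ‖w‖ * M.condDens θ u y) (x₀ := (0 : ℝ))
    (Metric.ball_mem_nhds (0 : ℝ) one_pos)
    (Eventually.of_forall fun s => ((hmeas s).mul hcm).aestronglyMeasurable)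
    (integrable_mul_condDens hdens hθ hu (hmeas 0) (B := B) fun y =>
      hB _ (hmem y 0 (Metric.mem_ball_self one_pos)))
    (hmeas'.mul hcm).aestronglyMeasurable
    (Eventually.of_forall fun y s hs => by
      have hc0 := hdens.cond_nonneg θ hθ u hu y
      rw [norm_mul, Real.norm_eq_abs (M.condDens θ u y), abs_of_nonneg hc0]
      gcongr
      exact (norm_inner_le_norm _ _).trans (by gcongr; exact hG _ (hmem y s hs)))
    (hci.const_mul _)
    (Eventually.of_forall fun y s hs =>
      (hasDerivAt_comp_segment h3.diff ((y : Euc d) - m) w s).mul_const _)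
  -- Shifting the residual by `s • w` amounts to replacing the centre `m` by `m - s • w`, so the
  -- minimality of the link makes `s = 0` a minimum, and Fermat's rule applies.
  have hmin : IsLocalMin (fun s : ℝ => ∫ y : Sph d,
      M.loss (((y : Euc d) - m) + s • w) * M.condDens θ u y ∂(surf d)) 0 := by
    refine Eventually.of_forall fun s => ?_
    have := hlink θ hθ u hu (m - s • w)
    simp only [condE] at this
    simpa [sub_sub_eq_add_sub, sub_add_eq_add_sub] using this
  have := hmin.hasDerivAt_eq_zero key.2
  simpa using this

section Conditional

variable {κ : ℝ} (hdens : M.HasDensities) (hlink : M.IsLink) (hθ : M.θ₀ ∈ paramSpace k)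
  (hclass : M.InClass κ) (h3 : M.A3) (hreg : M.LinkRegular)

include hdens hlink hθ hclass h3 hreg in
/-- The score at the true parameter is centred given the predictors. -/
theorem integral_inner_gradient_resid_eq_zero {q : Euc (k + 1) → Euc d}
    (hint : Integrable (fun z => inner ℝ (gradient M.loss (M.resid M.θ₀ z)) (q z.1)) M.law) :
    ∫ z, inner ℝ (gradient M.loss (M.resid M.θ₀ z)) (q z.1) ∂M.law = 0 := by
  rw [integral_law_eq hdens hθ hclass hreg hint]
  refine integral_eq_zero_of_ae ?_
  filter_upwards [ae_idx_mem_supp hdens hθ] with z hz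
  have := integral_inner_gradient_eq_zero hdens hlink h3 hθ hz (q z.1)
  simpa [resid, fit, mul_comm] using this

theorem inner_hess_eq_sum (A : Euc d →L[ℝ] Euc d) (a b : Euc d) :
    inner ℝ a (A b) = ∑ i, ∑ j, a i * b j * A (EuclideanSpace.single j 1) i := by
  have hb : A b = ∑ j, b j • A (EuclideanSpace.single j 1) := by
    conv_lhs => rw [← (EuclideanSpace.basisFun (Fin d) ℝ).sum_repr b]
    simp
  rw [hb, PiLp.inner_apply]
  refine Finset.sum_congr rfl fun i _ => ?_
  simp only [WithLp.ofLp_sum, WithLp.ofLp_smul, Finset.sum_apply, Pi.smul_apply, smul_eq_mul,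
    RCLike.inner_apply, RCLike.conj_to_real, Finset.sum_mul]
  exact Finset.sum_congr rfl fun j _ => by ring

theorem dotProduct_mulVec_eq_sum (A : Matrix (Fin d) (Fin d) ℝ) (a b : Fin d → ℝ) :
    a ⬝ᵥ A.mulVec b = ∑ i, ∑ j, a i * b j * A i j := by
  simp only [dotProduct, Matrix.mulVec, Finset.mul_sum]
  exact Finset.sum_congr rfl fun i _ => Finset.sum_congr rfl fun j _ => by ring

variable {r C L : ℝ} {K : NNReal} {G : ℝ} (hb : M.LocalBounds r C L K G)

include hdens hθ hb in
-- `Fmat` is an entrywise expectation, so the form is expanded in coordinates. The Lipschitz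
-- constant of the gradient bounds every entry, which makes each term integrable.
theorem integral_inner_hess_eq {u : ℝ} (hu : u ∈ M.supp M.θ₀) (a b : Euc d) :
    ∫ y : Sph d, M.condDens M.θ₀ u y • inner ℝ a (M.hess ((y : Euc d) - M.link M.θ₀ u) b)
      ∂(surf d) = a.ofLp ⬝ᵥ (M.Fmat M.θ₀ u).mulVec b.ofLp := by
  have hle : ∀ y : Sph d, ‖(y : Euc d) - M.link M.θ₀ u‖ ≤ 1 + C := fun y =>
    (norm_sphere_sub_le _ _).trans (by linarith [hb.link_le u hu])
  have hint : ∀ i j, Integrable (fun y : Sph d =>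
      (M.hess ((y : Euc d) - M.link M.θ₀ u) (EuclideanSpace.single j 1)) i *
        M.condDens M.θ₀ u y) (surf d) := by
    intro i j
    refine integrable_mul_condDens hdens hθ hu (B := K) ?_ fun y => ?_
    · have h1 : Measurable (fun a : Euc d => M.hess a (EuclideanSpace.single j 1)) :=
        measurable_fderiv_apply_const ℝ _ _
      have h2 : Measurable (fun y : Sph d => (y : Euc d) - M.link M.θ₀ u) :=
        measurable_subtype_coe.sub measurable_const
      exact (EuclideanSpace.proj (𝕜 := ℝ) i).continuous.measurable.comp (h1.comp h2)
    · have e1 := PiLp.norm_apply_le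
        (M.hess ((y : Euc d) - M.link M.θ₀ u) (EuclideanSpace.single j (1 : ℝ))) i
      have e2 := (M.hess ((y : Euc d) - M.link M.θ₀ u)).le_of_opNorm_le
        (hb.norm_hess_le (hle y)) (EuclideanSpace.single j (1 : ℝ))
      simp only [PiLp.norm_single, norm_one, mul_one] at e2
      exact e1.trans e2
  rw [dotProduct_mulVec_eq_sum]
  have : ∀ y : Sph d, M.condDens M.θ₀ u y • inner ℝ a (M.hess ((y : Euc d) - M.link M.θ₀ u) b) =
      ∑ i, ∑ j, a i * b j * ((M.hess ((y : Euc d) - M.link M.θ₀ u)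
        (EuclideanSpace.single j 1)) i * M.condDens M.θ₀ u y) := by
    intro y
    rw [inner_hess_eq_sum, smul_eq_mul, Finset.mul_sum]
    refine Finset.sum_congr rfl fun i _ => ?_
    rw [Finset.mul_sum]
    exact Finset.sum_congr rfl fun j _ => by ring
  simp only [this]
  rw [integral_finsetSum _ fun i _ => integrable_finsetSum _ fun j _ => (hint i j).const_mul _]
  refine Finset.sum_congr rfl fun i _ => ?_
  rw [integral_finsetSum _ fun j _ => (hint i j).const_mul _]
  refine Finset.sum_congr rfl fun j _ => ?_
  rw [integral_const_mul]
  rfl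

include hdens hθ h3 hb in
theorem integral_inner_mul_inner_gradient_eq {u : ℝ} (hu : u ∈ M.supp M.θ₀) (a b : Euc d) :
    ∫ y : Sph d, M.condDens M.θ₀ u y •
      (inner ℝ (gradient M.loss ((y : Euc d) - M.link M.θ₀ u)) a *
        inner ℝ (gradient M.loss ((y : Euc d) - M.link M.θ₀ u)) b) ∂(surf d) =
      a.ofLp ⬝ᵥ (M.Gmat M.θ₀ u).mulVec b.ofLp := by
  have hle : ∀ y : Sph d, ‖(y : Euc d) - M.link M.θ₀ u‖ ≤ 1 + C := fun y =>
    (norm_sphere_sub_le _ _).trans (by linarith [hb.link_le u hu])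
  have hmeas : ∀ i, Measurable (fun y : Sph d =>
      gradient M.loss ((y : Euc d) - M.link M.θ₀ u) i) := fun i =>
    ((EuclideanSpace.proj (𝕜 := ℝ) i).continuous.comp (h3.grad_lipschitz.continuous.comp
      (by fun_prop : Continuous fun y : Sph d => (y : Euc d) - M.link M.θ₀ u))).measurable
  have hint : ∀ i j, Integrable (fun y : Sph d =>
      (gradient M.loss ((y : Euc d) - M.link M.θ₀ u) i *
        gradient M.loss ((y : Euc d) - M.link M.θ₀ u) j) * M.condDens M.θ₀ u y) (surf d) := by
    intro i j
    refine integrable_mul_condDens hdens hθ hu (B := G * G) ((hmeas i).mul (hmeas j)) fun y => ?_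
    rw [abs_mul]
    have e1 := PiLp.norm_apply_le (gradient M.loss ((y : Euc d) - M.link M.θ₀ u)) i
    have e2 := PiLp.norm_apply_le (gradient M.loss ((y : Euc d) - M.link M.θ₀ u)) j
    have e3 := hb.grad_le' (hle y)
    exact mul_le_mul (e1.trans e3) (e2.trans e3) (abs_nonneg _) hb.G_nonneg
  rw [dotProduct_mulVec_eq_sum]
  have : ∀ y : Sph d, M.condDens M.θ₀ u y •
      (inner ℝ (gradient M.loss ((y : Euc d) - M.link M.θ₀ u)) a *
        inner ℝ (gradient M.loss ((y : Euc d) - M.link M.θ₀ u)) b) =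
      ∑ i, ∑ j, a i * b j * ((gradient M.loss ((y : Euc d) - M.link M.θ₀ u) i *
        gradient M.loss ((y : Euc d) - M.link M.θ₀ u) j) * M.condDens M.θ₀ u y) := by
    intro y
    rw [PiLp.inner_apply, PiLp.inner_apply, Finset.sum_mul_sum, smul_eq_mul, Finset.mul_sum]
    refine Finset.sum_congr rfl fun i _ => ?_
    rw [Finset.mul_sum]
    refine Finset.sum_congr rfl fun j _ => ?_
    simp only [RCLike.inner_apply, RCLike.conj_to_real]
    ring
  simp only [this]
  rw [integral_finsetSum _ fun i _ => integrable_finsetSum _ fun j _ => (hint i j).const_mul _]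
  refine Finset.sum_congr rfl fun i _ => ?_
  rw [integral_finsetSum _ fun j _ => (hint i j).const_mul _]
  refine Finset.sum_congr rfl fun j _ => ?_
  rw [integral_const_mul]
  rfl

end Conditional

end ESIM

/-! ### Derivatives of the index and of the fitted value -/

/-- The Jacobian matrix of `β`, as a linear map. -/
def jacMap {k : ℕ} (θ : Euc k) : Euc k →L[ℝ] Euc (k + 1) :=
  (Matrix.toLpLin 2 2 (jac θ)).toContinuousLinearMap

theorem ofLp_jacMap {k : ℕ} (θ v : Euc k) : (jacMap θ v).ofLp = (jac θ).mulVec v.ofLp := rfl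

theorem inner_jacMap {k : ℕ} (θ v : Euc k) (x : Euc (k + 1)) :
    inner ℝ x (jacMap θ v) = (jac θ).transpose.mulVec x.ofLp ⬝ᵥ v.ofLp := by
  rw [EuclideanSpace.inner_eq_star_dotProduct, ofLp_jacMap, star_trivial, dotProduct_comm,
    Matrix.dotProduct_mulVec, Matrix.mulVec_transpose]

theorem hasFDerivAt_betaOf {k : ℕ} {θ : Euc k} (hθ : θ ∈ paramSpace k) :
    HasFDerivAt betaOf (jacMap θ) θ := by
  have hpos : 0 < 1 - ‖θ‖ ^ 2 := sub_pos.2 hθ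
  rw [← hasFDerivWithinAt_univ, hasFDerivWithinAt_euclidean]
  simp only [hasFDerivWithinAt_univ]
  intro i
  refine Fin.cases ?_ (fun j => ?_) i
  · have h1 : HasFDerivAt (fun θ : Euc k => 1 - ‖θ‖ ^ 2) (-(2 • innerSL ℝ θ)) θ := by
      simpa using ((hasStrictFDerivAt_norm_sq θ).hasFDerivAt).const_sub 1
    have h2 := h1.sqrt hpos.ne'
    refine (h2.congr_fderiv ?_ : HasFDerivAt (fun θ : Euc k => Real.sqrt (1 - ‖θ‖ ^ 2)) _ θ)
    ext v
    have : (EuclideanSpace.proj (𝕜 := ℝ) (0 : Fin (k + 1)) ∘L jacMap θ) v =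
        ∑ j, (-θ j / Real.sqrt (1 - ‖θ‖ ^ 2)) * v j := rfl
    rw [this]
    simp only [smul_apply, neg_apply,
      innerSL_apply_apply, PiLp.inner_apply, smul_eq_mul, nsmul_eq_mul, RCLike.inner_apply,
      RCLike.conj_to_real, Nat.cast_ofNat]
    have hs : Real.sqrt (1 - ‖θ‖ ^ 2) ≠ 0 := (Real.sqrt_pos.2 hpos).ne'
    rw [show (1 / (2 * √(1 - ‖θ‖ ^ 2)) * -(2 * ∑ x, v.ofLp x * θ.ofLp x)) =
      (-(1 / √(1 - ‖θ‖ ^ 2))) * ∑ x, v.ofLp x * θ.ofLp x by field_simp, Finset.mul_sum]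
    refine Finset.sum_congr rfl fun j _ => ?_
    field_simp
  · refine (EuclideanSpace.proj (𝕜 := ℝ) j).hasFDerivAt.congr_fderiv ?_
    ext v
    have : (EuclideanSpace.proj (𝕜 := ℝ) j.succ ∘L jacMap θ) v =
        ∑ l, (1 : Matrix (Fin k) (Fin k) ℝ) j l * v l := rfl
    rw [this]
    simp [Matrix.one_apply]

theorem hasFDerivAt_idx {k : ℕ} {θ : Euc k} (hθ : θ ∈ paramSpace k) (x : Euc (k + 1)) :
    HasFDerivAt (fun θ => idx θ x) (innerSL ℝ x ∘L jacMap θ) θ :=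
  (innerSL ℝ x).hasFDerivAt.comp θ (hasFDerivAt_betaOf hθ)

theorem continuous_idx_param {k : ℕ} (x : Euc (k + 1)) : Continuous fun θ : Euc k => idx θ x := by
  have : Continuous (betaOf : Euc k → Euc (k + 1)) := by
    refine (PiLp.continuous_toLp 2 _).comp (continuous_pi fun i => ?_)
    refine Fin.cases ?_ (fun j => ?_) i
    · simp only [Fin.cons_zero]; fun_prop
    · simp only [Fin.cons_succ]; fun_prop
  unfold idx
  fun_prop

namespace ESIM

variable {d k : ℕ} {M : ESIM d k}

/-- The derivative of `(θ, u) ↦ μ_θ(u)` at `(θ₀, u)`. -/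
abbrev linkDeriv (M : ESIM d k) (u : ℝ) : Euc k × ℝ →L[ℝ] Euc d :=
  fderiv ℝ (fun w : Euc k × ℝ => M.link w.1 w.2) (M.θ₀, u)

/-- The derivative of the fitted value with respect to the parameter at `θ₀`. -/
def fitDeriv (M : ESIM d k) (x : Euc (k + 1)) : Euc k →L[ℝ] Euc d :=
  M.linkDeriv (idx M.θ₀ x) ∘L
    (ContinuousLinearMap.id ℝ (Euc k)).prod (innerSL ℝ x ∘L jacMap M.θ₀)

theorem hasFDerivAt_link (hreg : M.LinkRegular) {u : ℝ} (hu : u ∈ M.supp M.θ₀) :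
    HasFDerivAt (fun w : Euc k × ℝ => M.link w.1 w.2) (M.linkDeriv u) (M.θ₀, u) :=
  ((hreg.smooth u hu).differentiableAt one_ne_zero).hasFDerivAt

theorem linkDeriv_zero_one (hreg : M.LinkRegular) {u : ℝ} (hu : u ∈ M.supp M.θ₀) :
    M.linkDeriv u (0, 1) = deriv (M.link M.θ₀) u := by
  have h1 : HasDerivAt (fun v : ℝ => (M.θ₀, v)) ((0 : Euc k), (1 : ℝ)) u :=
    (hasDerivAt_const u M.θ₀).prodMk (hasDerivAt_id u)
  exact ((hasFDerivAt_link hreg hu).comp_hasDerivAt u h1).deriv.symm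

theorem hasFDerivAt_fit (hreg : M.LinkRegular) (hθ : M.θ₀ ∈ paramSpace k) {x : Euc (k + 1)}
    (hx : idx M.θ₀ x ∈ M.supp M.θ₀) :
    HasFDerivAt (fun θ => M.fit θ x) (M.fitDeriv x) M.θ₀ :=
  HasFDerivAt.comp (g := fun w : Euc k × ℝ => M.link w.1 w.2) (f := fun θ => (θ, idx θ x)) M.θ₀
    (hasFDerivAt_link hreg hx) ((hasFDerivAt_id M.θ₀).prodMk (hasFDerivAt_idx hθ x))

/-- The parameter enters the fitted value twice: through the link at a fixed index, and through the
index. The first contribution is still unknown here and is identified by `linkDeriv_fst_eq`. -/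
theorem fitDeriv_apply (hreg : M.LinkRegular) {x : Euc (k + 1)}
    (hx : idx M.θ₀ x ∈ M.supp M.θ₀) (v : Euc k) :
    M.fitDeriv x v = M.linkDeriv (idx M.θ₀ x) (v, 0) +
      inner ℝ x (jacMap M.θ₀ v) • deriv (M.link M.θ₀) (idx M.θ₀ x) := by
  rw [← linkDeriv_zero_one hreg hx, ← map_smul, ← map_add]
  simp [fitDeriv]

theorem continuousOn_linkDeriv (hreg : M.LinkRegular) :
    ContinuousOn M.linkDeriv (M.supp M.θ₀) := by
  intro u hu
  have h1 : ContDiffAt ℝ 0 (fderiv ℝ fun w : Euc k × ℝ => M.link w.1 w.2) (M.θ₀, u) :=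
    (hreg.smooth u hu).fderiv_right (by simp)
  have h2 : ContinuousAt (fun v : ℝ => (M.θ₀, v)) u := by fun_prop
  exact (ContinuousAt.comp (f := fun v : ℝ => (M.θ₀, v)) h1.continuousAt h2).continuousWithinAt

theorem continuousOn_deriv_link (hreg : M.LinkRegular) :
    ContinuousOn (deriv (M.link M.θ₀)) (M.supp M.θ₀) := by
  have h1 : ContinuousOn (fun u => M.linkDeriv u (0, 1)) (M.supp M.θ₀) :=
    (continuousOn_linkDeriv hreg).clm_apply continuousOn_const
  exact h1.congr fun u hu => (linkDeriv_zero_one hreg hu).symm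

theorem continuousOn_Fmat (h3 : M.A3) (hθ : M.θ₀ ∈ paramSpace k) :
    ContinuousOn (M.Fmat M.θ₀) (M.supp M.θ₀) :=
  h3.F_cont.comp (f := fun u : ℝ => (M.θ₀, u)) (by fun_prop) fun _ hu => ⟨hθ, hu⟩

theorem continuousOn_Gmat (h3 : M.A3) (hθ : M.θ₀ ∈ paramSpace k) :
    ContinuousOn (M.Gmat M.θ₀) (M.supp M.θ₀) :=
  h3.G_cont.comp (f := fun u : ℝ => (M.θ₀, u)) (by fun_prop) fun _ hu => ⟨hθ, hu⟩

section Bounds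

variable {r C L : ℝ} {K : NNReal} {G : ℝ} (hb : M.LocalBounds r C L K G)
include hb

/-- Parameters on the line through `θ₀` in direction `v` stay in the ball of parameters. -/
theorem LocalBounds.eventually_mem (v : Euc k) :
    ∀ᶠ s in 𝓝[≠] (0 : ℝ), M.θ₀ + s • v ∈ Metric.closedBall M.θ₀ r := by
  have h1 : Tendsto (fun s : ℝ => M.θ₀ + s • v) (𝓝 0) (𝓝 (M.θ₀ + (0 : ℝ) • v)) :=
    Continuous.tendsto (by fun_prop) 0
  rw [zero_smul, add_zero] at h1
  exact (h1.mono_left nhdsWithin_le_nhds).eventually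
    (Metric.closedBall_mem_nhds _ hb.r_pos)

theorem tendsto_slope_fit (hreg : M.LinkRegular) {x : Euc (k + 1)}
    (hx : idx M.θ₀ x ∈ M.supp M.θ₀) (v : Euc k) :
    Tendsto (fun s : ℝ => s⁻¹ • (M.fit (M.θ₀ + s • v) x - M.fit M.θ₀ x)) (𝓝[≠] 0)
      (𝓝 (M.fitDeriv x v)) := by
  have h1 := (hasFDerivAt_fit hreg (hb.subset hb.mem_self) hx).hasLineDerivAt v
  simpa [HasLineDerivAt, hasDerivAt_iff_tendsto_slope_zero] using h1

/-- The Lipschitz bound passes to the limit of difference quotients. A sequence of step sizes is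
used because the exceptional null set in `fit_sub` depends on the pair of parameters. -/
theorem ae_norm_fitDeriv_le (hdens : M.HasDensities) (hreg : M.LinkRegular) (v : Euc k) :
    ∀ᵐ z ∂M.law, ‖M.fitDeriv z.1 v‖ ≤ L * ‖v‖ := by
  have hu : Tendsto (fun n : ℕ => ((n : ℝ) + 1)⁻¹) atTop (𝓝[≠] 0) := by
    rw [tendsto_nhdsWithin_iff]
    refine ⟨?_, Eventually.of_forall fun n => by
      simp only [mem_compl_iff, mem_singleton_iff]; positivity⟩
    simpa using tendsto_one_div_add_atTop_nhds_zero_nat (𝕜 := ℝ)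
  have hae : ∀ᵐ z ∂M.law, ∀ n : ℕ, M.θ₀ + ((n : ℝ) + 1)⁻¹ • v ∈ Metric.closedBall M.θ₀ r →
      ‖M.fit (M.θ₀ + ((n : ℝ) + 1)⁻¹ • v) z.1 - M.fit M.θ₀ z.1‖ ≤
        L * ‖((n : ℝ) + 1)⁻¹ • v‖ := by
    rw [ae_all_iff]
    intro n
    by_cases hn : M.θ₀ + ((n : ℝ) + 1)⁻¹ • v ∈ Metric.closedBall M.θ₀ r
    · filter_upwards [hb.fit_sub _ hn _ hb.mem_self] with z hz _
      simpa using hz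
    · exact Eventually.of_forall fun z h => absurd h hn
  filter_upwards [hae, ae_idx_mem_supp hdens (hb.subset hb.mem_self)] with z hz hzs
  refine le_of_tendsto ((tendsto_slope_fit hb hreg hzs v).comp hu).norm ?_
  filter_upwards [hu.eventually (hb.eventually_mem v)] with n hn
  have h1 := hz n hn
  simp only [Function.comp_apply]
  rw [norm_smul] at h1 ⊢
  have h2 : (0 : ℝ) < ‖(((n : ℝ) + 1)⁻¹)⁻¹‖ := by
    rw [norm_pos_iff]; positivity
  calc _ ≤ ‖(((n : ℝ) + 1)⁻¹)⁻¹‖ * (L * (‖((n : ℝ) + 1)⁻¹‖ * ‖v‖)) := by gcongr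
    _ = (‖(((n : ℝ) + 1)⁻¹)⁻¹‖ * ‖((n : ℝ) + 1)⁻¹‖) * (L * ‖v‖) := by ring
    _ = L * ‖v‖ := by
      rw [← norm_mul, inv_mul_cancel₀ (by positivity), norm_one, one_mul]

theorem aestronglyMeasurable_fitDeriv (hdens : M.HasDensities) (hreg : M.LinkRegular)
    (v : Euc k) :
    AEStronglyMeasurable (fun z : Euc (k + 1) × Sph d => M.fitDeriv z.1 v) M.law := by
  have hu : Tendsto (fun n : ℕ => ((n : ℝ) + 1)⁻¹) atTop (𝓝[≠] 0) := by
    rw [tendsto_nhdsWithin_iff]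
    refine ⟨?_, Eventually.of_forall fun n => by
      simp only [mem_compl_iff, mem_singleton_iff]; positivity⟩
    simpa using tendsto_one_div_add_atTop_nhds_zero_nat (𝕜 := ℝ)
  -- The sequence is shifted by `N` so that every perturbed parameter lies in `Θ`, where the links
  -- are measurable.
  obtain ⟨N, hN⟩ := eventually_atTop.1 (hu.eventually (hb.eventually_mem v))
  have hu' := hu.comp (tendsto_add_atTop_nat N)
  refine aestronglyMeasurable_of_tendsto_ae (u := atTop) (f := fun (n : ℕ) z =>
    (((((n + N : ℕ) : ℝ) + 1)⁻¹)⁻¹ • (M.fit (M.θ₀ + (((n + N : ℕ) : ℝ) + 1)⁻¹ • v) z.1 -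
      M.fit M.θ₀ z.1))) (fun n => ?_) ?_
  · have h1 := measurable_fit hreg (hb.subset (hN (n + N) (by omega)))
    have h2 := measurable_fit hreg (hb.subset hb.mem_self)
    exact (((h1.comp measurable_fst).sub (h2.comp measurable_fst)).const_smul
      ((((n + N : ℕ) : ℝ) + 1)⁻¹)⁻¹).aestronglyMeasurable
  · filter_upwards [ae_idx_mem_supp hdens (hb.subset hb.mem_self)] with z hzs
    exact (tendsto_slope_fit hb hreg hzs v).comp hu'

end Bounds

/-- The Hessian of (A3) is given for each fixed index; since the set of differentiability points is
measurable, the disintegration applies. -/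
theorem ae_differentiableAt_gradient {κ : ℝ} (hdens : M.HasDensities) (hθ : M.θ₀ ∈ paramSpace k)
    (hclass : M.InClass κ) (h3 : M.A3) (hreg : M.LinkRegular) :
    ∀ᵐ z ∂M.law, DifferentiableAt ℝ (gradient M.loss) (M.resid M.θ₀ z) :=
  ae_law_of_forall_supp hdens hθ hclass hreg
    (measurable_resid hreg hθ (measurableSet_of_differentiableAt ℝ (gradient M.loss)))
    fun _ hx => h3.hess _ hθ _ hx

theorem measurable_gradient_resid (h3 : M.A3) (hreg : M.LinkRegular) {θ : Euc k}
    (hθ : θ ∈ paramSpace k) : Measurable fun z => gradient M.loss (M.resid θ z) :=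
  h3.grad_lipschitz.continuous.measurable.comp (measurable_resid hreg hθ)

/-! ### Differentiating the estimating equations -/

section Score

variable {κ : ℝ} (hdens : M.HasDensities) (hlink : M.IsLink) (hθ : M.θ₀ ∈ paramSpace k)
  (hclass : M.InClass κ) (h1 : M.A1) (h3 : M.A3) (hreg : M.LinkRegular)
  {r C L : ℝ} {K : NNReal} {G : ℝ} (hb : M.LocalBounds r C L K G)

include hb in
theorem LocalBounds.norm_gradient_resid_sub_le {z : Euc (k + 1) × Sph d} {θ : Euc k}
    (h1 : ‖M.resid θ z‖ ≤ 1 + C) (h2 : ‖M.resid M.θ₀ z‖ ≤ 1 + C)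
    (h3 : ‖M.fit θ z.1 - M.fit M.θ₀ z.1‖ ≤ L * ‖θ - M.θ₀‖) :
    ‖gradient M.loss (M.resid θ z) - gradient M.loss (M.resid M.θ₀ z)‖ ≤
      K * (L * ‖θ - M.θ₀‖) := by
  have e1 := hb.grad_lip.dist_le_mul (M.resid θ z)
    (by rw [mem_closedBall_zero_iff]; linarith) (M.resid M.θ₀ z)
    (by rw [mem_closedBall_zero_iff]; linarith)
  rw [dist_eq_norm, dist_eq_norm] at e1
  refine e1.trans ?_
  have e2 : M.resid θ z - M.resid M.θ₀ z = -(M.fit θ z.1 - M.fit M.θ₀ z.1) := by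
    simp only [resid]; abel
  rw [e2, norm_neg]
  gcongr

include hθ hreg in
theorem aestronglyMeasurable_hess_apply {f : Euc (k + 1) × Sph d → Euc d}
    (hf : AEStronglyMeasurable f M.law) :
    AEStronglyMeasurable (fun z => M.hess (M.resid M.θ₀ z) (f z)) M.law := by
  have h1 : Measurable (fun z => M.hess (M.resid M.θ₀ z)) :=
    (measurable_fderiv ℝ (gradient M.loss)).comp (measurable_resid hreg hθ)
  exact (isBoundedBilinearMap_apply (𝕜 := ℝ)).continuous.comp_aestronglyMeasurable
    (h1.aestronglyMeasurable.prodMk hf)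

include hdens hlink hθ hclass h1 h3 hreg hb in
/-- The derivative at `θ₀` of the unconditional estimating equations
`E[φ(U_θ) ψ'(Y - μ_θ(U_θ))] = 0`. -/
theorem integral_test_mul_inner_hess_eq_zero {φ : ℝ → ℝ} (hφ : ContDiff ℝ 1 φ)
    (hφc : HasCompactSupport φ) (v : Euc k) (w : Euc d) :
    ∫ z, φ (idx M.θ₀ z.1) * inner ℝ w (M.hess (M.resid M.θ₀ z) (M.fitDeriv z.1 v)) ∂M.law = 0 := by
  obtain ⟨Lφ, hLφ⟩ := hφ.lipschitzWith_of_hasCompactSupport hφc one_ne_zero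
  obtain ⟨Bφ, hBφ⟩ := hφc.exists_bound_of_continuous hφ.continuous
  obtain ⟨D, hD⟩ := h1.compact.exists_bound_of_continuousOn (f := id) continuousOn_id
  obtain ⟨Lβ, hLβ⟩ := (hasFDerivAt_betaOf hθ).isBigO_sub.bound
  have hBφ0 : 0 ≤ Bφ := (norm_nonneg _).trans (hBφ 0)
  set Φ : Euc k → Euc (k + 1) × Sph d → ℝ := fun θ z =>
    φ (idx θ z.1) * inner ℝ (gradient M.loss (M.resid θ z)) w with hΦ
  have hmeas : ∀ θ ∈ Metric.closedBall M.θ₀ r, Measurable (Φ θ) := by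
    intro θ hθ'
    have e1 := measurable_gradient_resid h3 hreg (hb.subset hθ')
    exact (hφ.continuous.measurable.comp (measurable_idx_fst θ)).mul
      (e1.inner measurable_const)
  have hint : ∀ θ ∈ Metric.closedBall M.θ₀ r, Integrable (Φ θ) M.law := by
    intro θ hθ'
    refine Integrable.of_bound (hmeas θ hθ').aestronglyMeasurable (Bφ * (G * ‖w‖)) ?_
    filter_upwards [hb.ae_resid_le hθ'] with z hz
    rw [norm_mul]
    have := hb.grad_le' hz
    gcongr
    · exact hBφ _
    · exact (norm_inner_le_norm _ _).trans (by gcongr)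
  -- The weight depends on `U_θ` only, so conditioning on `U_θ` and the estimating equation at that
  -- same `θ` suffice; no independence is needed away from `θ₀`.
  have hzero : ∀ θ ∈ Metric.closedBall M.θ₀ r, ∫ z, Φ θ z ∂M.law = 0 := by
    intro θ hθ'
    have hl := hreg.meas θ (hb.subset hθ')
    have hfm : Measurable (fun q : ℝ × Sph d =>
        φ q.1 * inner ℝ (gradient M.loss ((q.2 : Euc d) - M.link θ q.1)) w) := by
      have e1 : Measurable (fun q : ℝ × Sph d => (q.2 : Euc d) - M.link θ q.1) :=
        (measurable_subtype_coe.comp measurable_snd).sub (hl.comp measurable_fst)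
      exact (hφ.continuous.measurable.comp measurable_fst).mul
        ((h3.grad_lipschitz.continuous.measurable.comp e1).inner measurable_const)
    refine integral_idx_eq_zero hdens (hb.subset hθ') hfm fun u hu => ?_
    simp only [mul_assoc]
    rw [integral_const_mul, integral_inner_gradient_eq_zero hdens hlink h3 (hb.subset hθ') hu,
      mul_zero]
  set Φ' : Euc (k + 1) × Sph d → ℝ := fun z =>
    inner ℝ (gradient M.loss (M.resid M.θ₀ z))
      ((deriv φ (idx M.θ₀ z.1) * inner ℝ z.1 (jacMap M.θ₀ v)) • w) -
    φ (idx M.θ₀ z.1) * inner ℝ w (M.hess (M.resid M.θ₀ z) (M.fitDeriv z.1 v)) with hΦ'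
  have hlim : Tendsto (fun s : ℝ => ∫ z, s⁻¹ * (Φ (M.θ₀ + s • v) z - Φ M.θ₀ z) ∂M.law) (𝓝[≠] 0)
      (𝓝 (∫ z, Φ' z ∂M.law)) := by
    refine tendsto_integral_filter_of_dominated_convergence
      -- A product rule for Lipschitz constants: the weight varies through the index on the compact
      -- domain, and the gradient varies through the fit.
      (fun _ => Lφ * (D * (Lβ * ‖v‖)) * (G * ‖w‖) + Bφ * (K * (L * ‖v‖) * ‖w‖)) ?_ ?_
      (integrable_const _) ?_
    · filter_upwards [hb.eventually_mem v] with s hs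
      exact (((hmeas _ hs).sub (hmeas _ hb.mem_self)).const_mul _).aestronglyMeasurable
    · have hβ : ∀ᶠ s in 𝓝[≠] (0 : ℝ),
          ‖betaOf (M.θ₀ + s • v) - betaOf M.θ₀‖ ≤ Lβ * ‖M.θ₀ + s • v - M.θ₀‖ := by
        have e1 : Tendsto (fun s : ℝ => M.θ₀ + s • v) (𝓝 0) (𝓝 (M.θ₀ + (0 : ℝ) • v)) :=
          Continuous.tendsto (by fun_prop) 0
        rw [zero_smul, add_zero] at e1
        exact (e1.mono_left nhdsWithin_le_nhds).eventually hLβ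
      filter_upwards [hb.eventually_mem v, hβ, self_mem_nhdsWithin] with s hs hsβ hs0
      filter_upwards [hb.ae_resid_le hs, hb.ae_resid_le hb.mem_self,
        hb.fit_sub _ hs _ hb.mem_self, h1.mem_dom] with z ha hb' hc hd
      have hsv : M.θ₀ + s • v - M.θ₀ = s • v := by abel
      have hgs := hb.norm_gradient_resid_sub_le ha hb' hc
      rw [hsv, norm_smul] at hgs hsβ
      have hs0' : (0 : ℝ) < ‖s‖ := norm_pos_iff.2 hs0
      have hx := hD _ hd
      simp only [id] at hx
      have hD0 : 0 ≤ D := (norm_nonneg _).trans hx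
      have hi : ‖φ (idx (M.θ₀ + s • v) z.1) - φ (idx M.θ₀ z.1)‖ ≤
          Lφ * (D * (Lβ * (‖s‖ * ‖v‖))) := by
        have e1 := hLφ.dist_le_mul (idx (M.θ₀ + s • v) z.1) (idx M.θ₀ z.1)
        rw [dist_eq_norm, dist_eq_norm] at e1
        refine e1.trans ?_
        gcongr
        unfold idx
        rw [← inner_sub_right]
        exact (norm_inner_le_norm _ _).trans (mul_le_mul hx hsβ (norm_nonneg _) hD0)
      have hsplit : Φ (M.θ₀ + s • v) z - Φ M.θ₀ z =
          (φ (idx (M.θ₀ + s • v) z.1) - φ (idx M.θ₀ z.1)) *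
            inner ℝ (gradient M.loss (M.resid (M.θ₀ + s • v) z)) w +
          φ (idx M.θ₀ z.1) * inner ℝ (gradient M.loss (M.resid (M.θ₀ + s • v) z) -
            gradient M.loss (M.resid M.θ₀ z)) w := by
        simp only [hΦ, inner_sub_left]; ring
      have hin1 : ‖inner ℝ (gradient M.loss (M.resid (M.θ₀ + s • v) z)) w‖ ≤ G * ‖w‖ :=
        (norm_inner_le_norm _ _).trans (by gcongr; exact hb.grad_le' ha)
      have hin2 : ‖inner ℝ (gradient M.loss (M.resid (M.θ₀ + s • v) z) -
            gradient M.loss (M.resid M.θ₀ z)) w‖ ≤ K * (L * (‖s‖ * ‖v‖)) * ‖w‖ :=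
        (norm_inner_le_norm _ _).trans (by gcongr)
      rw [norm_mul, norm_inv, hsplit, inv_mul_le_iff₀ hs0']
      refine (norm_add_le _ _).trans ?_
      rw [norm_mul, norm_mul]
      have m1 := mul_le_mul hi hin1 (norm_nonneg _) ((norm_nonneg _).trans hi)
      have m2 := mul_le_mul (hBφ (idx M.θ₀ z.1)) hin2 (norm_nonneg _) hBφ0
      refine (add_le_add m1 m2).trans (le_of_eq ?_)
      ring
    · filter_upwards [ae_idx_mem_supp hdens hθ, ae_differentiableAt_gradient hdens hθ hclass h3 hreg]
        with z hz hdz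
      have hline : HasDerivAt (fun s : ℝ => M.θ₀ + s • v) v 0 := by
        simpa using ((hasDerivAt_id (0 : ℝ)).smul_const v).const_add M.θ₀
      have d1 : HasDerivAt (fun s : ℝ => idx (M.θ₀ + s • v) z.1)
          (inner ℝ z.1 (jacMap M.θ₀ v)) 0 := by
        have e : HasFDerivAt (fun θ => idx θ z.1) (innerSL ℝ z.1 ∘L jacMap M.θ₀)
            (M.θ₀ + (0 : ℝ) • v) := by simpa using hasFDerivAt_idx hθ z.1
        exact e.comp_hasDerivAt (0 : ℝ) hline
      have d2 : HasDerivAt (fun s : ℝ => φ (idx (M.θ₀ + s • v) z.1))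
          (deriv φ (idx M.θ₀ z.1) * inner ℝ z.1 (jacMap M.θ₀ v)) 0 := by
        have e : HasDerivAt φ (deriv φ (idx M.θ₀ z.1)) (idx (M.θ₀ + (0 : ℝ) • v) z.1) := by
          simpa using (hφ.differentiable one_ne_zero (idx M.θ₀ z.1)).hasDerivAt
        exact e.comp (0 : ℝ) d1
      have d3 : HasDerivAt (fun s : ℝ => M.resid (M.θ₀ + s • v) z) (-M.fitDeriv z.1 v) 0 := by
        have e : HasFDerivAt (fun θ => M.fit θ z.1) (M.fitDeriv z.1)
            (M.θ₀ + (0 : ℝ) • v) := by simpa using hasFDerivAt_fit hreg hθ hz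
        exact (e.comp_hasDerivAt (0 : ℝ) hline).const_sub _
      have d4 : HasDerivAt (fun s : ℝ => gradient M.loss (M.resid (M.θ₀ + s • v) z))
          (M.hess (M.resid M.θ₀ z) (-M.fitDeriv z.1 v)) 0 := by
        have e : HasFDerivAt (gradient M.loss) (M.hess (M.resid M.θ₀ z))
            (M.resid (M.θ₀ + (0 : ℝ) • v) z) := by simpa using hdz.hasFDerivAt
        exact e.comp_hasDerivAt (0 : ℝ) d3
      have d5 := d2.mul (d4.inner ℝ (hasDerivAt_const (0 : ℝ) w))
      have d6 := hasDerivAt_iff_tendsto_slope_zero.1 d5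
      simp only [zero_add, zero_smul, add_zero, inner_zero_right, map_neg, inner_neg_left,
        smul_eq_mul, Pi.mul_apply] at d6
      refine (d6.congr fun s => ?_).trans (le_of_eq (congrArg 𝓝 ?_))
      · simp only [hΦ]
      · simp only [hΦ', inner_smul_right, real_inner_comm w]
        ring
  have hlim0 : Tendsto (fun s : ℝ => ∫ z, s⁻¹ * (Φ (M.θ₀ + s • v) z - Φ M.θ₀ z) ∂M.law) (𝓝[≠] 0)
      (𝓝 0) := by
    refine tendsto_const_nhds.congr' ?_
    filter_upwards [hb.eventually_mem v] with s hs
    rw [integral_const_mul, integral_sub (hint _ hs) (hint _ hb.mem_self), hzero _ hs,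
      hzero _ hb.mem_self, sub_zero, mul_zero]
  have heq := tendsto_nhds_unique hlim hlim0
  obtain ⟨Bφ', hBφ'⟩ := hφc.deriv.exists_bound_of_continuous (hφ.continuous_deriv le_rfl)
  have hint1 : Integrable (fun z : Euc (k + 1) × Sph d =>
      inner ℝ (gradient M.loss (M.resid M.θ₀ z))
        ((deriv φ (idx M.θ₀ z.1) * inner ℝ z.1 (jacMap M.θ₀ v)) • w)) M.law := by
    have e1 := measurable_gradient_resid h3 hreg hθ
    have e2 : Measurable (fun z : Euc (k + 1) × Sph d => deriv φ (idx M.θ₀ z.1)) :=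
      (measurable_deriv φ).comp (measurable_idx_fst _)
    have e3 : Measurable (fun z : Euc (k + 1) × Sph d => inner ℝ z.1 (jacMap M.θ₀ v)) :=
      measurable_fst.inner measurable_const
    refine Integrable.of_bound
      (e1.inner ((e2.mul e3).smul measurable_const)).aestronglyMeasurable
      (G * (Bφ' * (D * ‖jacMap M.θ₀ v‖) * ‖w‖)) ?_
    filter_upwards [hb.ae_resid_le hb.mem_self, h1.mem_dom] with z ha hd
    refine (norm_inner_le_norm _ _).trans ?_
    have hx := hD _ hd
    simp only [id] at hx
    rw [norm_smul, norm_mul]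
    have hB := hBφ' (idx M.θ₀ z.1)
    refine mul_le_mul (hb.grad_le' ha) ?_ (by positivity) hb.G_nonneg
    refine mul_le_mul_of_nonneg_right ?_ (norm_nonneg _)
    refine mul_le_mul hB ((norm_inner_le_norm _ _).trans (by gcongr)) (norm_nonneg _)
      ((norm_nonneg _).trans hB)
  have hint2 : Integrable (fun z : Euc (k + 1) × Sph d => φ (idx M.θ₀ z.1) *
      inner ℝ w (M.hess (M.resid M.θ₀ z) (M.fitDeriv z.1 v))) M.law := by
    have e1 := aestronglyMeasurable_hess_apply hθ hreg (aestronglyMeasurable_fitDeriv hb hdens hreg v)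
    refine Integrable.of_bound
      (((hφ.continuous.measurable.comp (measurable_idx_fst _)).aestronglyMeasurable).mul
        (aestronglyMeasurable_const.inner e1)) (Bφ * (‖w‖ * (K * (L * ‖v‖)))) ?_
    filter_upwards [hb.ae_resid_le hb.mem_self, ae_norm_fitDeriv_le hb hdens hreg v] with z ha hd
    rw [norm_mul]
    refine mul_le_mul (hBφ _) ((norm_inner_le_norm _ _).trans ?_) (norm_nonneg _) hBφ0
    gcongr
    exact (ContinuousLinearMap.le_opNorm _ _).trans
      (mul_le_mul (hb.norm_hess_le ha) hd (norm_nonneg _) K.2)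
  -- The term with `φ'` carries the factor `xᵀ J v`, which is not a function of the index. It
  -- vanishes because the score at `θ₀` is centred given all of `X`.
  rw [hΦ', integral_sub hint1 hint2,
    integral_inner_gradient_resid_eq_zero hdens hlink hθ hclass h3 hreg
      (q := fun x => (deriv φ (idx M.θ₀ x) * inner ℝ x (jacMap M.θ₀ v)) • w) hint1] at heq
  linarith

end Score

end ESIM

/-! ### How the link moves with the parameter -/

/-- Off the closed support of `φ` the product is locally zero, so the behaviour of `q` outside `U`
is irrelevant. This localizes data that are continuous on the support of the index only. -/
theorem continuous_mul_of_tsupport_subset {X : Type*} [TopologicalSpace X] {U : Set X}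
    (hU : IsOpen U) {φ q : X → ℝ} (hφ : Continuous φ) (hφU : tsupport φ ⊆ U)
    (hq : ContinuousOn q U) : Continuous fun x => φ x * q x := by
  refine continuous_of_tsupport fun x hx => ?_
  have hxU : x ∈ U := hφU (closure_mono (Function.support_mul_subset_left φ q) hx)
  exact hφ.continuousAt.mul (hq.continuousAt (hU.mem_nhds hxU))

namespace ESIM

variable {d k : ℕ} {M : ESIM d k}

theorem sigmaU_le : M.sigmaU ≤ (inferInstance : MeasurableSpace (Euc (k + 1) × Sph d)) :=
  (measurable_idx_fst M.θ₀).comap_le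

theorem integrable_fst (h1 : M.A1) :
    Integrable (fun z : Euc (k + 1) × Sph d => z.1) M.law := by
  obtain ⟨D, hD⟩ := h1.compact.exists_bound_of_continuousOn (f := id) continuousOn_id
  refine Integrable.of_bound measurable_fst.aestronglyMeasurable D ?_
  filter_upwards [h1.mem_dom] with z hz
  exact hD _ hz

/-- `X` may be replaced by its conditional mean under a bounded weight depending on the index. -/
theorem integral_mul_inner_fst_eq (h1 : M.A1) {e : ℝ → Euc (k + 1)} (he : M.IsCondMean e)
    {ρ : ℝ → ℝ} (hρ : Measurable ρ) {B : ℝ} (hB : ∀ u, ‖ρ u‖ ≤ B) (b : Euc (k + 1)) :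
    ∫ z, ρ (idx M.θ₀ z.1) * inner ℝ z.1 b ∂M.law =
      ∫ z, ρ (idx M.θ₀ z.1) * inner ℝ (e (idx M.θ₀ z.1)) b ∂M.law := by
  have hidx : Measurable[M.sigmaU] (fun z : Euc (k + 1) × Sph d => idx M.θ₀ z.1) :=
    comap_measurable _
  have hsm : StronglyMeasurable[M.sigmaU]
      (fun z : Euc (k + 1) × Sph d => ρ (idx M.θ₀ z.1) • b) :=
    (hρ.comp hidx).stronglyMeasurable.smul_const b
  have key := condExp_stronglyMeasurable_bilin_of_bound (innerSL ℝ) (sigmaU_le (M := M)) hsm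
    (integrable_fst h1) (B * ‖b‖) (Eventually.of_forall fun z => by
      rw [norm_smul]; exact mul_le_mul_of_nonneg_right (hB _) (norm_nonneg _))
  calc ∫ z, ρ (idx M.θ₀ z.1) * inner ℝ z.1 b ∂M.law
      = ∫ z, innerSL ℝ (ρ (idx M.θ₀ z.1) • b) z.1 ∂M.law := by
        refine integral_congr_ae (Eventually.of_forall fun z => ?_)
        simp [real_inner_comm]
    _ = ∫ z, (condExp M.sigmaU M.law
          fun z => innerSL ℝ (ρ (idx M.θ₀ z.1) • b) z.1) z ∂M.law :=
        (integral_condExp sigmaU_le).symm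
    _ = ∫ z, ρ (idx M.θ₀ z.1) * inner ℝ (e (idx M.θ₀ z.1)) b ∂M.law := by
        refine integral_congr_ae ?_
        filter_upwards [key, he.ae_eq] with z hz hez
        rw [hz, hez, innerSL_apply_apply, real_inner_smul_left, real_inner_comm]
        rfl

theorem integral_idx_eq (hdens : M.HasDensities) {θ : Euc k} (hθ : θ ∈ paramSpace k) {η : ℝ → ℝ}
    (hη : Measurable η) :
    ∫ z, η (idx θ z.1) ∂M.law = ∫ u, M.idxDens θ u * η u := by
  have hm := (hdens.meas_idx θ hθ).ennreal_ofReal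
  rw [← integral_map (f := η) (measurable_idx_fst θ).aemeasurable hη.aestronglyMeasurable,
    hdens.idx_law θ hθ, integral_withDensity_eq_integral_toReal_smul hm (by simp)]
  simp only [ENNReal.toReal_ofReal (hdens.nonneg θ hθ _), smul_eq_mul]

section Conditional

variable {κ : ℝ} (hdens : M.HasDensities) (hlink : M.IsLink) (hθ : M.θ₀ ∈ paramSpace k)
  (hclass : M.InClass κ) (h1 : M.A1) (h3 : M.A3) (hreg : M.LinkRegular)
  {r C L : ℝ} {K : NNReal} {G : ℝ} (hb : M.LocalBounds r C L K G)

include hθ hreg hb in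
theorem integrable_inner_hess {a b : Euc (k + 1) → Euc d}
    (ha : AEStronglyMeasurable (fun z : Euc (k + 1) × Sph d => a z.1) M.law)
    (hbm : AEStronglyMeasurable (fun z : Euc (k + 1) × Sph d => b z.1) M.law)
    {A B : ℝ} (haA : ∀ᵐ z ∂M.law, ‖a z.1‖ ≤ A) (hbB : ∀ᵐ z ∂M.law, ‖b z.1‖ ≤ B) :
    Integrable (fun z => inner ℝ (a z.1) (M.hess (M.resid M.θ₀ z) (b z.1))) M.law := by
  refine Integrable.of_bound (ha.inner (aestronglyMeasurable_hess_apply hθ hreg hbm))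
    (A * (K * B)) ?_
  filter_upwards [hb.ae_resid_le hb.mem_self, haA, hbB] with z hz h1 h2
  refine (norm_inner_le_norm _ _).trans (mul_le_mul h1 ?_ (norm_nonneg _)
    ((norm_nonneg _).trans h1))
  exact (ContinuousLinearMap.le_opNorm _ _).trans
    (mul_le_mul (hb.norm_hess_le hz) h2 (norm_nonneg _) K.2)

include hdens hθ hclass hreg hb in
theorem integral_law_inner_hess_eq {a b : Euc (k + 1) → Euc d}
    (hint : Integrable (fun z => inner ℝ (a z.1) (M.hess (M.resid M.θ₀ z) (b z.1))) M.law) :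
    ∫ z, inner ℝ (a z.1) (M.hess (M.resid M.θ₀ z) (b z.1)) ∂M.law =
      ∫ z, (a z.1).ofLp ⬝ᵥ (M.Fmat M.θ₀ (idx M.θ₀ z.1)).mulVec (b z.1).ofLp ∂M.law := by
  rw [integral_law_eq hdens hθ hclass hreg hint]
  refine integral_congr_ae ?_
  filter_upwards [ae_idx_mem_supp hdens hθ] with z hz
  exact integral_inner_hess_eq hdens hθ hb hz (a z.1) (b z.1)

include hdens hθ hclass h3 hreg hb in
theorem integral_law_inner_mul_inner_eq {a b : Euc (k + 1) → Euc d}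
    (hint : Integrable (fun z => inner ℝ (gradient M.loss (M.resid M.θ₀ z)) (a z.1) *
      inner ℝ (gradient M.loss (M.resid M.θ₀ z)) (b z.1)) M.law) :
    ∫ z, inner ℝ (gradient M.loss (M.resid M.θ₀ z)) (a z.1) *
      inner ℝ (gradient M.loss (M.resid M.θ₀ z)) (b z.1) ∂M.law =
      ∫ z, (a z.1).ofLp ⬝ᵥ (M.Gmat M.θ₀ (idx M.θ₀ z.1)).mulVec (b z.1).ofLp ∂M.law := by
  rw [integral_law_eq hdens hθ hclass hreg hint]
  refine integral_congr_ae ?_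
  filter_upwards [ae_idx_mem_supp hdens hθ] with z hz
  exact integral_inner_mul_inner_gradient_eq hdens hθ h3 hb hz (a z.1) (b z.1)

include h3 hθ in
theorem continuousOn_Fform (w : Euc d) {q : ℝ → Euc d} (hq : ContinuousOn q (M.supp M.θ₀)) :
    ContinuousOn (fun u => w.ofLp ⬝ᵥ (M.Fmat M.θ₀ u).mulVec (q u).ofLp) (M.supp M.θ₀) := by
  simp only [dotProduct_mulVec_eq_sum]
  refine continuousOn_finsetSum _ fun i _ => continuousOn_finsetSum _ fun j _ => ?_
  have h1 : ContinuousOn (fun u => q u j) (M.supp M.θ₀) :=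
    (EuclideanSpace.proj (𝕜 := ℝ) j).continuous.comp_continuousOn hq
  have h2 : ContinuousOn (fun u => M.Fmat M.θ₀ u i j) (M.supp M.θ₀) :=
    (continuous_id.matrix_elem i j).comp_continuousOn (continuousOn_Fmat h3 hθ)
  exact (continuousOn_const.mul h1).mul h2

include hdens hθ h1 in
-- The tower property replaces `X` by `e(U)`, and the resulting expectation of a function of `U`
-- becomes an integral against its density. Continuity is asked of the product with `ρ` because `e`
-- is continuous on the support only.
theorem integral_idx_add_mul_inner_eq {e : ℝ → Euc (k + 1)} (he : M.IsCondMean e) {p ρ : ℝ → ℝ}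
    (hp : Continuous p) (hpc : HasCompactSupport p) (hρ : Continuous ρ)
    (hρc : HasCompactSupport ρ) {b : Euc (k + 1)} (hρe : Continuous fun u => ρ u * inner ℝ (e u) b) :
    ∫ z, (p (idx M.θ₀ z.1) + ρ (idx M.θ₀ z.1) * inner ℝ z.1 b) ∂M.law =
      ∫ u, M.idxDens M.θ₀ u * (p u + ρ u * inner ℝ (e u) b) := by
  have hU := measurable_idx_fst (d := d) M.θ₀
  obtain ⟨Bp, hBp⟩ := hpc.exists_bound_of_continuous hp
  obtain ⟨Bρ, hBρ⟩ := hρc.exists_bound_of_continuous hρ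
  obtain ⟨B, hB⟩ := (hρc.mul_right :
    HasCompactSupport fun u => ρ u * inner ℝ (e u) b).exists_bound_of_continuous hρe
  have hpi : Integrable (fun z : Euc (k + 1) × Sph d => p (idx M.θ₀ z.1)) M.law :=
    Integrable.of_bound (hp.measurable.comp hU).aestronglyMeasurable Bp
      (Eventually.of_forall fun z => hBp _)
  have hρi : Integrable (fun z : Euc (k + 1) × Sph d =>
      ρ (idx M.θ₀ z.1) * inner ℝ z.1 b) M.law :=
    ((integrable_fst h1).inner_const _).bdd_mul (hρ.measurable.comp hU).aestronglyMeasurable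
      (Eventually.of_forall fun z => hBρ _)
  have hρei : Integrable (fun z : Euc (k + 1) × Sph d =>
      ρ (idx M.θ₀ z.1) * inner ℝ (e (idx M.θ₀ z.1)) b) M.law :=
    Integrable.of_bound (hρe.measurable.comp hU).aestronglyMeasurable B
      (Eventually.of_forall fun z => hB _)
  rw [integral_add hpi hρi, integral_mul_inner_fst_eq h1 he hρ.measurable hBρ b,
    ← integral_add hpi hρei]
  exact integral_idx_eq hdens hθ (hp.add hρe).measurable

include hdens hlink hθ hclass h1 h3 hreg hb in
-- In the differentiated estimating equation, conditioning on `X` turns the Hessian into `F(u)`, and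
-- conditioning on `U` turns `x` into `e(u)`. What remains is a Lebesgue integral to which the
-- fundamental lemma of the calculus of variations applies.
theorem integral_test_mul_Fform_eq_zero {e : ℝ → Euc (k + 1)} (he : M.IsCondMean e) (v : Euc k)
    (w : Euc d) {φ : ℝ → ℝ} (hφ : ContDiff ℝ 1 φ) (hφc : HasCompactSupport φ)
    (hφU : tsupport φ ⊆ M.supp M.θ₀) :
    ∫ u, φ u * (M.idxDens M.θ₀ u * (w.ofLp ⬝ᵥ (M.Fmat M.θ₀ u).mulVec (M.linkDeriv u (v, 0) +
      inner ℝ (e u) (jacMap M.θ₀ v) • deriv (M.link M.θ₀) u).ofLp)) = 0 := by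
  have hU : IsOpen (M.supp M.θ₀) := h1.supp_open _ hθ
  have hA : ContinuousOn (fun u => M.linkDeriv u (v, 0)) (M.supp M.θ₀) :=
    (continuousOn_linkDeriv hreg).clm_apply continuousOn_const
  have hμ : ContinuousOn (deriv (M.link M.θ₀)) (M.supp M.θ₀) := continuousOn_deriv_link hreg
  have hes : ContinuousOn (fun u => inner ℝ (e u) (jacMap M.θ₀ v)) (M.supp M.θ₀) :=
    he.cont.inner continuousOn_const
  have hFA := continuousOn_Fform hθ h3 w hA
  have hFμ := continuousOn_Fform hθ h3 w hμ
  have hbase := integral_test_mul_inner_hess_eq_zero hdens hlink hθ hclass h1 h3 hreg hb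
    (φ := φ) hφ hφc v w
  obtain ⟨Bφ, hBφ⟩ := hφc.exists_bound_of_continuous hφ.continuous
  have hint := integrable_inner_hess hθ hreg hb
    (a := fun x => φ (idx M.θ₀ x) • w) (b := fun x => M.fitDeriv x v)
    (((hφ.continuous.measurable.comp (measurable_idx_fst M.θ₀)).smul_const
      w).aestronglyMeasurable)
    (aestronglyMeasurable_fitDeriv hb hdens hreg v) (A := Bφ * ‖w‖)
    (Eventually.of_forall fun z => by
      rw [norm_smul]; exact mul_le_mul_of_nonneg_right (hBφ _) (norm_nonneg _))
    (ae_norm_fitDeriv_le hb hdens hreg v)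
  have hF1 := integral_law_inner_hess_eq hdens hθ hclass hreg hb
    (a := fun x => φ (idx M.θ₀ x) • w) (b := fun x => M.fitDeriv x v) hint
  simp only [real_inner_smul_left] at hF1
  rw [hbase] at hF1
  set p : ℝ → ℝ := fun u => φ u * (w.ofLp ⬝ᵥ (M.Fmat M.θ₀ u).mulVec
    (M.linkDeriv u (v, 0)).ofLp) with hp
  set ρ : ℝ → ℝ := fun u => φ u * (w.ofLp ⬝ᵥ (M.Fmat M.θ₀ u).mulVec
    (deriv (M.link M.θ₀) u).ofLp) with hρ
  have hpc : Continuous p := continuous_mul_of_tsupport_subset hU hφ.continuous hφU hFA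
  have hρc : Continuous ρ := continuous_mul_of_tsupport_subset hU hφ.continuous hφU hFμ
  have hsplit : ∫ z, ((φ (idx M.θ₀ z.1) • w).ofLp ⬝ᵥ
      (M.Fmat M.θ₀ (idx M.θ₀ z.1)).mulVec (M.fitDeriv z.1 v).ofLp) ∂M.law =
      ∫ z, (p (idx M.θ₀ z.1) + ρ (idx M.θ₀ z.1) * inner ℝ z.1 (jacMap M.θ₀ v)) ∂M.law := by
    refine integral_congr_ae ?_
    filter_upwards [ae_idx_mem_supp hdens hθ] with z hz
    rw [fitDeriv_apply hreg hz]
    simp only [hp, hρ, WithLp.ofLp_smul, WithLp.ofLp_add, smul_dotProduct, Matrix.mulVec_add,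
      Matrix.mulVec_smul, dotProduct_add, dotProduct_smul, smul_eq_mul]
    ring
  have hρe : Continuous fun u => ρ u * inner ℝ (e u) (jacMap M.θ₀ v) := by
    have := continuous_mul_of_tsupport_subset hU hφ.continuous hφU (hFμ.mul hes)
    refine this.congr fun u => ?_
    simp only [hρ, Pi.mul_apply, mul_assoc]
  rw [hsplit, integral_idx_add_mul_inner_eq hdens hθ h1 he hpc hφc.mul_right hρc hφc.mul_right
    hρe] at hF1
  refine Eq.trans ?_ hF1.symm
  refine integral_congr_ae (Eventually.of_forall fun u => ?_)
  simp only [hp, hρ, WithLp.ofLp_smul, WithLp.ofLp_add, Matrix.mulVec_add,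
      Matrix.mulVec_smul, dotProduct_add, dotProduct_smul, smul_eq_mul]
  ring

include hdens hlink hθ hclass h1 h3 hreg hb in
/-- How the link function moves with the parameter: `∂_θ μ_θ(u) = -μ'(u) E[X | U = u]ᵀ J`. -/
theorem linkDeriv_fst_eq {e : ℝ → Euc (k + 1)} (he : M.IsCondMean e) (v : Euc k) {u : ℝ}
    (hu : u ∈ M.supp M.θ₀) :
    M.linkDeriv u (v, 0) = -(inner ℝ (e u) (jacMap M.θ₀ v) • deriv (M.link M.θ₀) u) := by
  set U := M.supp M.θ₀ with hUdef
  have hU : IsOpen U := h1.supp_open _ hθ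
  have hA : ContinuousOn (fun u => M.linkDeriv u (v, 0)) U :=
    (continuousOn_linkDeriv hreg).clm_apply continuousOn_const
  have hμ : ContinuousOn (deriv (M.link M.θ₀)) U := continuousOn_deriv_link hreg
  have hes : ContinuousOn (fun u => inner ℝ (e u) (jacMap M.θ₀ v)) U :=
    he.cont.inner continuousOn_const
  set q : ℝ → Euc d := fun u =>
    M.linkDeriv u (v, 0) + inner ℝ (e u) (jacMap M.θ₀ v) • deriv (M.link M.θ₀) u with hqdef
  have hq : ContinuousOn q U := hA.add (hes.smul hμ)
  suffices hq0 : q u = 0 from eq_neg_of_add_eq_zero_left hq0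
  have hzero : ∀ w : Euc d, w.ofLp ⬝ᵥ (M.Fmat M.θ₀ u).mulVec (q u).ofLp = 0 := by
    intro w
    have hidx : ContinuousOn (M.idxDens M.θ₀) U := (h1.smooth _ hθ).continuousOn
    have hηc := hidx.mul (continuousOn_Fform hθ h3 w hq)
    -- Test functions give vanishing almost everywhere on `U`; continuity on the open set `U` then
    -- gives it at every point.
    have hae := IsOpen.ae_eq_zero_of_integral_contDiff_smul_eq_zero (μ := volume) hU
      (hηc.locallyIntegrableOn hU.measurableSet) (by
        intro φ hφ hφc hφU
        exact integral_test_mul_Fform_eq_zero hdens hlink hθ hclass h1 h3 hreg hb he v w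
          (hφ.of_le (by simp)) hφc hφU)
    have heq := Measure.eqOn_open_of_ae_eq (μ := volume) (g := fun _ => (0 : ℝ))
      ((ae_restrict_iff' hU.measurableSet).2 hae) hU hηc continuousOn_const hu
    rcases mul_eq_zero.1 heq with h0 | h0
    · exact absurd h0 (ne_of_gt hu)
    · exact h0
  by_contra hne
  -- The vector `w` is arbitrary, so it may be taken to be `q u` itself.
  have := (h3.F_pos _ hθ u hu).dotProduct_mulVec_pos (x := (q u).ofLp)
    (fun h0 => hne (by ext i; simp [h0]))
  rw [star_trivial, hzero] at this
  exact lt_irrefl _ this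

include hdens hlink hθ hclass h1 h3 hreg hb in
-- The motion of the link at fixed index cancels the part of `x` predicted by the index. This
-- centring is the reason why the conditional covariance of `X`, and not its second moment, enters
-- `W₀` and `M₀`.
theorem fitDeriv_eq {e : ℝ → Euc (k + 1)} (he : M.IsCondMean e) {x : Euc (k + 1)}
    (hx : idx M.θ₀ x ∈ M.supp M.θ₀) (v : Euc k) :
    M.fitDeriv x v = (M.dir e x ⬝ᵥ v.ofLp) • deriv (M.link M.θ₀) (idx M.θ₀ x) := by
  rw [fitDeriv_apply hreg hx, linkDeriv_fst_eq hdens hlink hθ hclass h1 h3 hreg hb he v hx,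
    dir, ← inner_jacMap, inner_sub_left, sub_smul]
  abel

end Conditional

end ESIM

/-! ### Expansion of the criterion at `θ₀` -/

/-- Second-order expansion of `f ∘ r`, up to the first-order term in `r`. -/
theorem isLittleO_taylor_two_comp {E V : Type*} [NormedAddCommGroup E] [InnerProductSpace ℝ E]
    [CompleteSpace E] [NormedAddCommGroup V] [NormedSpace ℝ V] {f : E → ℝ}
    (hf : Differentiable ℝ f) {r : V → E} {D : V →L[ℝ] E} {x₀ : V} (hr : HasFDerivAt r D x₀)
    {H : E →L[ℝ] E} (hH : HasFDerivAt (gradient f) H (r x₀)) :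
    (fun x => f (r x) - f (r x₀) - inner ℝ (gradient f (r x₀)) (r x - r x₀) -
      2⁻¹ * inner ℝ (H (D (x - x₀))) (D (x - x₀))) =o[𝓝 x₀] fun x => ‖x - x₀‖ ^ 2 := by
  have hO : (fun x => r x - r x₀) =O[𝓝 x₀] fun x => ‖x - x₀‖ := hr.isBigO_sub.norm_right
  have hD : (fun x => D (x - x₀)) =O[𝓝 x₀] fun x => ‖x - x₀‖ :=
    (D.isBigO_comp (fun x => x - x₀) _).norm_right
  have ho : (fun x => r x - r x₀ - D (x - x₀)) =o[𝓝 x₀] fun x => ‖x - x₀‖ :=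
    hr.isLittleO.norm_right
  have h0 : Tendsto (fun x => r x - r x₀) (𝓝 x₀) (𝓝 0) := by
    have := hr.continuousAt.tendsto.sub_const (r x₀)
    rwa [sub_self] at this
  have h1 := ((isLittleO_taylor_two hf hH).comp_tendsto h0).trans_isBigO (hO.norm_left.pow 2)
  -- With `a = r x - r x₀` and `b = D (x - x₀)`, the identity `⟨Ha, a⟩ - ⟨Hb, b⟩ = ⟨H(a - b), a⟩ +
  -- ⟨Hb, a - b⟩` replaces increments by their linear parts without symmetry of `H`.
  have h2 : (fun x => inner ℝ (H (r x - r x₀ - D (x - x₀))) (r x - r x₀)) =o[𝓝 x₀]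
      fun x => ‖x - x₀‖ ^ 2 := by
    have e1 : (fun x => H (r x - r x₀ - D (x - x₀))) =o[𝓝 x₀] fun x => ‖x - x₀‖ :=
      (H.isBigO_comp _ _).trans_isLittleO ho
    refine (IsBigO.of_norm_le (g := fun x =>
      ‖H (r x - r x₀ - D (x - x₀))‖ * ‖r x - r x₀‖) fun x => norm_inner_le_norm _ _).trans_isLittleO ?_
    simpa [sq] using e1.norm_left.mul_isBigO hO.norm_left
  have h3 : (fun x => inner ℝ (H (D (x - x₀))) (r x - r x₀ - D (x - x₀))) =o[𝓝 x₀]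
      fun x => ‖x - x₀‖ ^ 2 := by
    have e1 : (fun x => H (D (x - x₀))) =O[𝓝 x₀] fun x => ‖x - x₀‖ :=
      (H.isBigO_comp _ _).trans hD
    refine (IsBigO.of_norm_le (g := fun x =>
      ‖H (D (x - x₀))‖ * ‖r x - r x₀ - D (x - x₀)‖) fun x => norm_inner_le_norm _ _).trans_isLittleO ?_
    simpa [sq] using e1.norm_left.mul_isLittleO ho.norm_left
  refine (h1.add ((h2.add h3).const_mul_left 2⁻¹)).congr_left fun x => ?_
  simp only [Function.comp_apply, add_sub_cancel, map_sub, inner_sub_left, inner_sub_right]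
  ring

/-- A function with a bounded gradient on a ball is Lipschitz there. -/
theorem abs_sub_le_of_norm_gradient_le {E : Type*} [NormedAddCommGroup E] [InnerProductSpace ℝ E]
    [CompleteSpace E] {f : E → ℝ} (hf : Differentiable ℝ f) {R G : ℝ}
    (hG : ∀ a ∈ Metric.closedBall (0 : E) R, ‖gradient f a‖ ≤ G) {a b : E}
    (ha : a ∈ Metric.closedBall (0 : E) R) (hb : b ∈ Metric.closedBall (0 : E) R) :
    |f a - f b| ≤ G * ‖a - b‖ := by
  rw [← Real.norm_eq_abs]
  refine (convex_closedBall (0 : E) R).norm_image_sub_le_of_norm_hasFDerivWithin_le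
    (fun x _ => (hf x).hasGradientAt.hasFDerivAt.hasFDerivWithinAt) (fun x hx => ?_) hb ha
  rw [LinearIsometryEquiv.norm_map]
  exact hG x hx

namespace ESIM

variable {d k : ℕ} {M : ESIM d k}

section Disintegration

variable {κ : ℝ} (hdens : M.HasDensities) (hθ : M.θ₀ ∈ paramSpace k) (hclass : M.InClass κ)
  (hreg : M.LinkRegular)
include hdens hθ hclass hreg

/-- The integrability half of Fubini. It lets a vanishing mean excess risk force a vanishing
conditional one, and yields integrability of the weights in `W₀` and `M₀`. -/
theorem integrable_law_inner {E : Type*} [NormedAddCommGroup E] [NormedSpace ℝ E]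
    {f : Euc (k + 1) × Sph d → E} (hf : Integrable f M.law) :
    Integrable (fun z : Euc (k + 1) × Sph d =>
      ∫ y, M.condDens M.θ₀ (idx M.θ₀ z.1) y • f (z.1, y) ∂(surf d)) M.law := by
  have : IsProbabilityMeasure (M.law.map Prod.fst) :=
    Measure.isProbabilityMeasure_map measurable_fst.aemeasurable
  have hm := measurable_condDens_idx hdens hθ
  have hint := hf
  rw [law_eq_withDensity hdens hθ hclass hreg,
    integrable_withDensity_iff_integrable_smul' hm.ennreal_ofReal (by simp)] at hint
  have h1 := hint.integral_prod_left
  rw [integrable_map_measure h1.aestronglyMeasurable measurable_fst.aemeasurable] at h1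
  refine h1.congr ?_
  filter_upwards [ae_idx_mem_supp hdens hθ] with z hz
  simp only [Function.comp_apply]
  congr 1
  ext y
  rw [ENNReal.toReal_ofReal (hdens.cond_nonneg _ hθ _ hz y)]

end Disintegration

section Bounds

variable (h3 : M.A3) (hreg : M.LinkRegular) {r C L : ℝ} {K : NNReal} {G : ℝ}
  (hb : M.LocalBounds r C L K G)
include h3 hreg hb

theorem integrable_loss_resid {θ : Euc k} (hθ : θ ∈ Metric.closedBall M.θ₀ r) :
    Integrable (fun z => M.loss (M.resid θ z)) M.law := by
  obtain ⟨B, hB⟩ := (isCompact_closedBall (0 : Euc d) (1 + C)).exists_bound_of_continuousOn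
    h3.diff.continuous.continuousOn
  refine Integrable.of_bound (h3.diff.continuous.measurable.comp
    (measurable_resid hreg (hb.subset hθ))).aestronglyMeasurable B ?_
  filter_upwards [hb.ae_resid_le hθ] with z hz
  exact hB _ (by rwa [mem_closedBall_zero_iff])

theorem continuousOn_crit : ContinuousOn (M.crit M.law) (Metric.closedBall M.θ₀ r) := by
  refine (LipschitzOnWith.of_dist_le_mul (K := ⟨G * L, mul_nonneg hb.G_nonneg hb.L_nonneg⟩)
    fun θ₁ h₁ θ₂ h₂ => ?_).continuousOn
  rw [dist_eq_norm, dist_eq_norm]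
  change ‖(∫ z, M.loss (M.resid θ₁ z) ∂M.law) - ∫ z, M.loss (M.resid θ₂ z) ∂M.law‖ ≤
    G * L * ‖θ₁ - θ₂‖
  rw [← integral_sub (integrable_loss_resid h3 hreg hb h₁) (integrable_loss_resid h3 hreg hb h₂)]
  have := norm_integral_le_of_norm_le_const (μ := M.law) (C := G * L * ‖θ₁ - θ₂‖)
    (f := fun z => M.loss (M.resid θ₁ z) - M.loss (M.resid θ₂ z)) ?_
  · simpa using this
  filter_upwards [hb.ae_resid_le h₁, hb.ae_resid_le h₂, hb.fit_sub _ h₁ _ h₂] with z e1 e2 e3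
  refine (abs_sub_le_of_norm_gradient_le h3.diff hb.grad_le
    (by rw [mem_closedBall_zero_iff]; linarith)
    (by rw [mem_closedBall_zero_iff]; linarith)).trans ?_
  rw [mul_assoc]
  have e4 : M.resid θ₁ z - M.resid θ₂ z = -(M.fit θ₁ z.1 - M.fit θ₂ z.1) := by
    simp only [resid]; abel
  rw [e4, norm_neg]
  exact mul_le_mul_of_nonneg_left e3 hb.G_nonneg

theorem crit_contaminate {θ : Euc k} (hθ : θ ∈ Metric.closedBall M.θ₀ r)
    (z : Euc (k + 1) × Sph d) {t : ℝ} (ht : t ∈ Icc (0 : ℝ) 1) :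
    M.crit (contaminate M.law z t) θ = (1 - t) * M.crit M.law θ + t * M.loss (M.resid θ z) := by
  have hi := integrable_loss_resid h3 hreg hb hθ
  have hd : Integrable (fun z => M.loss (M.resid θ z)) (Measure.dirac z) :=
    integrable_dirac (by simp)
  change ∫ z, M.loss (M.resid θ z) ∂(contaminate M.law z t) = (1 - t) *
    (∫ z, M.loss (M.resid θ z) ∂M.law) + _
  rw [contaminate, integral_add_measure (hi.smul_measure ENNReal.ofReal_ne_top)
    (hd.smul_measure ENNReal.ofReal_ne_top), integral_smul_measure, integral_smul_measure,
    integral_dirac, ENNReal.toReal_ofReal (by linarith [ht.2]), ENNReal.toReal_ofReal ht.1,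
    smul_eq_mul, smul_eq_mul]

end Bounds

section Criterion

variable {κ : ℝ} (hdens : M.HasDensities) (hlink : M.IsLink) (hθ : M.θ₀ ∈ paramSpace k)
  (hclass : M.InClass κ) (h1 : M.A1) (h3 : M.A3) (hreg : M.LinkRegular)
  {r C L : ℝ} {K : NNReal} {G : ℝ} (hb : M.LocalBounds r C L K G)

include hdens hθ hclass h3 hreg hb in
/-- The true parameter is the only minimizer of the criterion. -/
theorem crit_lt_crit (h2 : M.A2) (h4 : M.A4) {θ : Euc k} (hθr : θ ∈ Metric.closedBall M.θ₀ r)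
    (hne : θ ≠ M.θ₀) : M.crit M.law M.θ₀ < M.crit M.law θ := by
  have hi := integrable_loss_resid h3 hreg hb hθr
  have hi0 := integrable_loss_resid h3 hreg hb hb.mem_self
  have hsub := integral_law_eq hdens hθ hclass hreg (hi.sub hi0)
  have hinn := integrable_law_inner hdens hθ hclass hreg (hi.sub hi0)
  simp only [Pi.sub_apply] at hsub hinn
  rw [integral_sub hi hi0] at hsub
  -- Given `X = x`, the response follows the conditional density at the true index whichever `θ` is
  -- being fitted. The excess risk is therefore that of moving the optimal centre by the difference
  -- of the fits.
  have hgap : ∀ x, idx M.θ₀ x ∈ M.supp M.θ₀ →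
      ∫ y : Sph d, M.condDens M.θ₀ (idx M.θ₀ x) y •
        (M.loss (M.resid θ (x, y)) - M.loss (M.resid M.θ₀ (x, y))) ∂(surf d) =
      M.zeta M.θ₀ (idx M.θ₀ x) (M.fit M.θ₀ x - M.fit θ x) - M.zeta M.θ₀ (idx M.θ₀ x) 0 := by
    intro x hx
    have hI : ∀ m : Euc d, Integrable (fun y : Sph d =>
        M.loss ((y : Euc d) - m) * M.condDens M.θ₀ (idx M.θ₀ x) y) (surf d) := by
      intro m
      obtain ⟨B, hB⟩ := (isCompact_closedBall (0 : Euc d) (1 + ‖m‖)).exists_bound_of_continuousOn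
        h3.diff.continuous.continuousOn
      refine integrable_mul_condDens hdens hθ hx (B := B)
        (h3.diff.continuous.comp (by fun_prop :
          Continuous fun y : Sph d => (y : Euc d) - m)).measurable fun y => hB _ ?_
      rw [mem_closedBall_zero_iff]
      exact norm_sphere_sub_le y m
    unfold zeta condE
    rw [← integral_sub]
    · refine integral_congr_ae (Eventually.of_forall fun y => ?_)
      have e1 : (y : Euc d) - M.link M.θ₀ (idx M.θ₀ x) + (M.fit M.θ₀ x - M.fit θ x) =
          M.resid θ (x, y) := by simp only [fit, resid]; abel
      have e2 : (y : Euc d) - M.link M.θ₀ (idx M.θ₀ x) + 0 = M.resid M.θ₀ (x, y) := by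
        simp only [fit, resid]; abel
      simp only [e1, e2, smul_eq_mul]
      ring
    · convert hI (M.fit θ x) using 4
      simp only [fit]; abel
    · convert hI (M.fit M.θ₀ x) using 4
      simp only [fit]; abel
  have hnn : 0 ≤ᵐ[M.law] fun z : Euc (k + 1) × Sph d =>
      ∫ y : Sph d, M.condDens M.θ₀ (idx M.θ₀ z.1) y •
        (M.loss (M.resid θ (z.1, y)) - M.loss (M.resid M.θ₀ (z.1, y))) ∂(surf d) := by
    filter_upwards [ae_idx_mem_supp hdens hθ] with z hz
    rw [hgap z.1 hz, Pi.zero_apply, sub_nonneg]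
    rcases eq_or_ne (M.fit M.θ₀ z.1 - M.fit θ z.1) 0 with h | h
    · rw [h]
    · exact (h4.unique_min _ hθ _ hz _ h).le
  change (∫ z, M.loss (M.resid M.θ₀ z) ∂M.law) < ∫ z, M.loss (M.resid θ z) ∂M.law
  rw [← sub_pos, hsub]
  refine lt_of_le_of_ne (integral_nonneg_of_ae hnn) fun h0 => ?_
  -- Equal risks would make the nonnegative conditional excess vanish almost surely, so by (A4) the
  -- fits would agree almost surely, against identifiability.
  have hz0 := (integral_eq_zero_iff_of_nonneg_ae hnn hinn).1 h0.symm
  have hpos := h2.identifiable θ (hb.subset hθr) hne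
  refine hpos.ne' ?_
  have hae : ∀ᵐ z ∂M.law, M.link θ (idx θ z.1) = M.link M.θ₀ (idx M.θ₀ z.1) := by
    filter_upwards [hz0, ae_idx_mem_supp hdens hθ] with z h hz
    rw [hgap z.1 hz, Pi.zero_apply, sub_eq_zero] at h
    by_contra hcon
    have hne' : M.fit M.θ₀ z.1 - M.fit θ z.1 ≠ 0 := sub_ne_zero.2 (Ne.symm hcon)
    exact (h4.unique_min _ hθ _ hz _ hne').ne' h
  exact ae_iff.1 hae

include hdens hlink hθ hclass h3 hreg hb in
/-- Quadratic expansion of the criterion at the true parameter. -/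
theorem isLittleO_crit :
    (fun θ => M.crit M.law θ - M.crit M.law M.θ₀ - 2⁻¹ * ∫ z, inner ℝ (M.fitDeriv z.1 (θ - M.θ₀))
      (M.hess (M.resid M.θ₀ z) (M.fitDeriv z.1 (θ - M.θ₀))) ∂M.law) =o[𝓝 M.θ₀]
      fun θ => ‖θ - M.θ₀‖ ^ 2 := by
  -- The linear term keeps the exact increment of the fit instead of its derivative. This increment
  -- is a function of `X`, so the term has mean zero and no second derivative of the link is needed.
  set ρ : Euc k → Euc (k + 1) × Sph d → ℝ := fun θ z =>
    (M.loss (M.resid θ z) - M.loss (M.resid M.θ₀ z) -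
      inner ℝ (gradient M.loss (M.resid M.θ₀ z)) (M.fit M.θ₀ z.1 - M.fit θ z.1)) -
      2⁻¹ * inner ℝ (M.fitDeriv z.1 (θ - M.θ₀))
        (M.hess (M.resid M.θ₀ z) (M.fitDeriv z.1 (θ - M.θ₀))) with hρ
  have hball : ∀ᶠ θ in 𝓝 M.θ₀, θ ∈ Metric.closedBall M.θ₀ r :=
    Metric.closedBall_mem_nhds _ hb.r_pos
  have hq : ∀ θ, Integrable (fun z => inner ℝ (M.fitDeriv z.1 (θ - M.θ₀))
      (M.hess (M.resid M.θ₀ z) (M.fitDeriv z.1 (θ - M.θ₀)))) M.law := fun θ =>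
    integrable_inner_hess hθ hreg hb (a := fun x => M.fitDeriv x (θ - M.θ₀))
      (b := fun x => M.fitDeriv x (θ - M.θ₀))
      (aestronglyMeasurable_fitDeriv hb hdens hreg _)
      (aestronglyMeasurable_fitDeriv hb hdens hreg _)
      (ae_norm_fitDeriv_le hb hdens hreg _) (ae_norm_fitDeriv_le hb hdens hreg _)
  have hlin : ∀ θ ∈ Metric.closedBall M.θ₀ r, Integrable (fun z =>
      inner ℝ (gradient M.loss (M.resid M.θ₀ z)) (M.fit M.θ₀ z.1 - M.fit θ z.1)) M.law := by
    intro θ hθ'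
    have e1 := measurable_gradient_resid h3 hreg hθ
    have e2 := (measurable_fit hreg hθ).sub (measurable_fit hreg (hb.subset hθ'))
    refine Integrable.of_bound (e1.inner (e2.comp measurable_fst)).aestronglyMeasurable
      (G * (L * ‖M.θ₀ - θ‖)) ?_
    filter_upwards [hb.ae_resid_le hb.mem_self, hb.fit_sub _ hb.mem_self _ hθ'] with z ha hc
    exact (norm_inner_le_norm _ _).trans
      (mul_le_mul (hb.grad_le' ha) hc (norm_nonneg _) hb.G_nonneg)
  have hint : ∀ θ ∈ Metric.closedBall M.θ₀ r, ∫ z, ρ θ z ∂M.law =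
      M.crit M.law θ - M.crit M.law M.θ₀ - 2⁻¹ * ∫ z, inner ℝ (M.fitDeriv z.1 (θ - M.θ₀))
      (M.hess (M.resid M.θ₀ z) (M.fitDeriv z.1 (θ - M.θ₀))) ∂M.law := by
    intro θ hθ'
    have hi := integrable_loss_resid h3 hreg hb hθ'
    have hi0 := integrable_loss_resid h3 hreg hb hb.mem_self
    have hi1 : Integrable (fun z => M.loss (M.resid θ z) - M.loss (M.resid M.θ₀ z)) M.law :=
      hi.sub hi0
    have hi2 : Integrable (fun z => M.loss (M.resid θ z) - M.loss (M.resid M.θ₀ z) -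
        inner ℝ (gradient M.loss (M.resid M.θ₀ z)) (M.fit M.θ₀ z.1 - M.fit θ z.1)) M.law :=
      hi1.sub (hlin θ hθ')
    simp only [hρ]
    rw [integral_sub hi2 ((hq θ).const_mul _), integral_sub hi1 (hlin θ hθ'), integral_sub hi hi0, integral_const_mul,
      integral_inner_gradient_resid_eq_zero hdens hlink hθ hclass h3 hreg
        (q := fun x => M.fit M.θ₀ x - M.fit θ x) (hlin θ hθ'), sub_zero]
    rfl
  have hmeas : ∀ θ ∈ Metric.closedBall M.θ₀ r, AEStronglyMeasurable (ρ θ) M.law := by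
    intro θ hθ'
    have hi := integrable_loss_resid h3 hreg hb hθ'
    have hi0 := integrable_loss_resid h3 hreg hb hb.mem_self
    exact (((hi.sub hi0).sub (hlin θ hθ')).sub ((hq θ).const_mul _)).aestronglyMeasurable
  have key : Tendsto (fun θ => ∫ z, ρ θ z / ‖θ - M.θ₀‖ ^ 2 ∂M.law) (𝓝 M.θ₀)
      (𝓝 (∫ _, 0 ∂M.law)) := by
    refine tendsto_integral_filter_of_dominated_convergence
      -- One summand bounds the first-order Taylor remainder, the other the quadratic term; both use
      -- that the gradient is `K`-Lipschitz and the fit `L`-Lipschitz.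
      (fun _ => K * L ^ 2 + K * L ^ 2) ?_ ?_ (integrable_const _) ?_
    · filter_upwards [hball] with θ hθ'
      simp only [div_eq_mul_inv]
      exact (hmeas θ hθ').mul_const _
    · filter_upwards [hball] with θ hθ'
      filter_upwards [hb.ae_resid_le hb.mem_self, hb.ae_resid_le hθ',
        hb.fit_sub _ hb.mem_self _ hθ', ae_norm_fitDeriv_le hb hdens hreg (θ - M.θ₀)]
        with z ha hb' hc hd
      have hL := hb.L_nonneg
      have e0 : M.resid θ z = M.resid M.θ₀ z + (M.fit M.θ₀ z.1 - M.fit θ z.1) := by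
        simp only [resid]; abel
      have e1 : |M.loss (M.resid θ z) - M.loss (M.resid M.θ₀ z) -
          inner ℝ (gradient M.loss (M.resid M.θ₀ z)) (M.fit M.θ₀ z.1 - M.fit θ z.1)| ≤
          K * L ^ 2 * ‖θ - M.θ₀‖ ^ 2 := by
        rw [e0] at hb' ⊢
        refine (abs_taylor_one_le h3.diff hb.grad_lip
          (by rw [mem_closedBall_zero_iff]; linarith)
          (by rw [mem_closedBall_zero_iff]; linarith)).trans ?_
        rw [mul_assoc, ← mul_pow, norm_sub_rev θ]
        gcongr
      have e2 : |2⁻¹ * inner ℝ (M.fitDeriv z.1 (θ - M.θ₀))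
          (M.hess (M.resid M.θ₀ z) (M.fitDeriv z.1 (θ - M.θ₀)))| ≤
          K * L ^ 2 * ‖θ - M.θ₀‖ ^ 2 := by
        rw [abs_mul, abs_of_pos (by norm_num : (0 : ℝ) < 2⁻¹)]
        have e3 : |inner ℝ (M.fitDeriv z.1 (θ - M.θ₀))
          (M.hess (M.resid M.θ₀ z) (M.fitDeriv z.1 (θ - M.θ₀)))| ≤
          (L * ‖θ - M.θ₀‖) * (K * (L * ‖θ - M.θ₀‖)) := by
          refine (abs_real_inner_le_norm _ _).trans ?_
          refine mul_le_mul hd ?_ (norm_nonneg _) (by positivity)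
          exact (ContinuousLinearMap.le_opNorm _ _).trans
            (mul_le_mul (hb.norm_hess_le ha) hd (norm_nonneg _) K.2)
        have e4 : (0 : ℝ) ≤ (L * ‖θ - M.θ₀‖) * (K * (L * ‖θ - M.θ₀‖)) := by positivity
        calc _ ≤ 2⁻¹ * ((L * ‖θ - M.θ₀‖) * (K * (L * ‖θ - M.θ₀‖))) := by gcongr
          _ ≤ (L * ‖θ - M.θ₀‖) * (K * (L * ‖θ - M.θ₀‖)) := by linarith
          _ = _ := by ring
      rw [norm_div, norm_pow, norm_norm]
      refine div_le_of_le_mul₀ (by positivity) (by positivity) ?_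
      rw [add_mul]
      exact (norm_sub_le _ _).trans (add_le_add e1 e2)
    · filter_upwards [ae_idx_mem_supp hdens hθ, ae_differentiableAt_gradient hdens hθ hclass h3 hreg]
        with z hz hdz
      have hr : HasFDerivAt (fun θ => M.resid θ z) (-M.fitDeriv z.1) M.θ₀ :=
        (hasFDerivAt_fit hreg hθ hz).const_sub _
      have ho := isLittleO_taylor_two_comp h3.diff hr hdz.hasFDerivAt
      refine (ho.tendsto_div_nhds_zero).congr fun θ => ?_
      have e1 : M.resid θ z - M.resid M.θ₀ z = M.fit M.θ₀ z.1 - M.fit θ z.1 := by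
        simp only [resid]; abel
      simp only [hρ, e1, neg_apply, map_neg, inner_neg_left, inner_neg_right, neg_neg]
      rw [real_inner_comm (M.fitDeriv z.1 (θ - M.θ₀))]
  rw [integral_zero] at key
  refine (isLittleO_iff_tendsto' (Eventually.of_forall fun θ h0 => ?_)).2 (key.congr' ?_)
  · have : θ = M.θ₀ := by simpa [sub_eq_zero] using h0
    subst this
    simp
  · filter_upwards [hball] with θ hθ'
    rw [integral_div, hint θ hθ']

end Criterion

end ESIM

/-! ### The matrices `W₀` and `M₀` -/

/-- The constant is the minimum of the form on the compact unit sphere, spread by homogeneity. The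
sphere is empty in the zero space, which occurs when `k = 0`. -/
theorem exists_pos_mul_norm_sq_le {E : Type*} [NormedAddCommGroup E] [InnerProductSpace ℝ E]
    [ProperSpace E] (W : E →L[ℝ] E) (hW : ∀ v, v ≠ 0 → 0 < inner ℝ v (W v)) :
    ∃ c > 0, ∀ v, c * ‖v‖ ^ 2 ≤ inner ℝ v (W v) := by
  have hc : Continuous fun v => inner ℝ v (W v) := continuous_id.inner W.continuous
  rcases (Metric.sphere (0 : E) 1).eq_empty_or_nonempty with h0 | h0
  · refine ⟨1, one_pos, fun v => ?_⟩
    rcases eq_or_ne v 0 with rfl | hv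
    · simp
    · have : ‖v‖⁻¹ • v ∈ Metric.sphere (0 : E) 1 := by
        rw [mem_sphere_zero_iff_norm, norm_smul, norm_inv, norm_norm,
          inv_mul_cancel₀ (norm_ne_zero_iff.2 hv)]
      rw [h0] at this
      exact absurd this (notMem_empty _)
  · obtain ⟨m, hm, hmin⟩ := (isCompact_sphere (0 : E) 1).exists_isMinOn h0 hc.continuousOn
    have hm0 : m ≠ 0 := by
      rintro rfl
      simp at hm
    refine ⟨_, hW m hm0, fun v => ?_⟩
    rcases eq_or_ne v 0 with rfl | hv
    · simp
    · have hn : 0 < ‖v‖ := norm_pos_iff.2 hv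
      have hs : ‖v‖⁻¹ • v ∈ Metric.sphere (0 : E) 1 := by
        rw [mem_sphere_zero_iff_norm, norm_smul, norm_inv, norm_norm, inv_mul_cancel₀ hn.ne']
      have h1 := hmin hs
      simp only [mem_ofPred_eq, map_smul, real_inner_smul_left, real_inner_smul_right] at h1
      calc _ ≤ (‖v‖⁻¹ * (‖v‖⁻¹ * inner ℝ v (W v))) * ‖v‖ ^ 2 := by gcongr
        _ = inner ℝ v (W v) := by field_simp

namespace ESIM

variable {d k : ℕ} {M : ESIM d k}

theorem memLp_two_centered (h1 : M.A1) :
    MemLp (fun z : Euc (k + 1) × Sph d => z.1 - M.condMeanX z) 2 M.law := by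
  obtain ⟨D, hD⟩ := h1.compact.exists_bound_of_continuousOn (f := id) continuousOn_id
  have hX : MemLp (fun z : Euc (k + 1) × Sph d => z.1) 2 M.law := by
    refine MemLp.of_bound measurable_fst.aestronglyMeasurable D ?_
    filter_upwards [h1.mem_dom] with z hz
    exact hD _ hz
  exact hX.sub (hX.condExp (by norm_num))

theorem integrable_centered_mul (h1 : M.A1) (a b : Fin (k + 1)) :
    Integrable (fun z : Euc (k + 1) × Sph d =>
      (z.1 - M.condMeanX z) a * (z.1 - M.condMeanX z) b) M.law := by
  have h : ∀ a, MemLp (fun z : Euc (k + 1) × Sph d => (z.1 - M.condMeanX z) a) 2 M.law :=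
    fun a => (EuclideanSpace.proj (𝕜 := ℝ) a).comp_memLp' (memLp_two_centered h1)
  exact (h a).integrable_mul (h b)

/-- The centred predictors, projected to the tangent space. -/
theorem dir_mul_dir_eq {e : ℝ → Euc (k + 1)} {z : Euc (k + 1) × Sph d}
    (hz : e (idx M.θ₀ z.1) = M.condMeanX z) (i j : Fin k) :
    M.dir e z.1 i * M.dir e z.1 j = ∑ p : Fin (k + 1) × Fin (k + 1),
      (jac M.θ₀ p.1 i * jac M.θ₀ p.2 j) *
        ((z.1 - M.condMeanX z) p.1 * (z.1 - M.condMeanX z) p.2) := by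
  simp only [dir, Matrix.mulVec, dotProduct, Matrix.transpose_apply, hz]
  rw [Finset.sum_mul_sum, Fintype.sum_prod_type]
  exact Finset.sum_congr rfl fun a _ => Finset.sum_congr rfl fun b _ => by ring

theorem integrable_dir_mul_dir (h1 : M.A1) {e : ℝ → Euc (k + 1)} (he : M.IsCondMean e)
    (i j : Fin k) : Integrable (fun z : Euc (k + 1) × Sph d =>
      M.dir e z.1 i * M.dir e z.1 j) M.law := by
  have h : Integrable (fun z : Euc (k + 1) × Sph d => ∑ p : Fin (k + 1) × Fin (k + 1),
      (jac M.θ₀ p.1 i * jac M.θ₀ p.2 j) *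
        ((z.1 - M.condMeanX z) p.1 * (z.1 - M.condMeanX z) p.2)) M.law :=
    integrable_finsetSum _ fun p _ => (integrable_centered_mul h1 p.1 p.2).const_mul _
  refine h.congr ?_
  filter_upwards [he.ae_eq] with z hz
  exact (dir_mul_dir_eq hz i j).symm

/-- `Jᵀ Σ_{X|U} J` is the conditional second moment of `Jᵀ (X - E[X|U])`. -/
theorem condCovX_projected_ae_eq (h1 : M.A1) {e : ℝ → Euc (k + 1)} (he : M.IsCondMean e)
    (i j : Fin k) :
    (fun z => ((jac M.θ₀).transpose * M.condCovX z * jac M.θ₀) i j) =ᵐ[M.law]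
      condExp M.sigmaU M.law (fun z => M.dir e z.1 i * M.dir e z.1 j) := by
  set Z : Fin (k + 1) × Fin (k + 1) → Euc (k + 1) × Sph d → ℝ := fun p z =>
    (z.1 - M.condMeanX z) p.1 * (z.1 - M.condMeanX z) p.2 with hZ
  have e1 : (fun z : Euc (k + 1) × Sph d => M.dir e z.1 i * M.dir e z.1 j) =ᵐ[M.law]
      ∑ p, (jac M.θ₀ p.1 i * jac M.θ₀ p.2 j) • Z p := by
    filter_upwards [he.ae_eq] with z hz
    rw [dir_mul_dir_eq hz i j, Finset.sum_apply]
    rfl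
  have e2 := condExp_finsetSum (μ := M.law) (s := Finset.univ)
    (f := fun p => (jac M.θ₀ p.1 i * jac M.θ₀ p.2 j) • Z p)
    (fun p _ => (integrable_centered_mul h1 p.1 p.2).smul _) M.sigmaU
  have e3 : ∀ᵐ z ∂M.law, ∀ p, condExp M.sigmaU M.law
      ((jac M.θ₀ p.1 i * jac M.θ₀ p.2 j) • Z p) z =
      (jac M.θ₀ p.1 i * jac M.θ₀ p.2 j) * condExp M.sigmaU M.law (Z p) z :=
    ae_all_iff.2 fun p => condExp_smul (jac M.θ₀ p.1 i * jac M.θ₀ p.2 j) (Z p) M.sigmaU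
  filter_upwards [condExp_congr_ae (m := M.sigmaU) e1, e2, e3] with z h4 h5 h6
  rw [h4, h5, Finset.sum_apply]
  simp only [h6]
  rw [Fintype.sum_prod_type, Matrix.mul_apply, Finset.sum_comm]
  refine Finset.sum_congr rfl fun b _ => ?_
  rw [Matrix.mul_apply, Finset.sum_mul]
  refine Finset.sum_congr rfl fun a _ => ?_
  simp only [Matrix.transpose_apply, condCovX, Matrix.of_apply, hZ]
  ring

/-- The quadratic form `μ'(u)ᵀ A(u) μ'(u)`. -/
def weight (M : ESIM d k) (A : ℝ → Matrix (Fin d) (Fin d) ℝ) (u : ℝ) : ℝ :=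
  (deriv (M.link M.θ₀) u).ofLp ⬝ᵥ (A u).mulVec (deriv (M.link M.θ₀) u).ofLp

theorem continuousOn_weight (hreg : M.LinkRegular) {A : ℝ → Matrix (Fin d) (Fin d) ℝ}
    (hA : ContinuousOn A (M.supp M.θ₀)) : ContinuousOn (M.weight A) (M.supp M.θ₀) := by
  unfold weight
  simp only [dotProduct_mulVec_eq_sum]
  have h1 : ∀ i, ContinuousOn (fun u => deriv (M.link M.θ₀) u i) (M.supp M.θ₀) := fun i =>
    (EuclideanSpace.proj (𝕜 := ℝ) i).continuous.comp_continuousOn (continuousOn_deriv_link hreg)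
  refine continuousOn_finsetSum _ fun i _ => continuousOn_finsetSum _ fun j _ => ?_
  have h2 : ContinuousOn (fun u => A u i j) (M.supp M.θ₀) :=
    (continuous_id.matrix_elem i j).comp_continuousOn hA
  exact ((h1 i).mul (h1 j)).mul h2

/-- The matrix `E[μ'ᵀ A μ' Jᵀ Σ_{X|U} J]` as a second moment matrix of `Jᵀ (X - E[X|U])`. -/
theorem weighted_apply (hdens : M.HasDensities) (hθ : M.θ₀ ∈ paramSpace k) (h1 : M.A1)
    (hreg : M.LinkRegular) {e : ℝ → Euc (k + 1)} (he : M.IsCondMean e)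
    {A : ℝ → Matrix (Fin d) (Fin d) ℝ} (hA : ContinuousOn A (M.supp M.θ₀)) {i j : Fin k}
    (hint : Integrable (fun z : Euc (k + 1) × Sph d =>
      M.weight A (idx M.θ₀ z.1) * (M.dir e z.1 i * M.dir e z.1 j)) M.law) :
    M.weighted A i j =
      ∫ z, M.weight A (idx M.θ₀ z.1) * (M.dir e z.1 i * M.dir e z.1 j) ∂M.law := by
  classical
  have hU : MeasurableSet (M.supp M.θ₀) := (h1.supp_open _ hθ).measurableSet
  -- The weight is controlled on the support only; extending it by zero gives a Borel function, so
  -- that it is measurable for the σ-algebra of the index and can be pulled out of the conditional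
  -- expectation.
  set g : ℝ → ℝ := (M.supp M.θ₀).piecewise (M.weight A) (fun _ => 0) with hg
  have hgm : Measurable g :=
    (continuousOn_weight hreg hA).measurable_piecewise continuousOn_const hU
  have hgeq : (fun z : Euc (k + 1) × Sph d => g (idx M.θ₀ z.1)) =ᵐ[M.law]
      fun z => M.weight A (idx M.θ₀ z.1) := by
    filter_upwards [ae_idx_mem_supp hdens hθ] with z hz
    exact piecewise_eq_of_mem _ _ _ hz
  have hgs : StronglyMeasurable[M.sigmaU] (fun z : Euc (k + 1) × Sph d => g (idx M.θ₀ z.1)) :=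
    (hgm.comp (comap_measurable _)).stronglyMeasurable
  set P : Euc (k + 1) × Sph d → ℝ := fun z => M.dir e z.1 i * M.dir e z.1 j with hP
  have hint' : Integrable ((fun z : Euc (k + 1) × Sph d => g (idx M.θ₀ z.1)) * P) M.law := by
    refine hint.congr ?_
    filter_upwards [hgeq] with z hz
    rw [Pi.mul_apply, hz]
  have hpull := condExp_mul_of_stronglyMeasurable_left hgs hint' (integrable_dir_mul_dir h1 he i j)
  have hcov := condCovX_projected_ae_eq h1 he i j
  calc M.weighted A i j = ∫ z, M.weight A (idx M.θ₀ z.1) *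
        ((jac M.θ₀).transpose * M.condCovX z * jac M.θ₀) i j ∂M.law := rfl
    _ = ∫ z, condExp M.sigmaU M.law
          ((fun z : Euc (k + 1) × Sph d => g (idx M.θ₀ z.1)) * P) z ∂M.law := by
        refine integral_congr_ae ?_
        filter_upwards [hgeq, hpull, hcov] with z a b c
        rw [b, c, Pi.mul_apply, a]
    _ = ∫ z, ((fun z : Euc (k + 1) × Sph d => g (idx M.θ₀ z.1)) * P) z ∂M.law :=
        integral_condExp sigmaU_le
    _ = _ := by
        refine integral_congr_ae ?_
        filter_upwards [hgeq] with z a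
        rw [Pi.mul_apply, a]

section Matrices

variable {κ : ℝ} (hdens : M.HasDensities) (hlink : M.IsLink) (hθ : M.θ₀ ∈ paramSpace k)
  (hclass : M.InClass κ) (h1 : M.A1) (h3 : M.A3) (hreg : M.LinkRegular)
  {r C L : ℝ} {K : NNReal} {G : ℝ} (hb : M.LocalBounds r C L K G)
  {e : ℝ → Euc (k + 1)} (he : M.IsCondMean e)

include hdens hlink hθ hclass h1 h3 hreg hb he

theorem ae_fitDeriv_eq (v : Euc k) : ∀ᵐ z ∂M.law,
    M.fitDeriv z.1 v = (M.dir e z.1 ⬝ᵥ v.ofLp) • deriv (M.link M.θ₀) (idx M.θ₀ z.1) := by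
  filter_upwards [ae_idx_mem_supp hdens hθ] with z hz
  exact fitDeriv_eq hdens hlink hθ hclass h1 h3 hreg hb he hz v

theorem ae_fitDeriv_form_eq (A : ℝ → Matrix (Fin d) (Fin d) ℝ) (v w : Euc k) : ∀ᵐ z ∂M.law,
    (M.fitDeriv z.1 v).ofLp ⬝ᵥ (A (idx M.θ₀ z.1)).mulVec (M.fitDeriv z.1 w).ofLp =
      M.weight A (idx M.θ₀ z.1) * ((M.dir e z.1 ⬝ᵥ v.ofLp) * (M.dir e z.1 ⬝ᵥ w.ofLp)) := by
  filter_upwards [ae_fitDeriv_eq hdens hlink hθ hclass h1 h3 hreg hb he v,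
    ae_fitDeriv_eq hdens hlink hθ hclass h1 h3 hreg hb he w] with z a b
  rw [a, b]
  simp only [weight, WithLp.ofLp_smul, smul_dotProduct, Matrix.mulVec_smul, dotProduct_smul,
    smul_eq_mul]
  ring

/-- No bound on `μ'` alone is available. The product is the conditional mean given `X` of the
Hessian form in `fitDeriv`, which is bounded by (A2). -/
theorem integrable_weight_Fmat (i j : Fin k) : Integrable (fun z : Euc (k + 1) × Sph d =>
    M.weight (M.Fmat M.θ₀) (idx M.θ₀ z.1) * (M.dir e z.1 i * M.dir e z.1 j)) M.law := by
  have hint := integrable_inner_hess hθ hreg hb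
    (a := fun x => M.fitDeriv x (EuclideanSpace.single i 1))
    (b := fun x => M.fitDeriv x (EuclideanSpace.single j 1))
    (aestronglyMeasurable_fitDeriv hb hdens hreg _)
    (aestronglyMeasurable_fitDeriv hb hdens hreg _)
    (ae_norm_fitDeriv_le hb hdens hreg _) (ae_norm_fitDeriv_le hb hdens hreg _)
  refine (integrable_law_inner hdens hθ hclass hreg hint).congr ?_
  filter_upwards [ae_idx_mem_supp hdens hθ, ae_fitDeriv_form_eq hdens hlink hθ hclass h1 h3 hreg
    hb he (M.Fmat M.θ₀) (EuclideanSpace.single i 1) (EuclideanSpace.single j 1)] with z hz hf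
  have := integral_inner_hess_eq hdens hθ hb hz
    (M.fitDeriv z.1 (EuclideanSpace.single i 1)) (M.fitDeriv z.1 (EuclideanSpace.single j 1))
  rw [hf] at this
  simp only [EuclideanSpace.single, PiLp.ofLp_single, dotProduct_single, mul_one] at this
  exact this

theorem W₀_apply (i j : Fin k) : M.W₀ i j = ∫ z, M.weight (M.Fmat M.θ₀) (idx M.θ₀ z.1) *
    (M.dir e z.1 i * M.dir e z.1 j) ∂M.law :=
  weighted_apply hdens hθ h1 hreg he (continuousOn_Fmat h3 hθ)
    (integrable_weight_Fmat hdens hlink hθ hclass h1 h3 hreg hb he i j)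

theorem W₀_isSymm : M.W₀.IsSymm := by
  ext i j
  rw [Matrix.transpose_apply, W₀_apply hdens hlink hθ hclass h1 h3 hreg hb he,
    W₀_apply hdens hlink hθ hclass h1 h3 hreg hb he]
  simp only [mul_comm (M.dir e _ i)]

theorem dotProduct_W₀_mulVec (v w : Fin k → ℝ) : v ⬝ᵥ M.W₀.mulVec w =
    ∫ z, M.weight (M.Fmat M.θ₀) (idx M.θ₀ z.1) *
      ((M.dir e z.1 ⬝ᵥ v) * (M.dir e z.1 ⬝ᵥ w)) ∂M.law := by
  have hI := integrable_weight_Fmat hdens hlink hθ hclass h1 h3 hreg hb he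
  have : ∀ z : Euc (k + 1) × Sph d, M.weight (M.Fmat M.θ₀) (idx M.θ₀ z.1) *
      ((M.dir e z.1 ⬝ᵥ v) * (M.dir e z.1 ⬝ᵥ w)) = ∑ i, ∑ j, (v i * w j) *
        (M.weight (M.Fmat M.θ₀) (idx M.θ₀ z.1) * (M.dir e z.1 i * M.dir e z.1 j)) := by
    intro z
    simp only [dotProduct]
    rw [Finset.sum_mul_sum, Finset.mul_sum]
    refine Finset.sum_congr rfl fun i _ => ?_
    rw [Finset.mul_sum]
    exact Finset.sum_congr rfl fun j _ => by ring
  simp only [this]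
  rw [integral_finsetSum _ fun i _ => integrable_finsetSum _ fun j _ => (hI i j).const_mul _,
    dotProduct_mulVec_eq_sum]
  refine Finset.sum_congr rfl fun i _ => ?_
  rw [integral_finsetSum _ fun j _ => (hI i j).const_mul _]
  refine Finset.sum_congr rfl fun j _ => ?_
  rw [integral_const_mul, W₀_apply hdens hlink hθ hclass h1 h3 hreg hb he]

/-- The form of `W₀` at `v` is the mean of a nonnegative weight times a square, hence nonnegative;
invertibility excludes a kernel. -/
theorem W₀_posDef (hW : IsUnit M.W₀) : M.W₀.PosDef := by
  refine (Matrix.PosSemidef.posDef_iff_isUnit ?_).2 hW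
  refine .of_dotProduct_mulVec_nonneg ?_ fun v => ?_
  · rw [Matrix.IsHermitian, Matrix.conjTranspose_eq_transpose_of_trivial]
    exact W₀_isSymm hdens hlink hθ hclass h1 h3 hreg hb he
  · rw [star_trivial, dotProduct_W₀_mulVec hdens hlink hθ hclass h1 h3 hreg hb he]
    refine integral_nonneg_of_ae ?_
    filter_upwards [ae_idx_mem_supp hdens hθ] with z hz
    have h := (h3.F_pos _ hθ _ hz).posSemidef.dotProduct_mulVec_nonneg
      (deriv (M.link M.θ₀) (idx M.θ₀ z.1)).ofLp
    rw [star_trivial] at h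
    exact mul_nonneg h (mul_self_nonneg _)

/-- The quadratic term in the expansion of the criterion is given by `W₀`. -/
theorem integral_inner_fitDeriv_hess_eq (v : Euc k) :
    ∫ z, inner ℝ (M.fitDeriv z.1 v) (M.hess (M.resid M.θ₀ z) (M.fitDeriv z.1 v)) ∂M.law =
      v.ofLp ⬝ᵥ M.W₀.mulVec v.ofLp := by
  have hint := integrable_inner_hess hθ hreg hb
    (a := fun x => M.fitDeriv x v) (b := fun x => M.fitDeriv x v)
    (aestronglyMeasurable_fitDeriv hb hdens hreg _)
    (aestronglyMeasurable_fitDeriv hb hdens hreg _)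
    (ae_norm_fitDeriv_le hb hdens hreg _) (ae_norm_fitDeriv_le hb hdens hreg _)
  rw [integral_law_inner_hess_eq hdens hθ hclass hreg hb (a := fun x => M.fitDeriv x v)
    (b := fun x => M.fitDeriv x v) hint,
    dotProduct_W₀_mulVec hdens hlink hθ hclass h1 h3 hreg hb he]
  exact integral_congr_ae (ae_fitDeriv_form_eq hdens hlink hθ hclass h1 h3 hreg hb he _ v v)

theorem ae_score_mul_dir_eq (i : Fin k) : ∀ᵐ z ∂M.law, M.score z * M.dir e z.1 i =
    inner ℝ (gradient M.loss (M.resid M.θ₀ z)) (M.fitDeriv z.1 (EuclideanSpace.single i 1)) := by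
  filter_upwards [ae_fitDeriv_eq hdens hlink hθ hclass h1 h3 hreg hb he
    (EuclideanSpace.single i 1)] with z hz
  rw [hz, real_inner_smul_right]
  simp only [EuclideanSpace.single, PiLp.ofLp_single, dotProduct_single, mul_one]
  rw [mul_comm]
  rfl

/-- Score times direction is the gradient paired with `fitDeriv`, which is bounded almost surely.
Conditioning on `X` turns the product of gradients into `G`, and `weighted_apply` recognizes `M₀`.
-/
theorem integrable_score_sq (i j : Fin k) : Integrable (fun z : Euc (k + 1) × Sph d =>
    M.score z ^ 2 * (M.dir e z.1 i * M.dir e z.1 j)) M.law ∧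
    ∫ z, M.score z ^ 2 * (M.dir e z.1 i * M.dir e z.1 j) ∂M.law = M.M₀ i j := by
  set a : Fin k → Euc (k + 1) → Euc d := fun i x => M.fitDeriv x (EuclideanSpace.single i 1) with ha
  have hmeas : ∀ i, AEStronglyMeasurable (fun z =>
      inner ℝ (gradient M.loss (M.resid M.θ₀ z)) (a i z.1)) M.law := fun i =>
    (measurable_gradient_resid h3 hreg hθ).aestronglyMeasurable.inner
      (aestronglyMeasurable_fitDeriv hb hdens hreg _)
  have hbd : ∀ i, ∀ᵐ z ∂M.law, ‖inner ℝ (gradient M.loss (M.resid M.θ₀ z)) (a i z.1)‖ ≤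
      G * (L * ‖EuclideanSpace.single i (1 : ℝ)‖) := fun i => by
    filter_upwards [hb.ae_resid_le hb.mem_self, ae_norm_fitDeriv_le hb hdens hreg
      (EuclideanSpace.single i 1)] with z h5 h6
    exact (norm_inner_le_norm _ _).trans
      (mul_le_mul (hb.grad_le' h5) h6 (norm_nonneg _) hb.G_nonneg)
  have hint : Integrable (fun z => inner ℝ (gradient M.loss (M.resid M.θ₀ z)) (a i z.1) *
      inner ℝ (gradient M.loss (M.resid M.θ₀ z)) (a j z.1)) M.law := by
    refine Integrable.of_bound ((hmeas i).mul (hmeas j))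
      ((G * (L * ‖EuclideanSpace.single i (1 : ℝ)‖)) *
        (G * (L * ‖EuclideanSpace.single j (1 : ℝ)‖))) ?_
    filter_upwards [hbd i, hbd j] with z h5 h6
    rw [norm_mul]
    exact mul_le_mul h5 h6 (norm_nonneg _) ((norm_nonneg _).trans h5)
  have hae : (fun z => inner ℝ (gradient M.loss (M.resid M.θ₀ z)) (a i z.1) *
      inner ℝ (gradient M.loss (M.resid M.θ₀ z)) (a j z.1)) =ᵐ[M.law]
      fun z => M.score z ^ 2 * (M.dir e z.1 i * M.dir e z.1 j) := by
    filter_upwards [ae_score_mul_dir_eq hdens hlink hθ hclass h1 h3 hreg hb he i,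
      ae_score_mul_dir_eq hdens hlink hθ hclass h1 h3 hreg hb he j] with z h5 h6
    simp only [ha, ← h5, ← h6]
    ring
  have hform := ae_fitDeriv_form_eq hdens hlink hθ hclass h1 h3 hreg hb he (M.Gmat M.θ₀)
    (EuclideanSpace.single i 1) (EuclideanSpace.single j 1)
  simp only [EuclideanSpace.single, PiLp.ofLp_single, dotProduct_single, mul_one] at hform
  have hwint : Integrable (fun z : Euc (k + 1) × Sph d =>
      M.weight (M.Gmat M.θ₀) (idx M.θ₀ z.1) * (M.dir e z.1 i * M.dir e z.1 j)) M.law := by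
    refine (integrable_law_inner hdens hθ hclass hreg hint).congr ?_
    filter_upwards [ae_idx_mem_supp hdens hθ, hform] with z hz hf
    exact (integral_inner_mul_inner_gradient_eq hdens hθ h3 hb hz (a i z.1) (a j z.1)).trans hf
  refine ⟨hint.congr hae, ?_⟩
  rw [← integral_congr_ae hae,
    integral_law_inner_mul_inner_eq hdens hθ hclass h3 hreg hb (a := a i) (b := a j) hint]
  refine (integral_congr_ae hform).trans ?_
  exact (weighted_apply hdens hθ h1 hreg he (continuousOn_Gmat h3 hθ) hwint).symm

end Matrices

/-! ### The influence function -/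

theorem LocalBounds.mono {r C L : ℝ} {K : NNReal} {G : ℝ} (hb : M.LocalBounds r C L K G) {s : ℝ}
    (hs : 0 < s) (hsr : s ≤ r) : M.LocalBounds s C L K G where
  r_pos := hs
  subset := (Metric.closedBall_subset_closedBall hsr).trans hb.subset
  L_nonneg := hb.L_nonneg
  G_nonneg := hb.G_nonneg
  fit_sub θ₁ h₁ θ₂ h₂ := hb.fit_sub θ₁ (Metric.closedBall_subset_closedBall hsr h₁) θ₂
    (Metric.closedBall_subset_closedBall hsr h₂)
  fit_le θ h := hb.fit_le θ (Metric.closedBall_subset_closedBall hsr h)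
  link_le := hb.link_le
  grad_lip := hb.grad_lip
  grad_le := hb.grad_le

theorem HasInfluence.tendsto_zero {T : ℝ → Euc k} {θ v : Euc k}
    (h : Tendsto (fun t => t⁻¹ • (T t - θ)) (𝓝[>] (0 : ℝ)) (𝓝 v)) :
    Tendsto T (𝓝[>] 0) (𝓝 θ) := by
  have hid : Tendsto (fun t : ℝ => t) (𝓝[>] 0) (𝓝 0) := nhdsWithin_le_nhds
  have h1 := (hid.smul h).const_add θ
  rw [zero_smul, add_zero] at h1
  refine h1.congr' ?_
  filter_upwards [self_mem_nhdsWithin] with t ht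
  have ht0 : t ≠ 0 := ne_of_gt ht
  rw [smul_smul, mul_inv_cancel₀ ht0, one_smul, add_sub_cancel]

/-- The influence function is unique: it does not depend on the ball in its definition. -/
theorem HasInfluence.unique {z : Euc (k + 1) × Sph d} {v w : Euc k} (hv : M.HasInfluence z v)
    (hw : M.HasInfluence z w) : v = w := by
  obtain ⟨r, hr, -, -, hrex, hrlim⟩ := hv
  obtain ⟨s, hs, -, -, hsex, hslim⟩ := hw
  have key : ∀ {r s : ℝ} {v w : Euc k}, 0 < s → s ≤ r →
      (∀ᶠ t in 𝓝[>] (0 : ℝ), ∃ θ ∈ Metric.closedBall M.θ₀ r,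
        IsMinOn (M.crit (contaminate M.law z t)) (Metric.closedBall M.θ₀ r) θ) →
      (∀ T : ℝ → Euc k, (∀ᶠ t in 𝓝[>] (0 : ℝ), T t ∈ Metric.closedBall M.θ₀ r ∧
        IsMinOn (M.crit (contaminate M.law z t)) (Metric.closedBall M.θ₀ r) (T t)) →
        Tendsto (fun t => t⁻¹ • (T t - M.θ₀)) (𝓝[>] 0) (𝓝 v)) →
      (∀ T : ℝ → Euc k, (∀ᶠ t in 𝓝[>] (0 : ℝ), T t ∈ Metric.closedBall M.θ₀ s ∧
        IsMinOn (M.crit (contaminate M.law z t)) (Metric.closedBall M.θ₀ s) (T t)) →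
        Tendsto (fun t => t⁻¹ • (T t - M.θ₀)) (𝓝[>] 0) (𝓝 w)) → v = w := by
    intro r s v w hs hsr hex hlimr hlims
    -- Minimizers over the larger ball converge to `θ₀`, so they eventually lie in the smaller ball
    -- and minimize there too; one path then has both limits.
    obtain ⟨T, hT⟩ := hex.choice
    have h1 := hlimr T hT
    have h2 := (tendsto_zero h1).eventually (Metric.closedBall_mem_nhds M.θ₀ hs)
    refine tendsto_nhds_unique h1 (hlims T ?_)
    filter_upwards [hT, h2] with t h3 h4
    exact ⟨h4, h3.2.on_subset (Metric.closedBall_subset_closedBall hsr)⟩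
  rcases le_total s r with h | h
  · exact key hs h hrex hrlim hslim
  · exact (key hr h hsex hslim hrlim).symm

theorem HasInfluence.influence_eq {z : Euc (k + 1) × Sph d} {v : Euc k}
    (hv : M.HasInfluence z v) : M.influence z = v := by
  have h : ∃ v, M.HasInfluence z v := ⟨v, hv⟩
  rw [influence, dif_pos h]
  exact h.choose_spec.unique hv

section Influence

variable {κ : ℝ} (hdens : M.HasDensities) (hlink : M.IsLink) (hθ : M.θ₀ ∈ paramSpace k)
  (hclass : M.InClass κ) (h1 : M.A1) (h2 : M.A2) (h3 : M.A3) (h4 : M.A4) (hreg : M.LinkRegular)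
  {r C L : ℝ} {K : NNReal} {G : ℝ} (hb : M.LocalBounds r C L K G)
  {e : ℝ → Euc (k + 1)} (he : M.IsCondMean e)

include hreg hb in
-- The almost sure bounds say nothing at the single contaminating point `x`, so smoothness of the
-- link near `(θ₀, u)` is used instead. The radius depends on `x`.
theorem exists_continuousOn_fit {x : Euc (k + 1)} (hx : idx M.θ₀ x ∈ M.supp M.θ₀) :
    ∃ s, 0 < s ∧ s ≤ r ∧ ContinuousOn (fun θ => M.fit θ x) (Metric.closedBall M.θ₀ s) := by
  have hc : Continuous fun θ : Euc k => (θ, idx θ x) :=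
    continuous_id.prodMk (continuous_idx_param x)
  have h1 := (hreg.smooth _ hx).eventually (by simp)
  have h2 := (hc.tendsto M.θ₀).eventually h1
  obtain ⟨s, hs, hsub⟩ := Metric.nhds_basis_closedBall.mem_iff.1 h2
  refine ⟨min s r, lt_min hs hb.r_pos, min_le_right _ _, fun θ hθ => ?_⟩
  have h3 : ContDiffAt ℝ 1 (fun w : Euc k × ℝ => M.link w.1 w.2) (θ, idx θ x) :=
    hsub (Metric.closedBall_subset_closedBall (min_le_left _ _) hθ)
  exact (ContinuousAt.comp (f := fun θ : Euc k => (θ, idx θ x)) h3.continuousAt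
    hc.continuousAt).continuousWithinAt

include hdens hlink hθ hclass h1 h2 h3 h4 hreg hb he in
-- Both perturbation lemmas apply on a ball adapted to `x`. Compactness provides the minimizers,
-- `crit_lt_crit` their consistency, and `isLittleO_crit` the curvature `W₀`.
theorem hasInfluence (hW : IsUnit M.W₀) {x : Euc (k + 1)} (hx : idx M.θ₀ x ∈ M.supp M.θ₀)
    (y : Sph d) :
    M.HasInfluence (x, y) (WithLp.toLp 2 (M.score (x, y) • M.W₀⁻¹.mulVec (M.dir e x))) := by
  obtain ⟨s, hs, hsr, hfit⟩ := exists_continuousOn_fit hreg hb hx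
  have hbs := hb.mono hs hsr
  have hcrit := continuousOn_crit h3 hreg hbs
  have hmin : ∀ θ ∈ Metric.closedBall M.θ₀ s, θ ≠ M.θ₀ → M.crit M.law M.θ₀ < M.crit M.law θ :=
    fun θ hθs hne => crit_lt_crit hdens hθ hclass h3 hreg hbs h2 h4 hθs hne
  set h : Euc k → ℝ := fun θ => M.loss (M.resid θ (x, y)) with hh
  have hhc : ContinuousOn h (Metric.closedBall M.θ₀ s) :=
    h3.diff.continuous.comp_continuousOn (continuousOn_const.sub hfit)
  have hcont : ∀ t ∈ Icc (0 : ℝ) 1, EqOn (M.crit (contaminate M.law (x, y) t))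
      (fun θ => (1 - t) * M.crit M.law θ + t * h θ) (Metric.closedBall M.θ₀ s) :=
    fun t ht θ hθs => crit_contaminate h3 hreg hbs hθs (x, y) ht
  have hIcc : ∀ᶠ t in 𝓝[>] (0 : ℝ), t ∈ Icc (0 : ℝ) 1 :=
    mem_of_superset (Ioc_mem_nhdsGT one_pos) Ioc_subset_Icc_self
  refine ⟨s, hs, hbs.subset, fun θ hθs => ?_, ?_, fun T hT => ?_⟩
  · rcases eq_or_ne θ M.θ₀ with rfl | hne
    · exact le_refl (M.crit M.law M.θ₀)
    · exact (hmin θ hθs hne).le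
  · filter_upwards [hIcc] with t ht
    have hc : ContinuousOn (M.crit (contaminate M.law (x, y) t)) (Metric.closedBall M.θ₀ s) :=
      ((hcrit.const_smul (1 - t)).add (hhc.const_smul t)).congr (hcont t ht)
    exact (isCompact_closedBall M.θ₀ s).exists_isMinOn ⟨_, hbs.mem_self⟩ hc
  have hT' : ∀ᶠ t in 𝓝[>] (0 : ℝ), T t ∈ Metric.closedBall M.θ₀ s ∧
      IsMinOn (fun θ => (1 - t) * M.crit M.law θ + t * h θ) (Metric.closedBall M.θ₀ s) (T t) := by
    filter_upwards [hT, hIcc] with t ht htI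
    refine ⟨ht.1, fun θ hθs => ?_⟩
    have := ht.2 hθs
    simp only [mem_ofPred_eq] at this ⊢
    rwa [hcont t htI hθs, hcont t htI ht.1] at this
  have hTlim := tendsto_argmin_of_perturb hs hcrit hhc hmin hT'
  have hPD := W₀_posDef hdens hlink hθ hclass h1 h3 hreg hbs he hW
  set W : Euc k →L[ℝ] Euc k := (Matrix.toLpLin 2 2 M.W₀).toContinuousLinearMap with hWdef
  have hWin : ∀ v w : Euc k, inner ℝ v (W w) = v.ofLp ⬝ᵥ M.W₀.mulVec w.ofLp := fun v w => by
    rw [EuclideanSpace.inner_eq_star_dotProduct, star_trivial, dotProduct_comm]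
    rfl
  have hsymm : ∀ v w : Euc k, inner ℝ (W v) w = inner ℝ v (W w) := fun v w => by
    have := W₀_isSymm hdens hlink hθ hclass h1 h3 hreg hbs he
    rw [real_inner_comm, hWin, hWin, Matrix.dotProduct_mulVec, ← Matrix.mulVec_transpose, this.eq,
      dotProduct_comm]
  obtain ⟨c, hc, hpos⟩ := exists_pos_mul_norm_sq_le W fun v hv => by
    have := hPD.dotProduct_mulVec_pos (x := v.ofLp) (fun h0 => hv (by ext i; simp [h0]))
    rw [star_trivial] at this
    rwa [hWin]
  refine tendsto_scaled_argmin_of_perturb (R := M.crit M.law) (h := h) hs hsymm hc hpos ?_ ?_ hTlim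
    (hT'.mono fun t ht => ht.2)
  · refine (isLittleO_crit hdens hlink hθ hclass h3 hreg hbs).congr_left fun θ => ?_
    rw [integral_inner_fitDeriv_hess_eq hdens hlink hθ hclass h1 h3 hreg hbs he, hWin]
  · have hder : HasFDerivAt h (innerSL ℝ (gradient M.loss (M.resid M.θ₀ (x, y))) ∘L
        (-M.fitDeriv x)) M.θ₀ := by
      have e1 : HasFDerivAt (fun θ => M.resid θ (x, y)) (-M.fitDeriv x) M.θ₀ :=
        (hasFDerivAt_fit hreg hθ hx).const_sub _
      exact HasFDerivAt.comp M.θ₀ (h3.diff _).hasGradientAt.hasFDerivAt e1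
    -- Applying `W₀` to the candidate undoes the inverse and leaves score times direction, which is
    -- minus the gradient of `h`; the sign comes from the fit being subtracted in the residual.
    refine (hder.isLittleO.norm_right).congr_left fun θ => ?_
    rw [hWin, Matrix.mulVec_smul, Matrix.mulVec_mulVec,
      Matrix.mul_nonsing_inv _ ((Matrix.isUnit_iff_isUnit_det _).1 hW), Matrix.one_mulVec,
      dotProduct_smul]
    simp only [ContinuousLinearMap.comp_apply, neg_apply, map_neg,
      innerSL_apply_apply]
    rw [fitDeriv_eq hdens hlink hθ hclass h1 h3 hreg hbs he hx, real_inner_smul_right,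
      dotProduct_comm (θ - M.θ₀).ofLp, smul_eq_mul]
    have : inner ℝ (gradient M.loss (M.resid M.θ₀ (x, y))) (deriv (M.link M.θ₀) (idx M.θ₀ x)) =
      M.score (x, y) := rfl
    rw [this]
    ring

end Influence

/-! ### Dispersion and standardization -/

/-- The dispersion matrix of the influence function. -/
theorem dispersion_eq_of_influence {e : ℝ → Euc (k + 1)} (hsymm : M.W₀.IsSymm)
    (hinf : ∀ᵐ z ∂M.law,
      M.influence z = WithLp.toLp 2 (M.score z • M.W₀⁻¹.mulVec (M.dir e z.1)))
    (hsq : ∀ i j, Integrable (fun z : Euc (k + 1) × Sph d =>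
      M.score z ^ 2 * (M.dir e z.1 i * M.dir e z.1 j)) M.law ∧
      ∫ z, M.score z ^ 2 * (M.dir e z.1 i * M.dir e z.1 j) ∂M.law = M.M₀ i j) :
    M.dispersion = M.W₀⁻¹ * M.M₀ * M.W₀⁻¹ := by
  ext i j
  have hV : ∀ a b, M.W₀⁻¹ a b = M.W₀⁻¹ b a := by
    intro a b
    have : M.W₀⁻¹.transpose = M.W₀⁻¹ := by rw [Matrix.transpose_nonsing_inv, hsymm.eq]
    conv_lhs => rw [← this]
    rfl
  have hae : (fun z => M.influence z i * M.influence z j) =ᵐ[M.law] fun z =>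
      ∑ b, ∑ a, (M.W₀⁻¹ i a * M.W₀⁻¹ b j) *
        (M.score z ^ 2 * (M.dir e z.1 a * M.dir e z.1 b)) := by
    filter_upwards [hinf] with z hz
    rw [hz]
    simp only [Pi.smul_apply, smul_eq_mul, Matrix.mulVec, dotProduct]
    rw [mul_mul_mul_comm, Finset.sum_mul_sum, Finset.sum_comm, Finset.mul_sum]
    refine Finset.sum_congr rfl fun b _ => ?_
    rw [Finset.mul_sum]
    refine Finset.sum_congr rfl fun a _ => ?_
    rw [hV b j]
    ring
  change ∫ z, M.influence z i * M.influence z j ∂M.law = _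
  rw [integral_congr_ae hae, integral_finsetSum _ fun b _ =>
    integrable_finsetSum _ fun a _ => (hsq a b).1.const_mul _, Matrix.mul_apply]
  refine Finset.sum_congr rfl fun b _ => ?_
  rw [integral_finsetSum _ fun a _ => (hsq a b).1.const_mul _, Matrix.mul_apply, Finset.sum_mul]
  refine Finset.sum_congr rfl fun a _ => ?_
  rw [integral_const_mul, (hsq a b).2]
  ring

/-- The inverse of the sandwich is `V * N⁻¹ * V`, and each outer factor cancels one `V⁻¹` of the
vector, with symmetry used on the left. The scalar leaves the root as `√(c²) = |c|`. -/
theorem sqrt_standardized_eq {V N : Matrix (Fin k) (Fin k) ℝ} (hV : V.IsSymm) (hVu : IsUnit V)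
    (c : ℝ) (b : Fin k → ℝ) :
    Real.sqrt ((c • V⁻¹.mulVec b) ⬝ᵥ (V⁻¹ * N * V⁻¹)⁻¹.mulVec (c • V⁻¹.mulVec b)) =
      |c| * Real.sqrt (b ⬝ᵥ N⁻¹.mulVec b) := by
  have hdet := (Matrix.isUnit_iff_isUnit_det _).1 hVu
  have h1 : (V⁻¹ * N * V⁻¹)⁻¹ = V * N⁻¹ * V := by
    rw [Matrix.mul_inv_rev, Matrix.mul_inv_rev, Matrix.nonsing_inv_nonsing_inv _ hdet,
      Matrix.mul_assoc]
  have h2 : (V⁻¹ * N * V⁻¹)⁻¹.mulVec (V⁻¹.mulVec b) = V.mulVec (N⁻¹.mulVec b) := by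
    rw [h1, Matrix.mulVec_mulVec, Matrix.mul_assoc, Matrix.mul_assoc,
      Matrix.mul_nonsing_inv _ hdet, Matrix.mul_one, Matrix.mulVec_mulVec]
  have h3 : V⁻¹.mulVec b ⬝ᵥ V.mulVec (N⁻¹.mulVec b) = b ⬝ᵥ N⁻¹.mulVec b := by
    rw [Matrix.dotProduct_mulVec, ← Matrix.mulVec_transpose, hV.eq, Matrix.mulVec_mulVec,
      Matrix.mul_nonsing_inv _ hdet, Matrix.one_mulVec]
  rw [Matrix.mulVec_smul, h2, smul_dotProduct, dotProduct_smul, h3, smul_eq_mul, smul_eq_mul,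
    ← mul_assoc, Real.sqrt_mul (mul_self_nonneg c), Real.sqrt_mul_self_eq_abs]

end ESIM

end

theorem theorem3 {d k : ℕ} (hd : 2 < d) (M : ESIM d k) (κ : ℝ) (hκ : 0 < κ)
    (hdens : M.HasDensities) (hlink : M.IsLink) (hθ : M.IsTrueParam) (hclass : M.InClass κ)
    (h1 : M.A1) (h2 : M.A2) (h3 : M.A3) (h4 : M.A4) (h5 : M.A5) (hreg : M.LinkRegular)
    (e : ℝ → Euc (k + 1)) (he : M.IsCondMean e) (hW : IsUnit M.W₀) :
    (∀ x ∈ M.dom, idx M.θ₀ x ∈ M.supp M.θ₀ → ∀ y : Sph d,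
      M.HasInfluence (x, y) (WithLp.toLp 2 (M.score (x, y) • M.W₀⁻¹.mulVec (M.dir e x))) ∧
      M.influence (x, y) = WithLp.toLp 2 (M.score (x, y) • M.W₀⁻¹.mulVec (M.dir e x))) ∧
    M.dispersion = M.W₀⁻¹ * M.M₀ * M.W₀⁻¹ ∧
    (IsUnit M.dispersion →
      ∀ x ∈ M.dom, idx M.θ₀ x ∈ M.supp M.θ₀ → ∀ y : Sph d,
        M.stdInfluence M.dispersion (x, y) =
          |M.score (x, y)| * Real.sqrt (M.dir e x ⬝ᵥ M.M₀⁻¹.mulVec (M.dir e x))) := by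
  obtain ⟨r, C, L, K, G, hb⟩ := ESIM.exists_localBounds hdens hθ.1 h1 h2 h3 hreg
  have hIF : ∀ x, idx M.θ₀ x ∈ M.supp M.θ₀ → ∀ y : Sph d,
      M.HasInfluence (x, y) (WithLp.toLp 2 (M.score (x, y) • M.W₀⁻¹.mulVec (M.dir e x))) :=
    fun x hx y => ESIM.hasInfluence hdens hlink hθ.1 hclass h1 h2 h3 h4 hreg hb he hW hx y
  have hsymm := ESIM.W₀_isSymm hdens hlink hθ.1 hclass h1 h3 hreg hb he
  have hdisp : M.dispersion = M.W₀⁻¹ * M.M₀ * M.W₀⁻¹ := by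
    refine ESIM.dispersion_eq_of_influence hsymm ?_
      (ESIM.integrable_score_sq hdens hlink hθ.1 hclass h1 h3 hreg hb he)
    -- The index lies in its support almost surely, so the pointwise formula determines the second
    -- moments.
    filter_upwards [ESIM.ae_idx_mem_supp hdens hθ.1] with z hz
    exact (hIF z.1 hz z.2).influence_eq
  refine ⟨fun x _ hx y => ⟨hIF x hx y, (hIF x hx y).influence_eq⟩, hdisp, fun _ x _ hx y => ?_⟩
  rw [ESIM.stdInfluence, (hIF x hx y).influence_eq, hdisp]
  exact ESIM.sqrt_standardized_eq hsymm hW _ _
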